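/- A partial group is a set $M$ with a set $\mathbf D(M)$ of words in $M$ that contains all one-letter words and is closed under prefixes and suffixes, a product $\Pi\colon \mathbf D(M)\to M$, and an involution $x\mapsto x^{-1}$, such that $\Pi(x)=x$; if $u\circ v\circ w\in\mathbf D(M)$ then $u\circ\Pi(v)\circ w\in\mathbf D(M)$ and both words have the same product; and if $u\in\mathbf D(M)$ then $u^{-1}\circ u\in\mathbf D(M)$ and $\Pi(u^{-1}\circ u)=\Pi(\emptyset)$, where $(x_1,\dots,x_n)^{-1}=(x_n^{-1},\dots,x_1^{-1})$. It is identified with the simplicial set whose $n$-simplices are the words $[x_1|\cdots|x_n]\in\mathbf D(M)$ of length $n$, whose face maps multiply adjacent letters or drop an outer letter, and whose degeneracies insert $\Pi(\emptyset)$. Let $\mathrm{Aut}(M)$ be the automorphism group of $M$, and let $\mathrm{Inn}(M)$ be the (normal) subgroup of those $\alpha$ for which there is a simplicial homotopy $M\times\Delta[1]\to M$ from $\alpha$ to $\mathrm{Id}_M$; put $\mathrm{Out}(M)=\mathrm{Aut}(M)/\mathrm{Inn}(M)$. Let $N(M)$ be the set of $\eta\in M$ such that (a) $[\eta|x|\eta^{-1}]\in\mathbf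 D(M)$ for all $x\in M$, and $x\mapsto{}^{\eta}x=\Pi[\eta|x|\eta^{-1}]$ is an automorphism of $M$; (b) for every $[x_1|\cdots|x_n]\in\mathbf D(M)$ and $0\le i\le n$ the word $[{}^{\eta}x_1|\cdots|{}^{\eta}x_i|\eta|x_{i+1}|\cdots|x_n]$ lies in $\mathbf D(M)$ and its product does not depend on $i$. Under the product of $M$, $N(M)$ is a group, and $Z(M)=\{\eta\in N(M) : {}^{\eta}x=x \text{ for all } x\in M\}$ is an abelian subgroup. Let $\mathrm{aut}(M)$ be the simplicial group whose $n$-simplices are the invertible elements of the monoid of simplicial maps $M\times\Delta[n]\to M$ under composition over $\Delta[n]$. Let $B\,\mathrm{aut}(M)=\overline W(\mathrm{aut}(M))$ be its classifying space; for an abelian group $A$ let $B^2A=\overline W(BA)$, where $BA$ is regarded as a simplicial abelian group. Theorem. Let $M$ be a partial group. Then: (i) every connected component of the simplicial set $\mathrm{aut}(M)$ is (simplicially) homotopy equivalent to $BZ(M)$; (ii) there is a Kan fibration $B\,\mathrm{aut}(M)\to B\,\mathrm{Out}(M)$ whose fibre is homotopy equivalent to $B^2Z(M)$, that is, a fibration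 $B^2Z(M)\to B\,\mathrm{aut}(M)\to B\,\mathrm{Out}(M)$; (iii) the sequence of groups $$1\to Z(M)\to N(M)\to \mathrm{Aut}(M)\to \mathrm{Out}(M)\to 1$$ is exact, where the maps are the inclusion, $\eta\mapsto(x\mapsto{}^{\eta}x)$, and the quotient map. -/

import Mathlib

open CategoryTheory Simplicial

universe u

/-- A partial group (Chermak): a set `M`, a set `dom` of words, a product `prod : dom → M` and an
inversion. Only the values of `prod` on `dom` carry information. -/
class PartialGroup (M : Type u) extends Inv M where
  dom : Set (List M)
  prod : List M → M
  singleton_mem : ∀ x : M, [x] ∈ dom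
  mem_of_append : ∀ u v : List M, u ++ v ∈ dom → u ∈ dom ∧ v ∈ dom
  prod_singleton : ∀ x : M, prod [x] = x
  prod_append : ∀ u v w : List M, u ++ v ++ w ∈ dom →
    u ++ [prod v] ++ w ∈ dom ∧ prod (u ++ v ++ w) = prod (u ++ [prod v] ++ w)
  inv_inv : ∀ x : M, x⁻¹⁻¹ = x
  inv_append : ∀ u : List M, u ∈ dom →
    (u.map (·⁻¹)).reverse ++ u ∈ dom ∧ prod ((u.map (·⁻¹)).reverse ++ u) = prod []

namespace PartialGroup

section Basic

variable {M : Type u} [PartialGroup M]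

/-- The inverse word. -/
def invWord (u : List M) : List M := (u.map (·⁻¹)).reverse

lemma invWord_append (u v : List M) : invWord (u ++ v) = invWord v ++ invWord u := by
  simp [invWord]

lemma invWord_cons (x : M) (v : List M) : invWord (x :: v) = invWord v ++ [x⁻¹] := by
  simp [invWord]

lemma invWord_invWord (u : List M) : invWord (invWord u) = u := by
  simp [invWord, Function.comp_def, inv_inv]

lemma left_mem {u v : List M} (h : u ++ v ∈ dom) : u ∈ dom := (mem_of_append u v h).1

lemma right_mem {u v : List M} (h : u ++ v ∈ dom) : v ∈ dom := (mem_of_append u v h).2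

lemma invWord_mem {u : List M} (h : u ∈ dom) : invWord u ∈ dom := left_mem (inv_append u h).1

lemma invWord_left {u v : List M} (h : u ++ v ∈ dom) : invWord u ++ (u ++ v) ∈ dom := by
  have h1 : invWord (u ++ v) ++ (u ++ v) ∈ dom := (inv_append _ h).1
  rw [invWord_append, List.append_assoc] at h1
  exact right_mem h1

lemma prod_cons_append {u v : List M} (h : u ++ v ∈ dom) :
    prod u :: v ∈ dom ∧ prod (u ++ v) = prod (prod u :: v) := by
  simpa using prod_append [] u v (by simpa using h)

lemma prod_append_cons {u v : List M} (h : u ++ v ∈ dom) :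
    u ++ [prod v] ∈ dom ∧ prod (u ++ v) = prod (u ++ [prod v]) := by
  simpa using prod_append u v [] (by simpa using h)

lemma prod_nil_cons {v : List M} (h : v ∈ dom) : prod (prod [] :: v) = prod v := by
  have := (prod_cons_append (u := []) (v := v) (by simpa using h)).2
  simpa using this.symm

lemma prod_invWord_left {u v : List M} (h : u ++ v ∈ dom) :
    prod (invWord u ++ (u ++ v)) = prod v := by
  have h1 := invWord_left h
  rw [← List.append_assoc] at h1 ⊢
  rw [(prod_cons_append h1).2, show prod (invWord u ++ u) = prod [] from
    (inv_append u (left_mem h)).2, prod_nil_cons (right_mem h)]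

lemma left_cancel {u v w : List M} (hv : u ++ v ∈ dom) (hw : u ++ w ∈ dom)
    (h : prod (u ++ v) = prod (u ++ w)) : prod v = prod w := by
  rw [← prod_invWord_left hv, ← prod_invWord_left hw, (prod_append_cons (invWord_left hv)).2,
    (prod_append_cons (invWord_left hw)).2, h]

lemma right_invWord {u v : List M} (h : u ++ v ∈ dom) : u ++ (v ++ invWord v) ∈ dom := by
  have h1 := invWord_left (u := invWord v) (v := invWord u)
    (by rw [← invWord_append]; exact invWord_mem h)
  have := invWord_mem h1
  simpa [invWord_append, invWord_invWord] using this

lemma prod_self_invWord {v : List M} (h : v ∈ dom) : prod (v ++ invWord v) = prod [] := by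
  have := (inv_append _ (invWord_mem h)).2
  rwa [show ((invWord v).map (·⁻¹)).reverse = v from invWord_invWord v] at this

lemma prod_right_invWord {u v : List M} (h : u ++ v ∈ dom) :
    prod (u ++ (v ++ invWord v)) = prod u := by
  have h0 : u ++ [] ∈ dom := by simpa using left_mem h
  rw [(prod_append_cons (right_invWord h)).2, prod_self_invWord (right_mem h),
    ← (prod_append_cons h0).2, List.append_nil]

lemma right_cancel {u v w : List M} (hv : v ++ u ∈ dom) (hw : w ++ u ∈ dom)
    (h : prod (v ++ u) = prod (w ++ u)) : prod v = prod w := by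
  have h1 := right_invWord hv
  have h2 := right_invWord hw
  rw [← prod_right_invWord hv, ← prod_right_invWord hw]
  rw [← List.append_assoc] at h1 h2 ⊢
  rw [(prod_cons_append h1).2, h, ← (prod_cons_append h2).2, List.append_assoc]

lemma prod_invWord {u : List M} (h : u ∈ dom) : prod (invWord u) = (prod u)⁻¹ := by
  have h1 : invWord u ++ u ∈ dom := (inv_append u h).1
  have h2 : invWord [prod u] ++ [prod u] ∈ dom := (inv_append _ (singleton_mem _)).1
  have h3 := prod_append_cons h1
  have := right_cancel h3.1 h2 (by
    rw [← h3.2]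
    exact (inv_append u h).2.trans (inv_append [prod u] (singleton_mem _)).2.symm)
  simpa [invWord, prod_singleton] using this

variable (M) in
/-- The group of automorphisms of a partial group: the bijections which, together with their
inverses, preserve words in the domain and their products. -/
def Aut : Subgroup (Equiv.Perm M) where
  carrier := {α | (∀ w : List M, w.map α ∈ dom ↔ w ∈ dom) ∧
    ∀ w : List M, w ∈ dom → prod (w.map α) = α (prod w)}
  one_mem' := by simp
  mul_mem' := by
    rintro α β ⟨h1, h2⟩ ⟨h3, h4⟩
    have e : ∀ w : List M, w.map (α * β) = (w.map β).map α := fun w ↦ by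
      simp [Function.comp_def]
    refine ⟨fun w ↦ ?_, fun w hw ↦ ?_⟩
    · rw [e, h1, h3]
    · rw [e, h2 _ ((h3 w).2 hw), h4 w hw]; rfl
  inv_mem' := by
    rintro α ⟨h1, h2⟩
    have e : ∀ w : List M, (w.map ⇑α⁻¹).map α = w := fun w ↦ by
      simp [Function.comp_def]
    refine ⟨fun w ↦ ?_, fun w hw ↦ ?_⟩
    · rw [← h1, e]
    · have : w.map ⇑α⁻¹ ∈ dom := by rw [← h1, e]; exact hw
      have h3 := h2 _ this
      rw [e] at h3
      rw [h3]; simp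

lemma Aut.map_mem (α : Aut M) {w : List M} (h : w ∈ dom) : w.map α.1 ∈ dom := (α.2.1 w).2 h

lemma Aut.prod_map (α : Aut M) {w : List M} (h : w ∈ dom) : prod (w.map α.1) = α.1 (prod w) :=
  α.2.2 w h

lemma Aut.map_one (α : Aut M) : α.1 (prod []) = prod [] := by
  have : ([] : List M) ∈ dom := left_mem (v := [prod []]) (by simpa using singleton_mem _)
  simpa using (Aut.prod_map α this).symm

lemma Aut.map_inv (α : Aut M) (x : M) : α.1 x⁻¹ = (α.1 x)⁻¹ := by
  have h1 : [x⁻¹] ++ [x] ∈ dom := by simpa using (inv_append [x] (singleton_mem _)).1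
  have h2 : [(α.1 x)⁻¹] ++ [α.1 x] ∈ dom := by
    simpa using (inv_append [α.1 x] (singleton_mem _)).1
  have h1' : prod ([x⁻¹] ++ [x]) = prod [] := by simpa using (inv_append [x] (singleton_mem _)).2
  have h2' : prod ([(α.1 x)⁻¹] ++ [α.1 x]) = prod [] := by
    simpa using (inv_append [α.1 x] (singleton_mem _)).2
  have h3 := Aut.map_mem α h1
  have h4 := Aut.prod_map α h1
  rw [h1', Aut.map_one α] at h4
  have := right_cancel (u := [α.1 x]) (v := [α.1 x⁻¹]) (w := [(α.1 x)⁻¹]) h3 h2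
    (h4.trans h2'.symm)
  simpa [prod_singleton] using this

lemma Aut.map_invWord (α : Aut M) (u : List M) : (invWord u).map α.1 = invWord (u.map α.1) := by
  simp [invWord, List.map_reverse, Function.comp_def, Aut.map_inv α]

/-! ### The normalizer and the centre -/

/-- Left conjugation `η · x · η⁻¹`. -/
def conj (η x : M) : M := prod [η, x, η⁻¹]

/-- The elements of the normalizer `N(M)`. -/
structure IsNormalizing (η : M) : Prop where
  conj_mem : ∀ x : M, [η, x, η⁻¹] ∈ dom
  conj_aut : ∃ α : Aut M, ∀ x : M, α.1 x = conj η x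
  split_mem : ∀ w : List M, w ∈ dom → ∀ i ≤ w.length,
    (w.take i).map (conj η) ++ η :: w.drop i ∈ dom
  prod_split : ∀ w : List M, w ∈ dom → ∀ i ≤ w.length,
    prod ((w.take i).map (conj η) ++ η :: w.drop i) = prod (η :: w)

/-- Auxiliary reformulation of `IsNormalizing`. -/
def Intertwines (α : Aut M) (η : M) : Prop := ∀ u v : List M, u ++ v ∈ dom →
  u.map α.1 ++ η :: v ∈ dom ∧ prod (u.map α.1 ++ η :: v) = prod (η :: (u ++ v))

lemma IsNormalizing.intertwines {η : M} (h : IsNormalizing η) {α : Aut M}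
    (hα : ∀ x : M, α.1 x = conj η x) : Intertwines α η := by
  intro u v huv
  have e : (conj η : M → M) = α.1 := funext fun x ↦ (hα x).symm
  have h1 := h.split_mem _ huv u.length (by simp)
  have h2 := h.prod_split _ huv u.length (by simp)
  rw [e] at h1 h2
  simp only [List.take_left, List.drop_left] at h1 h2
  exact ⟨h1, h2⟩

lemma Intertwines.inv_aux {η : M} {α : Aut M} (h : Intertwines α η) {u v : List M}
    (huv : u ++ v ∈ dom) : u ++ η⁻¹ :: v.map α.1 ∈ dom := by
  have h1 := invWord_mem huv
  rw [invWord_append] at h1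
  have h2 := invWord_mem (h _ _ h1).1
  rw [invWord_append, invWord_cons, invWord_invWord, ← Aut.map_invWord α, invWord_invWord] at h2
  simpa using h2

lemma Intertwines.conj_mem {η : M} {α : Aut M} (h : Intertwines α η) (x : M) :
    [η, x, η⁻¹] ∈ dom := by
  have h1 := (h [] [x] (singleton_mem x)).1
  simpa using h.inv_aux (u := [η, x]) (v := []) (by simpa using h1)

lemma Intertwines.conj_eq {η : M} {α : Aut M} (h : Intertwines α η) (x : M) :
    α.1 x = conj η x := by
  have h1 := h [x] [] (singleton_mem x)
  simp only [List.map_cons, List.map_nil, List.append_nil] at h1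
  have h2 := h.conj_mem x
  have h3 : [α.1 x] ++ [η] ∈ dom := h1.1
  have h4 : prod [α.1 x, η, η⁻¹] = α.1 x := by
    have := prod_right_invWord h3
    simpa [invWord, prod_singleton] using this
  have h5 : [α.1 x, η, η⁻¹] ∈ dom := by
    have := right_invWord h3
    simpa [invWord] using this
  have e1 := (prod_cons_append (u := [η, x]) (v := [η⁻¹]) h2).2
  have e2 := (prod_cons_append (u := [α.1 x, η]) (v := [η⁻¹]) h5).2
  rw [← h4, conj]
  refine e2.trans (Eq.trans ?_ e1.symm)
  rw [show prod [α.1 x, η] = prod [η, x] from h1.2]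

lemma Intertwines.isNormalizing {η : M} {α : Aut M} (h : Intertwines α η) : IsNormalizing η := by
  have e : (conj η : M → M) = α.1 := funext fun x ↦ (h.conj_eq x).symm
  refine ⟨h.conj_mem, ⟨α, h.conj_eq⟩, fun w hw i _ ↦ ?_, fun w hw i _ ↦ ?_⟩
  · rw [e]; exact (h _ _ (by simpa using hw)).1
  · rw [e, (h _ _ (by simpa using hw)).2]; simp

lemma Intertwines.one : Intertwines (1 : Aut M) (prod [] : M) := by
  intro u v huv
  have h1 := prod_append u [] v (by simpa using huv)
  have h2 := prod_append [] [] (u ++ v) (by simpa using huv)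
  simp only [List.append_nil, List.nil_append, List.append_assoc, List.singleton_append] at h1 h2
  have e : u.map (1 : Aut M).1 = u := by simp
  rw [e]
  exact ⟨h1.1, h1.2.symm.trans h2.2⟩

lemma Intertwines.mul_mem {η σ : M} {α : Aut M} (h : Intertwines α η) {w : List M}
    (hw : σ :: w ∈ dom) : η :: σ :: w ∈ dom := by
  simpa using (h [] (σ :: w) (by simpa using hw)).1

lemma Intertwines.cons_mem {η : M} {α : Aut M} (h : Intertwines α η) {w : List M}
    (hw : w ∈ dom) : η :: w ∈ dom := by
  simpa using (h [] w (by simpa using hw)).1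

lemma Intertwines.mul {η σ : M} {α β : Aut M} (h : Intertwines α η) (k : Intertwines β σ) :
    Intertwines (α * β) (prod [η, σ]) := by
  intro u v huv
  obtain ⟨k1, k2⟩ := k u v huv
  obtain ⟨h1, h2⟩ := h _ _ k1
  have e : u.map (α * β).1 = (u.map β.1).map α.1 := by simp [Function.comp_def]
  have h3 := prod_append ((u.map β.1).map α.1) [η, σ] v (by simpa using h1)
  have h4 := prod_cons_append (u := [η, σ]) (v := u ++ v)
    (h.cons_mem (k.cons_mem huv))
  have h5 := prod_append_cons (u := [η]) (v := u.map β.1 ++ σ :: v) (h.cons_mem k1)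
  have h6 := prod_append_cons (u := [η]) (v := σ :: (u ++ v)) (h.cons_mem (k.cons_mem huv))
  rw [e]
  simp only [List.append_assoc, List.cons_append, List.nil_append] at h3 h4 h5 h6
  refine ⟨h3.1, ?_⟩
  rw [← h3.2, ← h4.2, h2, h5.2, h6.2, k2]

lemma Intertwines.inv {η : M} {α : Aut M} (h : Intertwines α η) : Intertwines α⁻¹ η⁻¹ := by
  have key : ∀ u v : List M, u ++ v ∈ dom → u.map (α⁻¹).1 ++ η⁻¹ :: v ∈ dom := by
    intro u v huv
    have h1 := Aut.map_mem α⁻¹ huv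
    rw [List.map_append] at h1
    have h2 := h.inv_aux h1
    simpa [Function.comp_def] using h2
  have unit : ∀ w : List M, w ∈ dom → prod (η :: η⁻¹ :: w) = prod w := by
    intro w hw
    have h1 := key [] w hw
    have h2 := h.cons_mem h1
    have h3 := (prod_cons_append (u := [η, η⁻¹]) (v := w) (by simpa using h2)).2
    have h4 : prod [η, η⁻¹] = prod [] := by
      simpa [invWord] using prod_self_invWord (singleton_mem η)
    rw [h4, prod_nil_cons hw] at h3
    simpa using h3
  intro u v huv
  have h1 := key u v huv
  refine ⟨h1, ?_⟩
  have h2 := key [] (u ++ v) (by simpa using huv)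
  refine left_cancel (u := [η]) (h.cons_mem h1) (h.cons_mem h2) ?_
  have h3 := (h _ _ h1).2
  have e : (u.map (α⁻¹).1).map α.1 = u := by simp [Function.comp_def]
  rw [e] at h3
  simp only [List.cons_append, List.nil_append] at h3 ⊢
  simp only [List.map_nil, List.nil_append] at h2
  rw [← h3, unit _ huv]
  have h4 : u ++ [η] ++ (η⁻¹ :: v) ∈ dom := by
    have := (h _ _ h1).1
    rw [e] at this
    simpa using this
  have h5 := prod_append u [η, η⁻¹] v (by simpa using h4)
  have h6 : prod [η, η⁻¹] = prod [] := by
    simpa [invWord] using prod_self_invWord (singleton_mem η)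
  have h7 := prod_append u [] v (by simpa using huv)
  rw [h6] at h5
  have := h5.2.trans h7.2.symm
  simpa using this

lemma IsNormalizing.exists_intertwines {η : M} (h : IsNormalizing η) :
    ∃ α : Aut M, Intertwines α η :=
  h.conj_aut.imp fun _ hα ↦ h.intertwines hα

variable (M) in
/-- The normalizer `N(M)`, a group under the product of `M`. -/
def Normalizer : Type u := {η : M // IsNormalizing η}

instance : Group (Normalizer M) where
  mul a b := ⟨prod [a.1, b.1], by
    obtain ⟨α, h⟩ := a.2.exists_intertwines
    obtain ⟨β, k⟩ := b.2.exists_intertwines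
    exact (h.mul k).isNormalizing⟩
  one := ⟨prod [], Intertwines.one.isNormalizing⟩
  inv a := ⟨a.1⁻¹, by
    obtain ⟨α, h⟩ := a.2.exists_intertwines
    exact h.inv.isNormalizing⟩
  mul_assoc a b c := by
    obtain ⟨α, h⟩ := a.2.exists_intertwines
    obtain ⟨β, k⟩ := b.2.exists_intertwines
    have h1 : [a.1, b.1, c.1] ∈ dom := h.cons_mem (k.cons_mem (singleton_mem c.1))
    have h2 := (prod_cons_append (u := [a.1, b.1]) (v := [c.1]) h1).2
    have h3 := (prod_append_cons (u := [a.1]) (v := [b.1, c.1]) h1).2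
    exact Subtype.ext (h2.symm.trans h3)
  one_mul a := Subtype.ext ((prod_nil_cons (singleton_mem a.1)).trans (prod_singleton _))
  mul_one a := by
    have h1 := (prod_append_cons (u := [a.1]) (v := []) (singleton_mem a.1)).2
    exact Subtype.ext (h1.symm.trans (prod_singleton _))
  inv_mul_cancel a := Subtype.ext (inv_append [a.1] (singleton_mem _)).2

lemma Normalizer.mul_val (a b : Normalizer M) : (a * b).1 = prod [a.1, b.1] := rfl

lemma Normalizer.one_val : (1 : Normalizer M).1 = prod [] := rfl

lemma Normalizer.inv_val (a : Normalizer M) : (a⁻¹).1 = a.1⁻¹ := rfl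

lemma Normalizer.exists_conjAut (η : Normalizer M) :
    ∃ α : Aut M, ∀ x : M, α.1 x = conj η.1 x := η.2.conj_aut

variable (M) in
/-- Left conjugation as a homomorphism `N(M) → Aut(M)`. -/
noncomputable def conjHom : Normalizer M →* Aut M where
  toFun η := η.exists_conjAut.choose
  map_one' := by
    apply Subtype.ext
    ext x
    rw [(Normalizer.exists_conjAut 1).choose_spec x]
    exact (Intertwines.one.conj_eq x).symm
  map_mul' a b := by
    apply Subtype.ext
    ext x
    rw [(Normalizer.exists_conjAut (a * b)).choose_spec x]
    exact (((a.2.intertwines a.exists_conjAut.choose_spec).mul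
      (b.2.intertwines b.exists_conjAut.choose_spec)).conj_eq x).symm

lemma conjHom_apply (η : Normalizer M) (x : M) : (conjHom M η).1 x = conj η.1 x :=
  η.exists_conjAut.choose_spec x

lemma conjHom_eq_one_iff (η : Normalizer M) : conjHom M η = 1 ↔ ∀ x : M, conj η.1 x = x := by
  refine ⟨fun h x ↦ ?_, fun h ↦ Subtype.ext (Equiv.ext fun x ↦ ?_)⟩
  · rw [← conjHom_apply, h]; rfl
  · rw [conjHom_apply, h]; rfl

variable (M) in
/-- The centre `Z(M)`, as a subgroup of `N(M)`. -/
def Center : Subgroup (Normalizer M) where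
  carrier := {η | ∀ x : M, conj η.1 x = x}
  one_mem' := (conjHom_eq_one_iff 1).1 (map_one _)
  mul_mem' {a b} ha hb := by
    refine (conjHom_eq_one_iff (a * b)).1 ?_
    rw [map_mul, (conjHom_eq_one_iff a).2 ha, (conjHom_eq_one_iff b).2 hb, one_mul]
  inv_mem' {a} ha := by
    refine (conjHom_eq_one_iff a⁻¹).1 ?_
    rw [map_inv, (conjHom_eq_one_iff a).2 ha, inv_one]

instance : CommGroup (Center M) where
  mul_comm a b := by
    have h := a.1.2.split_mem [b.1.1] (singleton_mem _) 1 (by simp)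
    have h2 := a.1.2.prod_split [b.1.1] (singleton_mem _) 1 (by simp)
    have e : conj a.1.1 b.1.1 = b.1.1 := a.2 b.1.1
    apply Subtype.ext
    apply Subtype.ext
    have h3 : prod [conj a.1.1 b.1.1, a.1.1] = prod [a.1.1, b.1.1] := h2
    rw [e] at h3
    exact h3.symm

end Basic


/-! ### The simplicial set of a partial group -/

section Nerve

variable {M : Type u} [PartialGroup M]

/-- The letters of `w` in positions `a + 1, …, b`. -/
def slice {α : Type*} (w : List α) (a b : ℕ) : List α := (w.take b).drop a

lemma slice_self {α : Type*} (w : List α) (a : ℕ) : slice w a a = [] := by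
  simp [slice]

lemma slice_append_slice {α : Type*} (w : List α) {a b c : ℕ} (hab : a ≤ b) (hbc : b ≤ c) :
    slice w a b ++ slice w b c = slice w a c := by
  have e : (w.take c).take b = w.take b := by rw [List.take_take, min_eq_left hbc]
  have h1 : slice w a b = ((w.take c).drop a).take (b - a) := by
    rw [slice, ← e, List.drop_take]
  have h2 : slice w b c = ((w.take c).drop a).drop (b - a) := by
    rw [slice, List.drop_drop, Nat.add_sub_cancel' hab]
  rw [h1, h2, List.take_append_drop, slice]

lemma slice_succ {α : Type*} (w : List α) {a b : ℕ} (hab : a ≤ b) (hb : b < w.length) :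
    slice w a (b + 1) = slice w a b ++ [w[b]] := by
  rw [← slice_append_slice w hab (Nat.le_succ b)]
  congr 1
  rw [slice, List.take_succ_eq_append_getElem hb, List.drop_append_of_le_length (by simp; omega)]
  simp

lemma slice_map {α β : Type*} (f : α → β) (w : List α) (a b : ℕ) :
    slice (w.map f) a b = (slice w a b).map f := by
  simp [slice, List.map_take, List.map_drop]

lemma slice_mem {w : List M} (h : w ∈ dom) (a b : ℕ) : slice w a b ∈ dom := by
  have h1 : w.take b ++ w.drop b ∈ dom := by simpa using h
  have h2 : (w.take b).take a ++ (w.take b).drop a ∈ dom := by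
    rw [List.take_append_drop]; exact left_mem h1
  exact right_mem h2

lemma flatten_mem (L : List (List M)) : ∀ u : List M, u ++ L.flatten ∈ dom →
    u ++ L.map prod ∈ dom ∧ prod (u ++ L.map prod) = prod (u ++ L.flatten) := by
  induction L with
  | nil => intro u h; simpa using h
  | cons v L ih =>
    intro u h
    have h1 := prod_append u v L.flatten (by simpa using h)
    obtain ⟨h2, h3⟩ := ih (u ++ [prod v]) h1.1
    refine ⟨by simpa using h2, ?_⟩
    have h4 := h3.trans h1.2.symm
    simpa using h4

/-- The consecutive blocks of `w` cut out by `θ`. -/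
def blocks {α : Type*} {m n : ℕ} (θ : Fin (m + 1) →o Fin (n + 1)) (w : List α) : List (List α) :=
  List.ofFn fun i : Fin m ↦ slice w (θ i.castSucc) (θ i.succ)

lemma flatten_slice_blocks {α : Type*} {m n : ℕ} (θ : Fin (m + 1) →o Fin (n + 1)) (w : List α)
    {a b : Fin (m + 1)} (hab : a ≤ b) :
    (slice (blocks θ w) a b).flatten = slice w (θ a) (θ b) := by
  obtain ⟨a, ha⟩ := a
  obtain ⟨b, hb⟩ := b
  have hab' : a ≤ b := hab
  clear hab
  dsimp only
  induction b, hab' using Nat.le_induction with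
  | base => simp [slice_self]
  | succ b hab ih =>
    have hb' : b < (blocks θ w).length := by simp [blocks]; omega
    rw [slice_succ _ hab hb', List.flatten_append, ih (by omega)]
    have e : (blocks θ w)[b] =
        slice w (θ (⟨b, by omega⟩ : Fin (m + 1))) (θ (⟨b + 1, hb⟩ : Fin (m + 1))) := by
      simp [blocks]
    rw [e]
    simp only [List.flatten_cons, List.flatten_nil, List.append_nil]
    exact slice_append_slice w (θ.monotone (Fin.mk_le_mk.2 hab))
      (θ.monotone (Fin.mk_le_mk.2 (Nat.le_succ b)))

/-- The simplicial operator `θ^*`: multiply the letters inside each block cut out by `θ`. The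
face operators of this action are `d₀[x₁|…|xₙ] = [x₂|…|xₙ]`, `dᵢ = [x₁|…|xᵢ·xᵢ₊₁|…|xₙ]`,
`dₙ = [x₁|…|xₙ₋₁]`, and the degeneracies insert the unit `prod []`. -/
def restrictWord {m n : ℕ} (θ : Fin (m + 1) →o Fin (n + 1)) (w : List M) : List M :=
  List.ofFn fun i : Fin m ↦ prod (slice w (θ i.castSucc) (θ i.succ))

lemma restrictWord_eq {m n : ℕ} (θ : Fin (m + 1) →o Fin (n + 1)) (w : List M) :
    restrictWord θ w = (blocks θ w).map prod := by
  simp [restrictWord, blocks, List.map_ofFn, Function.comp_def]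

lemma flatten_blocks {α : Type*} {m n : ℕ} (θ : Fin (m + 1) →o Fin (n + 1)) (w : List α) :
    (blocks θ w).flatten = slice w (θ 0) (θ (Fin.last m)) := by
  rw [← flatten_slice_blocks θ w (Fin.zero_le (Fin.last m))]
  simp [slice, blocks, List.take_of_length_le]

lemma restrictWord_mem {m n : ℕ} (θ : Fin (m + 1) →o Fin (n + 1)) {w : List M} (h : w ∈ dom) :
    restrictWord θ w ∈ dom := by
  have := (flatten_mem (blocks θ w) [] (by
    rw [List.nil_append, flatten_blocks]; exact slice_mem h _ _)).1
  rwa [restrictWord_eq]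

lemma prod_slice_restrictWord {m n : ℕ} (θ : Fin (m + 1) →o Fin (n + 1)) {w : List M}
    (h : w ∈ dom) {a b : Fin (m + 1)} (hab : a ≤ b) :
    prod (slice (restrictWord θ w) a b) = prod (slice w (θ a) (θ b)) := by
  rw [restrictWord_eq, slice_map, ← flatten_slice_blocks θ w hab]
  have := (flatten_mem (slice (blocks θ w) a b) [] (by
    rw [List.nil_append, flatten_slice_blocks θ w hab]; exact slice_mem h _ _)).2
  simpa using this

lemma restrictWord_id {n : ℕ} {w : List M} (hw : w.length = n) :
    restrictWord (OrderHom.id : Fin (n + 1) →o Fin (n + 1)) w = w := by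
  subst hw
  apply List.ext_getElem
  · simp [restrictWord]
  · intro i h1 h2
    simp only [restrictWord, List.getElem_ofFn]
    simp [slice_succ w le_rfl h2, slice_self, prod_singleton]

lemma restrictWord_comp {l m n : ℕ} (φ : Fin (l + 1) →o Fin (m + 1))
    (θ : Fin (m + 1) →o Fin (n + 1)) {w : List M} (hw : w ∈ dom) :
    restrictWord (θ.comp φ) w = restrictWord φ (restrictWord θ w) := by
  simp only [restrictWord]
  congr 1
  funext i
  exact (prod_slice_restrictWord θ hw (φ.monotone (Fin.castSucc_lt_succ (i := i)).le)).symm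

variable (M) in
/-- The simplicial set of a partial group: the `n`-simplices are the words `[x₁|…|xₙ]` of length
`n` in the domain. -/
def nerve : SSet.{u} where
  obj n := {w : List M // w ∈ dom ∧ w.length = n.unop.len}
  map θ := ↾fun w ↦ ⟨restrictWord θ.unop.toOrderHom w.1, restrictWord_mem _ w.2.1,
    by simp [restrictWord]⟩
  map_id n := by
    ext w : 3
    exact Subtype.ext (restrictWord_id w.2.2)
  map_comp θ φ := by
    ext w : 3
    exact Subtype.ext <| restrictWord_comp φ.unop.toOrderHom θ.unop.toOrderHom w.2.1

lemma restrictWord_map {m n : ℕ} (θ : Fin (m + 1) →o Fin (n + 1)) (α : Aut M) {w : List M}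
    (hw : w ∈ dom) : restrictWord θ (w.map α.1) = (restrictWord θ w).map α.1 := by
  simp only [restrictWord, List.map_ofFn]
  congr 1
  funext i
  rw [slice_map, Aut.prod_map α (slice_mem hw _ _)]
  rfl

/-- The simplicial map induced by an automorphism. -/
def nerveMap (α : Aut M) : nerve M ⟶ nerve M where
  app n := ↾fun w ↦ ⟨w.1.map α.1, Aut.map_mem α w.2.1, by simpa using w.2.2⟩
  naturality m n θ := by
    ext w
    apply Subtype.ext
    exact (restrictWord_map θ.unop.toOrderHom α w.2.1).symm

lemma nerveMap_one : nerveMap (1 : Aut M) = 𝟙 (nerve M) := by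
  ext n w
  apply Subtype.ext
  change w.1.map (1 : Aut M).1 = w.1
  simp

lemma nerveMap_mul (α β : Aut M) : nerveMap (α * β) = nerveMap β ≫ nerveMap α := by
  ext n w
  apply Subtype.ext
  change w.1.map (α * β).1 = (w.1.map β.1).map α.1
  simp [Function.comp_def]

lemma slice_reverse {α : Type*} (w : List α) {a b : ℕ} (hb : b ≤ w.length) :
    slice w.reverse a b = (slice w (w.length - b) (w.length - a)).reverse := by
  simp only [slice, List.take_reverse, List.drop_reverse, List.drop_take, List.length_drop]
  congr 2
  omega

lemma restrictWord_rev {m n : SimplexCategory} (θ : m ⟶ n) {w : List M} (hw : w ∈ dom)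
    (hl : w.length = n.len) :
    restrictWord (SimplexCategory.rev.map θ).toOrderHom (invWord w) =
      invWord (restrictWord θ.toOrderHom w) := by
  apply List.ext_getElem
  · simp [restrictWord, invWord]
  · intro i h1 h2
    have hi : i < m.len := by simpa [restrictWord] using h1
    simp only [restrictWord, invWord, List.getElem_ofFn, List.getElem_reverse, List.getElem_map,
      List.length_map, List.length_ofFn, SimplexCategory.rev_map_apply]
    rw [slice_reverse _ (by simp [hl]), slice_map]
    change prod (invWord _) = _
    rw [prod_invWord (slice_mem hw _ _)]
    congr 3
    · rw [List.length_map, hl]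
      simp only [Fin.val_rev]
      have : (Fin.succ (⟨i, hi⟩ : Fin m.len)).rev = Fin.castSucc ⟨m.len - 1 - i, by omega⟩ := by
        ext; simp [Fin.val_rev]; omega
      rw [this]
      have hn : (SimplexCategory.rev.obj n).len = n.len := rfl
      omega
    · rw [List.length_map, hl]
      simp only [Fin.val_rev]
      have : (Fin.castSucc (⟨i, hi⟩ : Fin m.len)).rev = Fin.succ ⟨m.len - 1 - i, by omega⟩ := by
        ext; simp [Fin.val_rev]; omega
      rw [this]
      have hn : (SimplexCategory.rev.obj n).len = n.len := rfl
      omega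

end Nerve

/-! ### Homotopies, inner and outer automorphisms -/

section Outer

open MonoidalCategory CartesianMonoidalCategory

/-- There is a simplicial homotopy `h : X × Δ[1] → Y` from `f` to `g`. -/
def Homotopic {X Y : SSet.{u}} (f g : X ⟶ Y) : Prop :=
  ∃ h : X ⊗ Δ[1] ⟶ Y, SSet.ι₀ ≫ h = f ∧ SSet.ι₁ ≫ h = g

variable {M : Type u} [PartialGroup M]

/-- The inversion `[x₁|…|xₙ] ↦ [xₙ⁻¹|…|x₁⁻¹]` in a fixed dimension. -/
def revSimplex {n : SimplexCategoryᵒᵖ} (w : (nerve M).obj n) : (nerve M).obj n :=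
  ⟨invWord w.1, invWord_mem w.2.1, by simpa [invWord] using w.2.2⟩

lemma revSimplex_revSimplex {n : SimplexCategoryᵒᵖ} (w : (nerve M).obj n) :
    revSimplex (revSimplex w) = w := Subtype.ext (invWord_invWord w.1)

lemma revSimplex_map {n m : SimplexCategoryᵒᵖ} (θ : n ⟶ m) (w : (nerve M).obj n) :
    revSimplex ((nerve M).map θ w) =
      (nerve M).map (SimplexCategory.rev.map θ.unop).op (revSimplex w) :=
  Subtype.ext (restrictWord_rev θ.unop w.2.1 w.2.2).symm

lemma revSimplex_nerveMap (α : Aut M) {n : SimplexCategoryᵒᵖ} (w : (nerve M).obj n) :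
    revSimplex ((nerveMap α).app n w) = (nerveMap α).app n (revSimplex w) :=
  Subtype.ext (Aut.map_invWord α w.1).symm

lemma Homotopic.reverse {α β : Aut M} (h : Homotopic (nerveMap α) (nerveMap β)) :
    Homotopic (nerveMap β) (nerveMap α) := by
  obtain ⟨h, h0, h1⟩ := h
  let r (n : SimplexCategoryᵒᵖ) (t : (Δ[1] : SSet.{u}).obj n) : (Δ[1] : SSet.{u}).obj n :=
    SSet.stdSimplex.objEquiv.symm (SimplexCategory.rev.map (SSet.stdSimplex.objEquiv t))
  have hnat {n m : SimplexCategoryᵒᵖ} (θ : n ⟶ m) (x : (nerve M).obj n)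
      (t : (Δ[1] : SSet.{u}).obj n) :
      h.app m ((nerve M).map θ x, (Δ[1] : SSet.{u}).map θ t) =
        (nerve M).map θ (h.app n (x, t)) :=
    congrArg (fun f : (nerve M ⊗ Δ[1]).obj n ⟶ (nerve M).obj m ↦ f (x, t)) (h.naturality θ)
  refine ⟨{ app := fun n ↦ ↾fun p ↦ revSimplex (h.app n (revSimplex p.1, r n p.2))
            naturality := fun n m θ ↦ ?_ }, ?_, ?_⟩
  · ext p
    obtain ⟨x, t⟩ := p
    change revSimplex (h.app m (revSimplex ((nerve M).map θ x), r m ((Δ[1] : SSet.{u}).map θ t)))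
      = (nerve M).map θ (revSimplex (h.app n (revSimplex x, r n t)))
    have e : r m ((Δ[1] : SSet.{u}).map θ t) =
        (Δ[1] : SSet.{u}).map (SimplexCategory.rev.map θ.unop).op (r n t) := by
      apply SSet.stdSimplex.objEquiv.injective
      exact SimplexCategory.rev.map_comp θ.unop (SSet.stdSimplex.objEquiv t)
    rw [revSimplex_map, e, hnat, revSimplex_map]
    simp
  · ext n x
    have e := congrArg (fun f : nerve M ⟶ nerve M ↦ f.app n (revSimplex x)) h1
    exact (congrArg revSimplex e).trans ((revSimplex_nerveMap β (revSimplex x)).trans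
      (congrArg ((nerveMap β).app n) (revSimplex_revSimplex x)))
  · ext n x
    have e := congrArg (fun f : nerve M ⟶ nerve M ↦ f.app n (revSimplex x)) h0
    exact (congrArg revSimplex e).trans ((revSimplex_nerveMap α (revSimplex x)).trans
      (congrArg ((nerveMap α).app n) (revSimplex_revSimplex x)))

lemma Homotopic.comp {X Y Z : SSet.{u}} {f g : X ⟶ Y} {f' g' : Y ⟶ Z} (h : Homotopic f g)
    (h' : Homotopic f' g') : Homotopic (f ≫ f') (g ≫ g') := by
  obtain ⟨h, rfl, rfl⟩ := h
  obtain ⟨h', rfl, rfl⟩ := h'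
  exact ⟨lift h (snd _ _) ≫ h', rfl, rfl⟩

lemma Homotopic.refl {X Y : SSet.{u}} (f : X ⟶ Y) : Homotopic f f :=
  ⟨fst _ _ ≫ f, rfl, rfl⟩

variable (M) in
/-- `Inn(M)`: the automorphisms `α` for which there is a homotopy from `α` to the identity. -/
def Inn : Subgroup (Aut M) where
  carrier := {α | Homotopic (nerveMap α) (𝟙 (nerve M))}
  one_mem' := by
    change Homotopic (nerveMap 1) (𝟙 (nerve M))
    rw [nerveMap_one]; exact .refl _
  mul_mem' {α β} hα hβ := by
    have := Homotopic.comp hβ hα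
    rwa [← nerveMap_mul, Category.comp_id] at this
  inv_mem' {α} hα := by
    change Homotopic (nerveMap α⁻¹) (𝟙 (nerve M))
    have h : Homotopic (nerveMap α) (nerveMap 1) := by rw [nerveMap_one]; exact hα
    have := h.reverse.comp (.refl (nerveMap α⁻¹))
    rwa [← nerveMap_mul, ← nerveMap_mul, inv_mul_cancel, mul_one, nerveMap_one] at this

instance : (Inn M).Normal where
  conj_mem α hα β := by
    have := ((Homotopic.refl (nerveMap β⁻¹)).comp hα).comp (.refl (nerveMap β))
    rw [Category.comp_id, ← nerveMap_mul, ← nerveMap_mul, ← nerveMap_mul, mul_inv_cancel,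
      nerveMap_one, ← mul_assoc] at this
    exact this

variable (M) in
/-- `Out(M) = Aut(M)/Inn(M)`. -/
abbrev Out : Type u := Aut M ⧸ Inn M

end Outer

/-! ### The simplicial group of automorphisms of a simplicial set -/

section FunctionComplex

open MonoidalCategory CartesianMonoidalCategory

/-- The `n`-simplices of the function complex `hom(X, X)`: the simplicial maps
`X × Δ[n] → X`. -/
def EndSimplex (X : SSet.{u}) (n : SimplexCategory) : Type u :=
  X ⊗ SSet.stdSimplex.{u}.obj n ⟶ X

/-- Composition over `Δ[n]`: `(F * G)(x, t) = F (G (x, t), t)`. -/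
instance (X : SSet.{u}) (n : SimplexCategory) : Monoid (EndSimplex X n) where
  mul F G := lift (show X ⊗ SSet.stdSimplex.{u}.obj n ⟶ X from G) (snd _ _) ≫ F
  one := fst _ _
  mul_assoc _ _ _ := rfl
  one_mul _ := rfl
  mul_one _ := rfl

/-- Restriction along `θ : [m] → [n]`. -/
def EndSimplex.restrict (X : SSet.{u}) {m n : SimplexCategory} (θ : m ⟶ n) :
    EndSimplex X n →* EndSimplex X m where
  toFun F := X ◁ SSet.stdSimplex.{u}.map θ ≫ F
  map_one' := rfl
  map_mul' _ _ := rfl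

/-- The simplicial group `aut(X)`: in each dimension, the maximal subgroup of the monoid of
simplices of the function complex `hom(X, X)`. -/
def autGroup (X : SSet.{u}) : SimplicialObject GrpCat.{u} where
  obj n := GrpCat.of (EndSimplex X n.unop)ˣ
  map θ := GrpCat.ofHom (Units.map (EndSimplex.restrict X θ.unop))
  map_id n := by
    ext F
    change X ◁ SSet.stdSimplex.{u}.map (𝟙 n.unop) ≫ (F.1 : X ⊗ SSet.stdSimplex.obj n.unop ⟶ X)
      = F.1
    exact (congrArg (fun t : SSet.stdSimplex.{u}.obj n.unop ⟶ SSet.stdSimplex.{u}.obj n.unop ↦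
      X ◁ t ≫ (F.1 : X ⊗ SSet.stdSimplex.obj n.unop ⟶ X))
      (SSet.stdSimplex.{u}.map_id n.unop)).trans rfl
  map_comp _ _ := rfl

/-- The simplicial set underlying a simplicial group. -/
abbrev underlying (G : SimplicialObject GrpCat.{u}) : SSet.{u} := G ⋙ forget GrpCat.{u}

end FunctionComplex

/-! ### Classifying spaces -/

section Classifying

/-- The classifying space of a discrete group: the nerve of its one-object category. -/
abbrev classifyingSpace (G : Type u) [Group G] : SSet.{u} := CategoryTheory.nerve (SingleObj G)

/-- Pointwise multiplication on the `n`-simplices of `BA`, for an abelian group `A`. -/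
instance barSimplexGroup (A : Type u) [CommGroup A] (n : SimplexCategoryᵒᵖ) :
    Group ((classifyingSpace A).obj n) where
  mul F G :=
    { obj := fun _ ↦ SingleObj.star A
      map := fun f ↦ (show A from F.map f) * (show A from G.map f)
      map_id := fun i ↦ by
        rw [F.map_id, G.map_id]; exact one_mul (1 : A)
      map_comp := fun f g ↦ by
        rw [F.map_comp, G.map_comp]
        exact mul_mul_mul_comm (show A from F.map g) (F.map f) (G.map g) (G.map f) }
  one := (Functor.const _).obj (SingleObj.star A)
  inv F :=
    { obj := fun _ ↦ SingleObj.star A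
      map := fun f ↦ (show A from F.map f)⁻¹
      map_id := fun i ↦ by
        rw [F.map_id]; exact inv_one (G := A)
      map_comp := fun f g ↦ by
        rw [F.map_comp]
        exact mul_inv (show A from F.map g) (F.map f) }
  mul_assoc F G H := by
    refine CategoryTheory.Functor.ext (fun _ ↦ rfl) fun i j f ↦ ?_
    simp only [eqToHom_refl, Category.comp_id, Category.id_comp]
    exact mul_assoc (show A from F.map f) (G.map f) (H.map f)
  one_mul F := by
    refine CategoryTheory.Functor.ext (fun _ ↦ rfl) fun i j f ↦ ?_
    simp only [eqToHom_refl, Category.comp_id, Category.id_comp]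
    exact one_mul (show A from F.map f)
  mul_one F := by
    refine CategoryTheory.Functor.ext (fun _ ↦ rfl) fun i j f ↦ ?_
    simp only [eqToHom_refl, Category.comp_id, Category.id_comp]
    exact mul_one (show A from F.map f)
  inv_mul_cancel F := by
    refine CategoryTheory.Functor.ext (fun _ ↦ rfl) fun i j f ↦ ?_
    simp only [eqToHom_refl, Category.comp_id, Category.id_comp]
    exact inv_mul_cancel (show A from F.map f)

/-- The classifying space `BA` of an abelian group as a simplicial group. -/
def barGroup (A : Type u) [CommGroup A] : SimplicialObject GrpCat.{u} where
  obj n := GrpCat.of ((classifyingSpace A).obj n)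
  map θ := GrpCat.ofHom
    { toFun := (classifyingSpace A).map θ
      map_one' := rfl
      map_mul' := fun _ _ ↦ rfl }
  map_id _ := rfl
  map_comp _ _ := rfl

lemma underlying_barGroup (A : Type u) [CommGroup A] :
    underlying (barGroup A) = classifyingSpace A := rfl

/-- An `n`-simplex of the classifying space `W̄G` of a simplicial group `G`, that is, a
`G`-valued cocycle on the `n`-simplex. To vertices `i ≤ j` of `[n]` and a simplex `σ : [k] → [n]`
all of whose vertices are `≥ j` it assigns an element of `G_k`, naturally in `σ` and
multiplicatively in `i ≤ j`. Such a cocycle amounts to the tuple `(g_{n-1}, …, g_0)` in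
`G_{n-1} × ⋯ × G_0` of its values on the pairs `(i, i + 1)` and the back faces `{i + 1, …, n}`
(see `WBarSimplex.coords_bijective`); in these coordinates `d₀` drops `g_{n-1}` and, for
`0 < i < n`, the operator `dᵢ` replaces `g_{n-i}, g_{n-i-1}` by `d₀(g_{n-i}) · g_{n-i-1}`. -/
@[ext]
structure WBarSimplex (G : SimplicialObject GrpCat.{u}) (n : SimplexCategory) where
  val : ∀ (k : SimplexCategory) (σ : k ⟶ n) (i j : Fin (n.len + 1)), i ≤ j →
    j ≤ σ.toOrderHom 0 → G.obj (Opposite.op k)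
  val_mul : ∀ (k : SimplexCategory) (σ : k ⟶ n) (i j l : Fin (n.len + 1)) (hij : i ≤ j)
    (hjl : j ≤ l) (hl : l ≤ σ.toOrderHom 0),
    val k σ i j hij (hjl.trans hl) * val k σ j l hjl hl = val k σ i l (hij.trans hjl) hl
  map_val : ∀ (k k' : SimplexCategory) (σ : k ⟶ n) (θ : k' ⟶ k) (i j : Fin (n.len + 1))
    (hij : i ≤ j) (hj : j ≤ σ.toOrderHom 0),
    G.map θ.op (val k σ i j hij hj) =
      val k' (θ ≫ σ) i j hij (hj.trans (σ.toOrderHom.monotone (Fin.zero_le _)))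

/-- The classifying space `W̄G` of a simplicial group `G`. -/
def WBar (G : SimplicialObject GrpCat.{u}) : SSet.{u} where
  obj n := WBarSimplex G n.unop
  map {n m} τ := ↾fun c ↦
    { val := fun k σ i j hij hj ↦ c.val k (σ ≫ τ.unop) (τ.unop.toOrderHom i)
        (τ.unop.toOrderHom j) (τ.unop.toOrderHom.monotone hij) (τ.unop.toOrderHom.monotone hj)
      val_mul := fun _ _ _ _ _ _ _ _ ↦ c.val_mul _ _ _ _ _ _ _ _
      map_val := fun _ _ _ _ _ _ _ _ ↦ c.map_val _ _ _ _ _ _ _ _ }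
  map_id n := by
    refine ConcreteCategory.hom_ext _ _ fun (c : WBarSimplex G n.unop) ↦ WBarSimplex.ext ?_
    funext k σ i j hij hj
    have key : ∀ σ' : k ⟶ n.unop, σ' = σ → ∀ h : j ≤ σ'.toOrderHom 0,
        c.val k σ' i j hij h = c.val k σ i j hij hj := by
      rintro _ rfl _; rfl
    exact key (σ ≫ 𝟙 n.unop) (Category.comp_id σ) _
  map_comp _ _ := rfl

namespace WBarSimplex

variable {G : SimplicialObject GrpCat.{u}} {n : ℕ}

/-- The inclusion of the face `{j + 1, …, n}` of `[n]`. -/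
def backFace {n : ℕ} (j : Fin n) : ⦋n - 1 - j⦌ ⟶ ⦋n⦌ :=
  SimplexCategory.Hom.mk
    { toFun := fun t ↦ ⟨j + 1 + t, by
        have := t.2
        simp only [SimplexCategory.len_mk] at this ⊢
        omega⟩
      monotone' := fun s t h ↦ Fin.mk_le_mk.2 (Nat.add_le_add_left (Fin.le_def.1 h) _) }

/-- The coordinates `(g_{n-1}, …, g_0)` of a simplex of `W̄G`. -/
def coords {n : ℕ} (c : WBarSimplex G ⦋n⦌) (j : Fin n) :
    G.obj (Opposite.op ⦋n - 1 - j⦌) :=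
  c.val ⦋n - 1 - j⦌ (backFace j) j.castSucc j.succ (Fin.castSucc_lt_succ).le
    (Fin.le_def.2 (Nat.le_refl _))

/-- A simplex of `[n]` with vertices `> j`, as a simplex of the back face. -/
def factor {n : ℕ} {k : SimplexCategory} (σ : k ⟶ ⦋n⦌) (j : Fin n)
    (_ : j.succ ≤ σ.toOrderHom 0) : k ⟶ ⦋n - 1 - j⦌ :=
  SimplexCategory.Hom.mk
    { toFun := fun t ↦ ⟨σ.toOrderHom t - (j + 1), by
        have h1 := (σ.toOrderHom t).2
        have h2 := j.2
        simp only [SimplexCategory.len_mk] at h1 ⊢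
        omega⟩
      monotone' := fun s t h ↦ Fin.mk_le_mk.2
        (Nat.sub_le_sub_right (Fin.le_def.1 (σ.toOrderHom.monotone h)) _) }

lemma factor_comp {n : ℕ} {k : SimplexCategory} (σ : k ⟶ ⦋n⦌) (j : Fin n)
    (h : j.succ ≤ σ.toOrderHom 0) : factor σ j h ≫ backFace j = σ := by
  apply SimplexCategory.Hom.ext
  ext t
  have h1 : (j : ℕ) + 1 ≤ σ.toOrderHom t :=
    Fin.le_def.1 (h.trans (σ.toOrderHom.monotone (Fin.zero_le t)))
  change (j : ℕ) + 1 + (σ.toOrderHom t - (j + 1)) = σ.toOrderHom t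
  omega

lemma comp_factor {n : ℕ} {k k' : SimplexCategory} (θ : k' ⟶ k) (σ : k ⟶ ⦋n⦌) (j : Fin n)
    (h : j.succ ≤ σ.toOrderHom 0) (h' : j.succ ≤ (θ ≫ σ).toOrderHom 0) :
    factor (θ ≫ σ) j h' = θ ≫ factor σ j h := rfl

lemma factor_backFace {n : ℕ} (j : Fin n) (h : j.succ ≤ (backFace j).toOrderHom 0) :
    factor (backFace j) j h = 𝟙 _ := by
  apply SimplexCategory.Hom.ext
  ext t
  change (j : ℕ) + 1 + (t : ℕ) - (j + 1) = t
  omega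

lemma val_self (c : WBarSimplex G ⦋n⦌) (k : SimplexCategory) (σ : k ⟶ ⦋n⦌) (i : Fin (n + 1))
    (hi : i ≤ σ.toOrderHom 0) : c.val k σ i i le_rfl hi = 1 := by
  have := c.val_mul k σ i i i le_rfl le_rfl hi
  simpa using this

lemma val_step (c : WBarSimplex G ⦋n⦌) (k : SimplexCategory) (σ : k ⟶ ⦋n⦌) (j : Fin n)
    (hj : j.succ ≤ σ.toOrderHom 0) :
    c.val k σ j.castSucc j.succ (Fin.castSucc_lt_succ).le hj =
      G.map (factor σ j hj).op (c.coords j) := by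
  rw [coords, c.map_val]
  have key : ∀ (σ' : k ⟶ ⦋n⦌) (e : σ' = σ) (h : j.succ ≤ σ'.toOrderHom 0),
      c.val k σ j.castSucc j.succ (Fin.castSucc_lt_succ).le hj =
        c.val k σ' j.castSucc j.succ (Fin.castSucc_lt_succ).le h := by
    rintro _ rfl _; rfl
  exact key _ (factor_comp σ j hj) _

/-- The ordered product of the first `b` coordinates, restricted along `σ`. -/
noncomputable def partialProd {n : ℕ} (g : ∀ j : Fin n, G.obj (Opposite.op ⦋n - 1 - j⦌))
    (k : SimplexCategory) (σ : k ⟶ ⦋n⦌) (b : ℕ) : G.obj (Opposite.op k) :=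
  (((List.finRange n).take b).map fun j ↦
    if h : j.succ ≤ σ.toOrderHom 0 then G.map (factor σ j h).op (g j) else 1).prod

lemma map_partialProd {n : ℕ} (g : ∀ j : Fin n, G.obj (Opposite.op ⦋n - 1 - j⦌))
    {k k' : SimplexCategory} (σ : k ⟶ ⦋n⦌) (θ : k' ⟶ k) (b : Fin (n + 1))
    (hb : b ≤ σ.toOrderHom 0) :
    G.map θ.op (partialProd g k σ b) = partialProd g k' (θ ≫ σ) b := by
  rw [partialProd, partialProd, ← GrpCat.Hom.hom, map_list_prod, List.map_map]
  congr 1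
  refine List.map_congr_left fun j hj ↦ ?_
  have hjb : (j : ℕ) < b := by
    obtain ⟨m, hm, e⟩ := List.getElem_of_mem hj
    simp only [List.length_take, List.length_finRange] at hm
    simp only [List.getElem_take, List.getElem_finRange] at e
    rw [← e]
    simp
    omega
  have h1 : j.succ ≤ σ.toOrderHom 0 := le_trans (Fin.le_def.2 hjb) hb
  have h2 : j.succ ≤ (θ ≫ σ).toOrderHom 0 :=
    h1.trans (σ.toOrderHom.monotone (Fin.zero_le _))
  simp only [Function.comp_apply, dif_pos h1, dif_pos h2]
  rw [comp_factor θ σ j h1 h2, op_comp, G.map_comp]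
  rfl

lemma partialProd_succ {n : ℕ} (g : ∀ j : Fin n, G.obj (Opposite.op ⦋n - 1 - j⦌))
    (k : SimplexCategory) (σ : k ⟶ ⦋n⦌) (j : Fin n) (hj : j.succ ≤ σ.toOrderHom 0) :
    partialProd g k σ (j + 1) = partialProd g k σ j * G.map (factor σ j hj).op (g j) := by
  rw [partialProd, List.take_succ_eq_append_getElem (by simp)]
  simp [partialProd, hj]

/-- An `n`-simplex of `W̄G` is determined by its coordinates in `G_{n-1} × ⋯ × G_0`, which can be
prescribed arbitrarily. -/
theorem coords_bijective (n : ℕ) :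
    Function.Bijective
      (coords : WBarSimplex G ⦋n⦌ → ∀ j : Fin n, G.obj (Opposite.op ⦋n - 1 - j⦌)) := by
  constructor
  · intro c d hcd
    apply WBarSimplex.ext
    funext k σ i j hij hj
    obtain ⟨i, hi⟩ := i
    obtain ⟨j, hj'⟩ := j
    have hij' : i ≤ j := hij
    induction j, hij' using Nat.le_induction with
    | base => exact (val_self c k σ _ _).trans (val_self d k σ _ _).symm
    | succ j hij' ih =>
      have hjn : j < n := by simpa using hj'
      have h1 : (⟨j, by omega⟩ : Fin (n + 1)) ≤ ⟨j + 1, hj'⟩ := Fin.mk_le_mk.2 (Nat.le_succ j)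
      have e1 := c.val_mul k σ ⟨i, hi⟩ ⟨j, by omega⟩ ⟨j + 1, hj'⟩ hij' h1 hj
      have e2 := d.val_mul k σ ⟨i, hi⟩ ⟨j, by omega⟩ ⟨j + 1, hj'⟩ hij' h1 hj
      have e3 := val_step c k σ ⟨j, hjn⟩ hj
      have e4 := val_step d k σ ⟨j, hjn⟩ hj
      rw [← e1, ← e2, ih _ (h1.trans hj) hij']
      congr 1
      exact e3.trans ((congrArg _ (congrFun hcd _)).trans e4.symm)
  · intro g
    refine ⟨{ val := fun k σ i j _ _ ↦ (partialProd g k σ i)⁻¹ * partialProd g k σ j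
              val_mul := fun k σ i j l _ _ _ ↦ by group
              map_val := fun k k' σ θ i j hij hj ↦ ?_ }, ?_⟩
    · rw [map_mul, map_inv, map_partialProd g σ θ i (hij.trans hj), map_partialProd g σ θ j hj]
    · funext j
      have h : j.succ ≤ (backFace j).toOrderHom 0 := Fin.le_def.2 (Nat.le_refl _)
      have e := partialProd_succ g _ (backFace j) j h
      rw [factor_backFace] at e
      change (partialProd g _ (backFace j) j)⁻¹ * partialProd g _ (backFace j) (j + 1) = g j
      rw [e, op_id, G.map_id]
      exact inv_mul_cancel_left _ _

end WBarSimplex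

/-- `p` is a Kan fibration: it has the right lifting property against the horn inclusions. -/
def IsKanFibration {E B : SSet.{u}} (p : E ⟶ B) : Prop :=
  SSet.modelCategoryQuillen.J.rlp p

/-- The fibre of `p` over a vertex `b`. -/
def fiber {E B : SSet.{u}} (p : E ⟶ B) (b : B _⦋0⦌) : E.Subcomplex :=
  (SSet.Subcomplex.ofSimplex b).preimage p

/-- The connected component `c` of a simplicial set: the simplices with vertices in `c`. -/
def component {X : SSet.{u}} (c : SSet.π₀ X) : X.Subcomplex where
  obj n := {x | ∀ v : ⦋0⦌ ⟶ n.unop, SSet.π₀.mk (X.map v.op x) = c}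
  map {n m} θ x hx v := by
    have := hx (v ≫ θ.unop)
    simpa using this

/-- Simplicial homotopy equivalence. -/
def HomotopyEquivalent (X Y : SSet.{u}) : Prop :=
  ∃ (f : X ⟶ Y) (g : Y ⟶ X), Homotopic (f ≫ g) (𝟙 X) ∧ Homotopic (g ≫ f) (𝟙 Y)

end Classifying

end PartialGroup

/-! The simplicial group `aut(M)` is completely described by the crossed module `N(M) → Aut(M)`,
with `η` sent to conjugation by `η`; the rest is formal and holds for any crossed module `bd : N →
A`.

An invertible map `F : M × Δ[n] → M` is determined by its effect on single letters over edges `i →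
j` (`letter_ext`). Over the constant edge at `i` it gives an automorphism `α_i`. Over `i → j` the
unit letter goes to an element `η_ij`. Evaluate `F` on a word `u ∘ 1 ∘ v` along a path in `Δ[n]`
that jumps from `i` to `j` exactly at the inserted unit (`letter_intertwines`): the result has the
form `α_i(u) ∘ η_ij ∘ α_j(v)`, and its product does not depend on where `u ∘ v` was cut. This is the
condition defining `N(M)`. Hence `η_ij ∈ N(M)`, conjugation by `η_ij` composed with `α_j` is `α_i`,
and a letter `x` goes to `α_i(x) · η_ij`. Conversely all data `(α_i, η_ij)` with these relations
arise, since the elements `η_ij` can be moved through words and telescope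
(`flatten_twistBlocks_mem`). So the `n`-simplices of `aut(M)` are maps from the codiscrete groupoid
on `[n]` to the action groupoid of `N(M)` on `Aut(M)` (`autModel`).

For a simplicial group modelled on a crossed module, a simplex of `W̄` is the same as a normalized
nonabelian 2-cocycle (`wBarIso`). The first components, read modulo the image of `bd`, give a map to
the classifying space of the cokernel. It is a Kan fibration because a cocycle on a horn is the
coboundary of a potential based at the centre of the horn, and a potential extends to the whole
simplex (`exists_cocycle`). In the fibre all first components lie in the image of `bd`; gauging by a
section of `bd` makes them trivial and pushes the second components into `ker bd`, which leaves
cocycles with values in the centre (`homotopyEquivalent_fiber`). The same gauge one dimension lower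
contracts each component of the group onto the classifying space of `ker bd`
(`homotopyEquivalent_component`).

For a partial group `ker bd = Z(M)` by definition. The image of `bd` is `Inn(M)`: a homotopy from
`α` to the identity, evaluated on the unit over the edge of `Δ[1]`, is an element of `N(M)` whose
conjugation is `α`, and the converse is a one-simplex of the model (`mem_Inn_iff`). This identifies
the cokernel with `Out(M)` and gives the exact sequence. -/

/-! ### Crossed modules and their simplicial models -/

/-- A crossed module: a homomorphism `bd : N → A` together with an action of `A` on `N` which
is compatible with conjugation. -/
structure CrossedModule (N A : Type u) [Group N] [Group A] where
  bd : N →* A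
  act : A →* MulAut N
  bd_act : ∀ (a : A) (n : N), bd (act a n) = a * bd n * a⁻¹
  act_bd : ∀ m n : N, act (bd m) n = m * n * m⁻¹

namespace CrossedModule

variable {N A : Type u} [Group N] [Group A]

/-- The `k`-simplices of the simplicial group of a crossed module: a functor from the codiscrete
groupoid on the vertices of the `k`-simplex to the action groupoid of `N` on `A`. -/
@[ext]
structure ActionSimplex (X : CrossedModule N A) (k : SimplexCategory) where
  vert : Fin (k.len + 1) → A
  edge : Fin (k.len + 1) → Fin (k.len + 1) → N
  edge_mul : ∀ i j l, edge i j * edge j l = edge i l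
  bd_edge : ∀ i j, X.bd (edge i j) * vert j = vert i

namespace ActionSimplex

variable {X : CrossedModule N A} {k k' k'' : SimplexCategory}

lemma edge_self (s : ActionSimplex X k) (i) : s.edge i i = 1 := by
  simpa using s.edge_mul i i i

lemma edge_inv (s : ActionSimplex X k) (i j) : (s.edge i j)⁻¹ = s.edge j i := by
  rw [inv_eq_iff_mul_eq_one, s.edge_mul, s.edge_self]

/-- The pointwise multiplication of the strict 2-group attached to a crossed module. That the
product edges compose is the Peiffer identity `act_bd`; that they join the product vertices is the
equivariance `bd_act`. -/
instance : Group (ActionSimplex X k) where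
  mul s t :=
    { vert i := s.vert i * t.vert i
      edge i j := X.act (s.vert i) (t.edge i j) * s.edge i j
      edge_mul i j l := by
        rw [← s.edge_mul i j l, ← t.edge_mul i j l, ← s.bd_edge i j]
        simp only [map_mul, MulAut.mul_apply, X.act_bd]
        group
      bd_edge i j := by
        rw [map_mul, X.bd_act, ← t.bd_edge i j, ← s.bd_edge i j]
        group }
  one :=
    { vert _ := 1
      edge _ _ := 1
      edge_mul _ _ _ := one_mul _
      bd_edge _ _ := by simp }
  inv s :=
    { vert i := (s.vert i)⁻¹
      edge i j := X.act (s.vert i)⁻¹ (s.edge i j)⁻¹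
      edge_mul i j l := by
        rw [← s.edge_mul i j l, ← s.bd_edge i j]
        have hi : ∀ a n, X.act a n⁻¹ = (X.act a n)⁻¹ := fun a n ↦ map_inv (X.act a) n
        simp only [mul_inv_rev, map_mul, ← map_inv X.bd, MulAut.mul_apply, X.act_bd, hi]
        group
      bd_edge i j := by
        rw [X.bd_act, map_inv, ← s.bd_edge i j]
        group }
  mul_assoc s t v := by
    apply ActionSimplex.ext
    · funext i; exact mul_assoc _ _ _
    · funext i j
      change X.act (s.vert i * t.vert i) (v.edge i j) * (X.act (s.vert i) (t.edge i j) *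
        s.edge i j) = X.act (s.vert i) (X.act (t.vert i) (v.edge i j) * t.edge i j) * s.edge i j
      simp only [map_mul, MulAut.mul_apply, mul_assoc]
  one_mul s := by
    apply ActionSimplex.ext
    · funext i; exact one_mul _
    · funext i j
      change X.act 1 (s.edge i j) * 1 = s.edge i j
      simp
  mul_one s := by
    apply ActionSimplex.ext
    · funext i; exact mul_one _
    · funext i j
      change X.act (s.vert i) 1 * s.edge i j = s.edge i j
      simp
  inv_mul_cancel s := by
    apply ActionSimplex.ext
    · funext i; exact inv_mul_cancel _
    · funext i j
      change X.act (s.vert i)⁻¹ (s.edge i j) * X.act (s.vert i)⁻¹ (s.edge i j)⁻¹ = 1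
      rw [← map_mul, mul_inv_cancel, map_one]

lemma mul_vert (s t : ActionSimplex X k) (i) : (s * t).vert i = s.vert i * t.vert i := rfl

lemma mul_edge (s t : ActionSimplex X k) (i j) :
    (s * t).edge i j = X.act (s.vert i) (t.edge i j) * s.edge i j := rfl

/-- Restriction along a simplicial operator. -/
def restrict (θ : k' ⟶ k) (s : ActionSimplex X k) : ActionSimplex X k' where
  vert i := s.vert (θ.toOrderHom i)
  edge i j := s.edge (θ.toOrderHom i) (θ.toOrderHom j)
  edge_mul _ _ _ := s.edge_mul _ _ _
  bd_edge _ _ := s.bd_edge _ _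

/-- The simplex with `x`-th vertex `(bd (m x))⁻¹ * a`, spanned by paths out of `a`. -/
def cone (X : CrossedModule N A) (k : SimplexCategory) (a : A) (m : Fin (k.len + 1) → N) :
    ActionSimplex X k where
  vert x := (X.bd (m x))⁻¹ * a
  edge x y := (m x)⁻¹ * m y
  edge_mul _ _ _ := by group
  bd_edge _ _ := by rw [map_mul, map_inv]; group

/-- Change of a simplex along elements of `N` attached to its vertices. -/
def gauge (s : ActionSimplex X k) (m : Fin (k.len + 1) → N) : ActionSimplex X k where
  vert i := (X.bd (m i))⁻¹ * s.vert i
  edge i j := (m i)⁻¹ * s.edge i j * m j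
  edge_mul i j l := by rw [← s.edge_mul i j l]; group
  bd_edge i j := by rw [← s.bd_edge i j]; simp only [map_mul, map_inv]; group

lemma gauge_one (s : ActionSimplex X k) : s.gauge (fun _ ↦ 1) = s := by
  apply ActionSimplex.ext <;> simp [gauge]

end ActionSimplex

/-- An identification of a simplicial group with the simplicial group of a crossed module. -/
structure Model (X : CrossedModule N A) (G : SimplicialObject GrpCat.{u}) where
  equiv : ∀ k : SimplexCategory, G.obj (Opposite.op k) ≃* ActionSimplex X k
  equiv_map : ∀ {k k' : SimplexCategory} (θ : k' ⟶ k) (g : G.obj (Opposite.op k)),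
    equiv k' (G.map θ.op g) = (equiv k g).restrict θ

/-! ### Normalized nonabelian 2-cocycles. -/

/-- A normalized nonabelian `2`-cocycle on the `n`-simplex with values in a crossed module. -/
@[ext]
structure Cocycle (X : CrossedModule N A) (n : SimplexCategory) where
  fst : ∀ i j : Fin (n.len + 1), i ≤ j → A
  snd : ∀ i j l : Fin (n.len + 1), i ≤ j → j ≤ l → N
  snd_left : ∀ i l (h : i ≤ l), snd i i l le_rfl h = 1
  snd_right : ∀ i j (h : i ≤ j), snd i j j h le_rfl = 1
  bd_snd : ∀ i j l (hij : i ≤ j) (hjl : j ≤ l),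
    X.bd (snd i j l hij hjl) * fst i l (hij.trans hjl) = fst i j hij * fst j l hjl
  cocycle : ∀ i j l m (hij : i ≤ j) (hjl : j ≤ l) (hlm : l ≤ m),
    snd i j l hij hjl * snd i l m (hij.trans hjl) hlm =
      X.act (fst i j hij) (snd j l m hjl hlm) * snd i j m hij (hjl.trans hlm)

namespace Cocycle

variable {X : CrossedModule N A} {n n' : SimplexCategory}

lemma fst_self (c : Cocycle X n) (i) : c.fst i i le_rfl = 1 := by
  have := c.bd_snd i i i le_rfl le_rfl
  rw [c.snd_left, map_one, one_mul] at this
  simpa using this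

/-- Restriction along a simplicial operator. -/
def restrict (τ : n' ⟶ n) (c : Cocycle X n) : Cocycle X n' where
  fst i j h := c.fst (τ.toOrderHom i) (τ.toOrderHom j) (τ.toOrderHom.monotone h)
  snd i j l h h' := c.snd (τ.toOrderHom i) (τ.toOrderHom j) (τ.toOrderHom l)
    (τ.toOrderHom.monotone h) (τ.toOrderHom.monotone h')
  snd_left _ _ _ := c.snd_left _ _ _
  snd_right _ _ _ := c.snd_right _ _ _
  bd_snd _ _ _ _ _ := c.bd_snd _ _ _ _ _
  cocycle _ _ _ _ _ _ _ := c.cocycle _ _ _ _ _ _ _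

end Cocycle

/-- The simplicial set of normalized cocycles with values in a crossed module. -/
def cocycles (X : CrossedModule N A) : SSet.{u} where
  obj n := Cocycle X n.unop
  map τ := ↾fun c ↦ c.restrict τ.unop
  map_id _ := rfl
  map_comp _ _ := rfl

/-! ### Cocycles and the classifying space -/

open PartialGroup (WBar WBarSimplex)

/-- The edge from `i` to `j` of a simplex. -/
def edgeHom {n : SimplexCategory} (i j : Fin (n.len + 1)) (h : i ≤ j) : ⦋1⦌ ⟶ n :=
  SimplexCategory.Hom.mk
    { toFun := fun t : Fin 2 ↦ ![i, j] t
      monotone' := by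
        intro s t hst
        change Fin 2 at s t
        fin_cases s <;> fin_cases t <;> first | (exact le_rfl) | (exact h) | (simp at hst) }

/-- The simplex `σ` with a vertex `j` added in front. -/
def consHom {n k : SimplexCategory} (j : Fin (n.len + 1)) (σ : k ⟶ n)
    (h : j ≤ σ.toOrderHom 0) : ⦋k.len + 1⦌ ⟶ n :=
  SimplexCategory.Hom.mk
    { toFun := fun t : Fin (k.len + 2) ↦ (Fin.cons j fun x ↦ σ.toOrderHom x : Fin (k.len + 2) → Fin (n.len + 1)) t
      monotone' := by
        intro s t hst
        change Fin (k.len + 2) at s t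
        induction s using Fin.cases with
        | zero =>
          induction t using Fin.cases with
          | zero => exact le_rfl
          | succ t => exact h.trans (σ.toOrderHom.monotone (Fin.zero_le t))
        | succ s =>
          induction t using Fin.cases with
          | zero => exact absurd hst (by simp)
          | succ t => exact σ.toOrderHom.monotone (Fin.succ_le_succ_iff.1 hst) }

/-- The inclusion of the last vertices of a simplex with one more vertex. -/
def tailHom (k : SimplexCategory) : k ⟶ ⦋k.len + 1⦌ :=
  SimplexCategory.Hom.mk
    { toFun := fun t ↦ (Fin.succ t : Fin (k.len + 2))
      monotone' := fun _ _ h ↦ Fin.succ_le_succ_iff.2 h }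

lemma tailHom_comp_consHom {n k : SimplexCategory} (j : Fin (n.len + 1)) (σ : k ⟶ n)
    (h : j ≤ σ.toOrderHom 0) : tailHom k ≫ consHom j σ h = σ := by
  apply SimplexCategory.Hom.ext
  ext t
  rfl

lemma le_edgeHom {n : SimplexCategory} (i j : Fin (n.len + 1)) (h : i ≤ j) :
    i ≤ (edgeHom i j h).toOrderHom 0 := le_rfl

lemma le_consHom {n k : SimplexCategory} (j : Fin (n.len + 1)) (σ : k ⟶ n)
    (h : j ≤ σ.toOrderHom 0) : j ≤ (consHom j σ h).toOrderHom 0 := le_rfl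

lemma le_const {n : SimplexCategory} (i : Fin (n.len + 1)) :
    i ≤ (SimplexCategory.const ⦋0⦌ n i).toOrderHom 0 := le_rfl

lemma edgeHom_comp {n k : SimplexCategory} (σ : k ⟶ n) (i j : Fin (k.len + 1)) (h : i ≤ j) :
    edgeHom i j h ≫ σ =
      edgeHom (σ.toOrderHom i) (σ.toOrderHom j) (σ.toOrderHom.monotone h) := by
  apply SimplexCategory.Hom.ext
  ext t
  change Fin 2 at t
  fin_cases t <;> rfl

lemma edgeHom_self {n : SimplexCategory} (i : Fin (n.len + 1)) :
    edgeHom i i le_rfl = SimplexCategory.const ⦋1⦌ n i := by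
  apply SimplexCategory.Hom.ext
  ext t
  change Fin 2 at t
  fin_cases t <;> rfl

variable {X : CrossedModule N A} {G : SimplicialObject GrpCat.{u}}

lemma _root_.PartialGroup.WBarSimplex.val_congr {n k : SimplexCategory} (c : WBarSimplex G n)
    {σ σ' : k ⟶ n} (e : σ = σ') (i j : Fin (n.len + 1)) (h : i ≤ j) (h' : j ≤ σ.toOrderHom 0) :
    c.val k σ i j h h' = c.val k σ' i j h (by rwa [← e]) := by
  subst e; rfl

namespace Model

variable (E : Model X G) {n : SimplexCategory}

/-- The first component of the cocycle of a simplex of `W̄G`. -/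
def fst (c : WBarSimplex G n) (i j : Fin (n.len + 1)) (h : i ≤ j) : A :=
  (E.equiv _ (c.val ⦋0⦌ (SimplexCategory.const ⦋0⦌ n j) i j h (le_const j))).vert 0

/-- The second component of the cocycle of a simplex of `W̄G`. -/
def snd (c : WBarSimplex G n) (i j l : Fin (n.len + 1)) (h : i ≤ j) (h' : j ≤ l) : N :=
  (E.equiv _ (c.val ⦋1⦌ (edgeHom j l h') i j h (le_edgeHom j l h'))).edge (0 : Fin 2) (1 : Fin 2)

lemma restrict_val (c : WBarSimplex G n) {k k' : SimplexCategory} (σ : k ⟶ n) (θ : k' ⟶ k)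
    (i j : Fin (n.len + 1)) (h : i ≤ j) (h' : j ≤ σ.toOrderHom 0) :
    (E.equiv k (c.val k σ i j h h')).restrict θ = E.equiv k' (c.val k' (θ ≫ σ) i j h
      (h'.trans (σ.toOrderHom.monotone (Fin.zero_le _)))) := by
  rw [← E.equiv_map, c.map_val]

/-- Put `j` in front of `σ`: the value on the longer simplex is still defined, since vertices `≥ j`
are allowed. An action simplex is determined by its first vertex and the edges out of it, and here
these are seen on the vertex `j` and the edges `j → σ x`, that is, in `fst` and `snd`. -/
lemma equiv_val (c : WBarSimplex G n) {k : SimplexCategory} (σ : k ⟶ n)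
    (i j : Fin (n.len + 1)) (h : i ≤ j) (h' : j ≤ σ.toOrderHom 0) :
    E.equiv k (c.val k σ i j h h') = ActionSimplex.cone X k (E.fst c i j h)
      fun x ↦ E.snd c i j (σ.toOrderHom x) h
        (h'.trans (σ.toOrderHom.monotone (Fin.zero_le x))) := by
  set s := E.equiv _ (c.val _ (consHom j σ h') i j h (le_consHom j σ h')) with hs
  have e1 : E.equiv k (c.val k σ i j h h') = s.restrict (tailHom k) := by
    rw [hs, restrict_val, c.val_congr (tailHom_comp_consHom j σ h')]
  have e2 : ∀ x : Fin (k.len + 1), s.edge (0 : Fin (k.len + 2)) (x.succ : Fin (k.len + 2)) =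
      E.snd c i j (σ.toOrderHom x) h (h'.trans (σ.toOrderHom.monotone (Fin.zero_le x))) := by
    intro x
    have := E.restrict_val c (consHom j σ h')
      (edgeHom (0 : Fin (k.len + 2)) x.succ (Fin.zero_le _)) i j h (le_consHom j σ h')
    rw [c.val_congr (edgeHom_comp _ _ _ _)] at this
    exact congrArg (fun s ↦ s.edge (0 : Fin 2) (1 : Fin 2)) this
  have e3 : s.vert (0 : Fin (k.len + 2)) = E.fst c i j h := by
    have := E.restrict_val c (consHom j σ h')
      (SimplexCategory.const ⦋0⦌ _ (0 : Fin (k.len + 2))) i j h (le_consHom j σ h')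
    exact congrArg (fun s ↦ s.vert (0 : Fin 1)) this
  rw [e1]
  apply ActionSimplex.ext
  · funext x
    change s.vert (x.succ : Fin (k.len + 2)) = (X.bd _)⁻¹ * _
    beta_reduce
    rw [← e2, ← e3, ← s.bd_edge (0 : Fin (k.len + 2)) (x.succ : Fin (k.len + 2))]
    group
  · funext x y
    change s.edge (x.succ : Fin (k.len + 2)) (y.succ : Fin (k.len + 2)) = _⁻¹ * _
    beta_reduce
    rw [← e2, ← e2, s.edge_inv, s.edge_mul]

lemma val_self (c : WBarSimplex G n) (k : SimplexCategory) (σ : k ⟶ n) (i : Fin (n.len + 1))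
    (hi : i ≤ σ.toOrderHom 0) : c.val k σ i i le_rfl hi = 1 := by
  have := c.val_mul k σ i i i le_rfl le_rfl hi
  simpa using this

lemma snd_right (c : WBarSimplex G n) (i j : Fin (n.len + 1)) (h : i ≤ j) :
    E.snd c i j j h le_rfl = 1 := by
  have h1 := E.restrict_val c (SimplexCategory.const ⦋0⦌ n j)
      (SimplexCategory.const ⦋1⦌ ⦋0⦌ 0) i j h (le_const j)
  rw [snd, c.val_congr (edgeHom_self j)]
  refine (congrArg (fun s ↦ s.edge (0 : Fin 2) (1 : Fin 2)) h1).symm.trans ?_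
  exact ActionSimplex.edge_self _ _

/-- The cocycle of a simplex of `W̄G`. -/
def toCocycle (c : WBarSimplex G n) : Cocycle X n where
  fst := E.fst c
  snd := E.snd c
  snd_left i l h := by
    rw [snd, val_self, map_one]; rfl
  snd_right := E.snd_right c
  bd_snd i j l hij hjl := by
    -- Multiplicativity evaluated at the vertex `l`: the terms whose last two indices are both `l`
    -- are trivial, so only the triangle `i, j, l` survives.
    have h1 := congrArg (fun g ↦ (E.equiv _ g).vert 0)
      (c.val_mul ⦋0⦌ (SimplexCategory.const ⦋0⦌ n l) i j l hij hjl (le_const l))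
    rw [map_mul, equiv_val, equiv_val, equiv_val] at h1
    have h2 : (X.bd (E.snd c i j l hij hjl))⁻¹ * E.fst c i j hij *
        ((X.bd (E.snd c j l l hjl le_rfl))⁻¹ * E.fst c j l hjl) =
        (X.bd (E.snd c i l l (hij.trans hjl) le_rfl))⁻¹ * E.fst c i l (hij.trans hjl) := h1
    rw [snd_right, snd_right] at h2
    simp only [map_one, inv_one, one_mul] at h2
    rw [← h2]; group
  cocycle i j l m hij hjl hlm := by
    -- Multiplicativity evaluated on the edge from `l` to `m` is the cocycle identity, once `act_bd`
    -- turns the action of boundaries into conjugation.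
    have h1 := congrArg (fun g ↦ (E.equiv _ g).edge (0 : Fin 2) (1 : Fin 2))
      (c.val_mul ⦋1⦌ (edgeHom l m hlm) i j l hij hjl (le_edgeHom l m hlm))
    rw [map_mul, equiv_val, equiv_val, equiv_val] at h1
    have h2 : X.act ((X.bd (E.snd c i j l hij hjl))⁻¹ * E.fst c i j hij)
        ((E.snd c j l l hjl le_rfl)⁻¹ * E.snd c j l m hjl hlm) *
        ((E.snd c i j l hij hjl)⁻¹ * E.snd c i j m hij (hjl.trans hlm)) =
        (E.snd c i l l (hij.trans hjl) le_rfl)⁻¹ * E.snd c i l m (hij.trans hjl) hlm := h1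
    rw [snd_right, snd_right] at h2
    simp only [inv_one, one_mul, ← map_inv X.bd, map_mul, MulAut.mul_apply, X.act_bd] at h2
    rw [← h2]; group

/-- The cocycle conditions express `fst i l` and `snd i l (v x)` through the two shorter steps, at
the cost of a factor `(snd i j l)⁻¹` which does not depend on `x`. This common factor cancels from
the vertices and the edges of a cone. -/
lemma cone_mul (c : Cocycle X n) (k : SimplexCategory) (i j l : Fin (n.len + 1)) (hij : i ≤ j)
    (hjl : j ≤ l) (v : Fin (k.len + 1) → Fin (n.len + 1)) (hv : ∀ x, l ≤ v x) :
    ActionSimplex.cone X k (c.fst i j hij) (fun x ↦ c.snd i j (v x) hij (hjl.trans (hv x))) *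
      ActionSimplex.cone X k (c.fst j l hjl) (fun x ↦ c.snd j l (v x) hjl (hv x)) =
    ActionSimplex.cone X k (c.fst i l (hij.trans hjl))
      (fun x ↦ c.snd i l (v x) (hij.trans hjl) (hv x)) := by
  have key : ∀ x, c.snd i l (v x) (hij.trans hjl) (hv x) = (c.snd i j l hij hjl)⁻¹ *
      (X.act (c.fst i j hij) (c.snd j l (v x) hjl (hv x)) *
        c.snd i j (v x) hij (hjl.trans (hv x))) := fun x ↦ by
    rw [← c.cocycle]; group
  have key2 : c.fst i l (hij.trans hjl) =
      (X.bd (c.snd i j l hij hjl))⁻¹ * (c.fst i j hij * c.fst j l hjl) := by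
    rw [← c.bd_snd]; group
  apply ActionSimplex.ext
  · funext x
    change (X.bd _)⁻¹ * _ * ((X.bd _)⁻¹ * _) = (X.bd _)⁻¹ * _
    beta_reduce
    rw [key, key2]
    simp only [map_mul, map_inv, X.bd_act]
    group
  · funext x y
    change X.act ((X.bd _)⁻¹ * _) (_⁻¹ * _) * (_⁻¹ * _) = _⁻¹ * _
    beta_reduce
    rw [key, key]
    have hi : ∀ a n, X.act a n⁻¹ = (X.act a n)⁻¹ := fun a n ↦ map_inv (X.act a) n
    simp only [map_mul, ← map_inv X.bd, MulAut.mul_apply, X.act_bd, hi]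
    group

/-- The simplex of `W̄G` of a cocycle. -/
def ofCocycle (c : Cocycle X n) : WBarSimplex G n where
  val k σ i j hij hj := (E.equiv k).symm (ActionSimplex.cone X k (c.fst i j hij)
    fun x ↦ c.snd i j (σ.toOrderHom x) hij (hj.trans (σ.toOrderHom.monotone (Fin.zero_le x))))
  val_mul k σ i j l hij hjl hl := by
    rw [← map_mul]
    exact congrArg _ (cone_mul c k i j l hij hjl σ.toOrderHom
      fun x ↦ hl.trans (σ.toOrderHom.monotone (Fin.zero_le x)))
  map_val k k' σ θ i j hij hj := by
    apply (E.equiv k').injective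
    rw [E.equiv_map, MulEquiv.apply_symm_apply, MulEquiv.apply_symm_apply]
    rfl

lemma ofCocycle_toCocycle (c : WBarSimplex G n) : E.ofCocycle (E.toCocycle c) = c := by
  apply WBarSimplex.ext
  funext k σ i j hij hj
  change (E.equiv k).symm _ = _
  rw [MulEquiv.symm_apply_eq, E.equiv_val]
  rfl

lemma toCocycle_ofCocycle (c : Cocycle X n) : E.toCocycle (E.ofCocycle c) = c := by
  apply Cocycle.ext
  · funext i j h
    change ((E.equiv _) ((E.equiv _).symm _)).vert 0 = _
    rw [MulEquiv.apply_symm_apply]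
    change (X.bd (c.snd i j j h le_rfl))⁻¹ * _ = _
    rw [c.snd_right]; simp
  · funext i j l h h'
    change ((E.equiv _) ((E.equiv _).symm _)).edge _ _ = _
    rw [MulEquiv.apply_symm_apply]
    change (c.snd i j j h le_rfl)⁻¹ * c.snd i j l h h' = _
    rw [c.snd_right]; simp

/-- The classifying space of a simplicial group modelled on a crossed module is the simplicial
set of cocycles. -/
def wBarIso : WBar G ≅ cocycles X :=
  NatIso.ofComponents
    (fun n ↦ Equiv.toIso
      { toFun := fun c : WBarSimplex G n.unop ↦ (E.toCocycle c : Cocycle X n.unop)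
        invFun := E.ofCocycle
        left_inv := E.ofCocycle_toCocycle
        right_inv := E.toCocycle_ofCocycle })
    (fun {n m} τ ↦ by
      ext c
      apply Cocycle.ext
      · rfl
      · funext i j l h h'
        exact congrArg (fun g ↦ (E.equiv _ g).edge (0 : Fin 2) (1 : Fin 2))
          (WBarSimplex.val_congr c (edgeHom_comp τ.unop j l h') _ _ _ _))

end Model

end CrossedModule

namespace CrossedModule

variable {N A : Type u} [Group N] [Group A]

/-! ### Filling horns of cocycles -/

/-- The cocycle of a potential, that is, the coboundary of a nonabelian `1`-cochain. -/
def Cocycle.ofPotential (X : CrossedModule N A) (n : SimplexCategory) (b : Fin (n.len + 1) → A)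
    (x : ∀ i j : Fin (n.len + 1), i ≤ j → N) (hx : ∀ i, x i i le_rfl = 1) : Cocycle X n where
  fst i j h := (b i)⁻¹ * X.bd (x i j h) * b j
  snd i j l h h' := X.act (b i)⁻¹ (x i j h * x j l h' * (x i l (h.trans h'))⁻¹)
  snd_left i l h := by simp [hx]
  snd_right i j h := by simp [hx]
  bd_snd i j l h h' := by
    rw [X.bd_act]
    simp only [map_mul, map_inv]
    group
  cocycle i j l m hij hjl hlm := by
    -- The first component carries elements based at `j` to elements based at `i`; the boundary in
    -- its middle acts as conjugation by `x i j`.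
    have e : X.act ((b i)⁻¹ * X.bd (x i j hij) * b j) (X.act (b j)⁻¹
        (x j l hjl * x l m hlm * (x j m (hjl.trans hlm))⁻¹)) = X.act (b i)⁻¹
        (x i j hij * (x j l hjl * x l m hlm * (x j m (hjl.trans hlm))⁻¹) * (x i j hij)⁻¹) := by
      rw [← MulAut.mul_apply, ← map_mul, mul_inv_cancel_right,
        map_mul X.act, MulAut.mul_apply, X.act_bd]
    rw [e, ← map_mul, ← map_mul]
    congr 1
    group

/-- A compatible system of first and second components on the simplices of a horn with centre
`k`: the cocycle conditions hold for vertices in each face opposite to some `r ≠ k`. -/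
structure HornCocycle (X : CrossedModule N A) {n : SimplexCategory} (k : Fin (n.len + 1)) where
  fst : ∀ i j : Fin (n.len + 1), i ≤ j → A
  snd : ∀ i j l : Fin (n.len + 1), i ≤ j → j ≤ l → N
  snd_left : ∀ r, r ≠ k → ∀ i l (h : i ≤ l), i ≠ r → l ≠ r → snd i i l le_rfl h = 1
  snd_right : ∀ r, r ≠ k → ∀ i j (h : i ≤ j), i ≠ r → j ≠ r → snd i j j h le_rfl = 1
  bd_snd : ∀ r, r ≠ k → ∀ i j l (hij : i ≤ j) (hjl : j ≤ l), i ≠ r → j ≠ r → l ≠ r →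
    X.bd (snd i j l hij hjl) * fst i l (hij.trans hjl) = fst i j hij * fst j l hjl
  cocycle : ∀ r, r ≠ k → ∀ i j l m (hij : i ≤ j) (hjl : j ≤ l) (hlm : l ≤ m),
    i ≠ r → j ≠ r → l ≠ r → m ≠ r →
    snd i j l hij hjl * snd i l m (hij.trans hjl) hlm =
      X.act (fst i j hij) (snd j l m hjl hlm) * snd i j m hij (hjl.trans hlm)

namespace HornCocycle

variable {X : CrossedModule N A} {n : SimplexCategory} {k : Fin (n.len + 1)}

/-- The conditions are available at the centre only inside some face, so a vertex `r ≠ k` has to be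
supplied. -/
lemma fst_centre (c : HornCocycle X k) {r} (hr : r ≠ k) : c.fst k k le_rfl = 1 := by
  have := c.bd_snd r hr k k k le_rfl le_rfl hr.symm hr.symm hr.symm
  rw [c.snd_left r hr k k le_rfl hr.symm hr.symm, map_one, one_mul] at this
  simpa using this

/-- The value at `i` of the potential of a horn, based at the centre. -/
def base (c : HornCocycle X k) (i : Fin (n.len + 1)) : A :=
  if h : k ≤ i then c.fst k i h else (c.fst i k (le_of_not_ge h))⁻¹

lemma base_of_ge (c : HornCocycle X k) {i} (h : k ≤ i) : c.base i = c.fst k i h := dif_pos h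

lemma base_of_le (c : HornCocycle X k) {r} (hr : r ≠ k) {i} (h : i ≤ k) :
    c.base i = (c.fst i k h)⁻¹ := by
  by_cases hi : k ≤ i
  · obtain rfl := le_antisymm h hi
    rw [base_of_ge c hi, c.fst_centre hr, inv_one]
  · exact dif_neg hi

open Classical in
/-- The value at an edge of the potential of a horn, based at the centre. -/
noncomputable def path (c : HornCocycle X k) (i j : Fin (n.len + 1)) (h : i ≤ j) : N :=
  -- A face opposite some `r ≠ k` contains the centre, so if it contains the edge then it contains
  -- the whole triangle on `i`, `j`, `k`, whose second component gives the potential. An edge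
  -- outside the horn is unconstrained and gets the value `1`.
  if ∃ r, r ≠ k ∧ i ≠ r ∧ j ≠ r then
    if hi : k ≤ i then c.snd k i j hi h
    else if hj : j ≤ k then X.act (c.base i) (c.snd i j k h hj)
    else X.act (c.base i) (c.snd i k j (le_of_not_ge hi) (le_of_not_ge hj))⁻¹
  else 1

section

variable (c : HornCocycle X k) {r i j : Fin (n.len + 1)} (hr : r ≠ k) (hi : i ≠ r) (hj : j ≠ r)

include hr hi hj

lemma path_of_ge (h : i ≤ j) (h' : k ≤ i) : c.path i j h = c.snd k i j h' h := by
  rw [path, if_pos ⟨r, hr, hi, hj⟩, dif_pos h']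

/-- The case distinction in `path` is strict in places; normalization makes the formulas agree where
`i` or `j` is the centre, so each holds on its closed range. -/
lemma path_of_le (h : i ≤ j) (h' : j ≤ k) :
    c.path i j h = X.act (c.base i) (c.snd i j k h h') := by
  rw [path, if_pos ⟨r, hr, hi, hj⟩]
  by_cases hk : k ≤ i
  · obtain rfl := le_antisymm (h.trans h') hk
    obtain rfl := le_antisymm h h'
    rw [dif_pos hk, c.snd_left r hr _ _ _ hi hi, map_one]
  · rw [dif_neg hk, dif_pos h']

lemma path_of_le_of_ge (h : i ≤ k) (h' : k ≤ j) :
    c.path i j (h.trans h') = X.act (c.base i) (c.snd i k j h h')⁻¹ := by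
  rw [path, if_pos ⟨r, hr, hi, hj⟩]
  by_cases hk : k ≤ i
  · obtain rfl := le_antisymm h hk
    rw [dif_pos hk, c.snd_left r hr _ _ _ hi hj, inv_one, map_one]
  · rw [dif_neg hk]
    by_cases hk' : j ≤ k
    · obtain rfl := le_antisymm hk' h'
      rw [dif_pos hk', c.snd_right r hr _ _ _ hi hj, inv_one, map_one]
    · rw [dif_neg hk']

end

lemma path_self (c : HornCocycle X k) (i) : c.path i i le_rfl = 1 := by
  by_cases h : ∃ r, r ≠ k ∧ i ≠ r
  · obtain ⟨r, hr, hi⟩ := h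
    rcases le_total k i with h | h
    · rw [c.path_of_ge hr hi hi _ h, c.snd_right r hr _ _ _ hr.symm hi]
    · rw [c.path_of_le hr hi hi _ h, c.snd_left r hr _ _ _ hi hr.symm, map_one]
  · rw [path, if_neg]
    rintro ⟨r, hr, hi, -⟩
    exact h ⟨r, hr, hi⟩

/-- This is `bd_snd` for the triangle on `i`, `j`, `k`, in each of the three positions of the
centre. With `act_path` it shows that the coboundary of the potential gives back the cocycle on the
horn. -/
lemma bd_path (c : HornCocycle X k) {r i j : Fin (n.len + 1)} (hr : r ≠ k) (hi : i ≠ r)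
    (hj : j ≠ r) (h : i ≤ j) :
    (c.base i)⁻¹ * X.bd (c.path i j h) * c.base j = c.fst i j h := by
  rcases le_total k i with h1 | h1
  · have := c.bd_snd r hr k i j h1 h hr.symm hi hj
    rw [c.path_of_ge hr hi hj h h1, c.base_of_ge h1, c.base_of_ge (h1.trans h), mul_assoc, this]
    group
  · rcases le_total j k with h2 | h2
    · have := c.bd_snd r hr i j k h h2 hi hj hr.symm
      rw [c.path_of_le hr hi hj h h2, c.base_of_le hr h1, c.base_of_le hr h2, X.bd_act,
        eq_mul_inv_of_mul_eq this]
      group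
    · have := c.bd_snd r hr i k j h1 h2 hi hr.symm hj
      rw [c.path_of_le_of_ge hr hi hj h1 h2, c.base_of_le hr h1, c.base_of_ge h2, X.bd_act,
        map_inv, eq_inv_mul_of_mul_eq this]
      group

/-- This is the cocycle identity for the tetrahedron on `i`, `j`, `l`, `k`, which lies in the face
opposite `r`; there is one case for each position of the centre. -/
lemma act_path (c : HornCocycle X k) {r i j l : Fin (n.len + 1)} (hr : r ≠ k) (hi : i ≠ r)
    (hj : j ≠ r) (hl : l ≠ r) (h : i ≤ j) (h' : j ≤ l) :
    X.act (c.base i)⁻¹ (c.path i j h * c.path j l h' * (c.path i l (h.trans h'))⁻¹) =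
      c.snd i j l h h' := by
  have cancel : ∀ y, X.act (c.base i)⁻¹ (X.act (c.base i) y) = y := fun y ↦ by
    rw [← MulAut.mul_apply, ← map_mul, inv_mul_cancel, map_one, MulAut.one_apply]
  -- Change of base vertex from `j` to `i`: the quotient of the two base values is `fst i j` up to a
  -- boundary, which acts by conjugation.
  have shift : ∀ hk : j ≤ k, ∀ y, X.act (c.base i)⁻¹ (X.act (c.base j) y) =
      (c.snd i j k h hk)⁻¹ * X.act (c.fst i j h) y * c.snd i j k h hk := fun hk y ↦ by
    have := c.bd_path hr hi hj h
    rw [c.path_of_le hr hi hj h hk, X.bd_act, c.base_of_le hr (h.trans hk)] at this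
    have e : (c.base i)⁻¹ * c.base j = X.bd (c.snd i j k h hk)⁻¹ * c.fst i j h := by
      rw [← this, c.base_of_le hr (h.trans hk), map_inv]; group
    rw [← MulAut.mul_apply, ← map_mul, e, map_mul, MulAut.mul_apply, X.act_bd, inv_inv]
  have hinv : ∀ (a : A) (y : N), X.act a y⁻¹ = (X.act a y)⁻¹ := fun a y ↦ map_inv (X.act a) y
  rcases le_total k i with h1 | h1
  · have := c.cocycle r hr k i j l h1 h h' hr.symm hi hj hl
    rw [c.path_of_ge hr hi hj _ h1, c.path_of_ge hr hi hl _ h1,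
      c.path_of_ge hr hj hl _ (h1.trans h), this, mul_inv_cancel_right, ← c.base_of_ge h1, cancel]
  · rcases le_total k j with h2 | h2
    · have := c.cocycle r hr i k j l h1 h2 h' hi hr.symm hj hl
      rw [c.path_of_le_of_ge hr hi hj h1 h2, c.path_of_ge hr hj hl h' h2,
        c.path_of_le_of_ge hr hi hl h1 (h2.trans h')]
      simp only [map_mul, hinv, cancel]
      rw [c.base_of_le hr h1, inv_inv, inv_inv, mul_assoc, ← this, inv_mul_cancel_left]
    · rcases le_total k l with h3 | h3
      · have := c.cocycle r hr i j k l h h2 h3 hi hj hr.symm hl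
        rw [c.path_of_le hr hi hj h h2, c.path_of_le_of_ge hr hj hl h2 h3,
          c.path_of_le_of_ge hr hi hl h1 h3]
        simp only [map_mul, hinv, cancel, shift h2]
        rw [eq_inv_mul_of_mul_eq this]
        group
      · have := c.cocycle r hr i j l k h h' h3 hi hj hl hr.symm
        rw [c.path_of_le hr hi hj h h2, c.path_of_le hr hj hl h' h3,
          c.path_of_le hr hi hl (h.trans h') h3]
        simp only [map_mul, hinv, cancel, shift h2]
        rw [eq_mul_inv_of_mul_eq this.symm]
        group

/-- A horn of cocycles can be filled over a given simplex of the quotient. -/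
lemma exists_cocycle {Q : Type u} [Group Q] (c : HornCocycle X k) (π : A →* Q)
    (hπ : Function.Surjective π) (hbd : ∀ m, π (X.bd m) = 1)
    (β : ∀ i j : Fin (n.len + 1), i ≤ j → Q)
    (hβ : ∀ i j l (h : i ≤ j) (h' : j ≤ l), β i j h * β j l h' = β i l (h.trans h'))
    (hc : ∀ r, r ≠ k → ∀ i j h, i ≠ r → j ≠ r → π (c.fst i j h) = β i j h) :
    ∃ d : Cocycle X n, (∀ r, r ≠ k → ∀ i j h, i ≠ r → j ≠ r → d.fst i j h = c.fst i j h) ∧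
      (∀ r, r ≠ k → ∀ i j l h h', i ≠ r → j ≠ r → l ≠ r → d.snd i j l h h' = c.snd i j l h h') ∧
      ∀ i j h, π (d.fst i j h) = β i j h := by
  have hself : ∀ i, β i i le_rfl = 1 := fun i ↦ by simpa using hβ i i i le_rfl le_rfl
  -- The potential of the 1-cocycle `β`, based at the centre in the same way as `base`.
  let γ (i : Fin (n.len + 1)) : Q :=
    if h : k ≤ i then β k i h else (β i k (le_of_not_ge h))⁻¹
  have hγ : ∀ i j h, (γ i)⁻¹ * γ j = β i j h := by
    intro i j h
    by_cases h1 : k ≤ i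
    · simp only [γ, dif_pos h1, dif_pos (h1.trans h), ← hβ k i j h1 h]; group
    · by_cases h2 : k ≤ j
      · simp only [γ, dif_neg h1, dif_pos h2, ← hβ i k j (le_of_not_ge h1) h2]; group
      · simp only [γ, dif_neg h1, dif_neg h2, ← hβ i j k h (le_of_not_ge h2)]; group
  -- On a vertex of the horn the lift of `γ` is forced to be `base`. A vertex outside the horn,
  -- which exists only in dimension one, takes any lift; this is where surjectivity of `π` enters.
  have hb : ∀ i, ∃ b : A, π b = γ i ∧ ∀ r, r ≠ k → i ≠ r → b = c.base i := by
    intro i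
    by_cases h : ∃ r, r ≠ k ∧ i ≠ r
    · obtain ⟨r, hr, hi⟩ := h
      refine ⟨c.base i, ?_, fun _ _ _ ↦ rfl⟩
      by_cases h1 : k ≤ i
      · rw [c.base_of_ge h1, hc r hr k i h1 hr.symm hi]
        simp only [γ, dif_pos h1]
      · rw [c.base_of_le hr (le_of_not_ge h1), map_inv, hc r hr i k _ hi hr.symm]
        simp only [γ, dif_neg h1]
    · obtain ⟨b, hb⟩ := hπ (γ i)
      exact ⟨b, hb, fun r hr hi ↦ (h ⟨r, hr, hi⟩).elim⟩
  choose b hb1 hb2 using hb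
  refine ⟨Cocycle.ofPotential X n b c.path c.path_self, fun r hr i j h hi hj ↦ ?_,
    fun r hr i j l h h' hi hj hl ↦ ?_, fun i j h ↦ ?_⟩
  · simp only [Cocycle.ofPotential]
    rw [hb2 i r hr hi, hb2 j r hr hj, c.bd_path hr hi hj]
  · simp only [Cocycle.ofPotential]
    rw [hb2 i r hr hi, c.act_path hr hi hj hl]
  · simp only [Cocycle.ofPotential]
    rw [map_mul, map_mul, map_inv, hbd, hb1, hb1, mul_one, hγ]

end HornCocycle

/-! ### Horns as compatible families of cocycles on their simplices. -/

/-- The simplex with a given monotone sequence of vertices. -/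
def vecHom {n : SimplexCategory} {m : ℕ} (v : Fin (m + 1) → Fin (n.len + 1)) (hv : Monotone v) :
    ⦋m⦌ ⟶ n :=
  SimplexCategory.Hom.mk ⟨v, hv⟩

lemma monotone_vec_two {P : Type*} [Preorder P] {i j : P} (h : i ≤ j) : Monotone ![i, j] := by
  rw [Fin.monotone_iff_le_succ]
  intro t
  fin_cases t
  exact h

lemma monotone_vec_three {P : Type*} [Preorder P] {i j l : P} (h : i ≤ j) (h' : j ≤ l) :
    Monotone ![i, j, l] := by
  rw [Fin.monotone_iff_le_succ]
  intro t
  fin_cases t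
  · exact h
  · exact h'

lemma monotone_vec_four {P : Type*} [Preorder P] {i j l m : P} (h : i ≤ j) (h' : j ≤ l)
    (h'' : l ≤ m) : Monotone ![i, j, l, m] := by
  rw [Fin.monotone_iff_le_succ]
  intro t
  fin_cases t
  · exact h
  · exact h'
  · exact h''

/-- The simplices of the horn with centre `k`. -/
def InHorn {n : SimplexCategory} (k : Fin (n.len + 1)) {m : SimplexCategory} (σ : m ⟶ n) : Prop :=
  ∃ r, r ≠ k ∧ ∀ t, σ.toOrderHom t ≠ r

lemma inHorn_four {n : SimplexCategory} {k r i j l m : Fin (n.len + 1)} (hr : r ≠ k)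
    (hij : i ≤ j) (hjl : j ≤ l)
    (hlm : l ≤ m) (hi : i ≠ r) (hj : j ≠ r) (hl : l ≠ r) (hm : m ≠ r) :
    InHorn k (vecHom _ (monotone_vec_four hij hjl hlm)) := by
  refine ⟨r, hr, fun t ↦ ?_⟩
  change Fin 4 at t
  fin_cases t
  exacts [hi, hj, hl, hm]

section

variable {X : CrossedModule N A} {n : SimplexCategory} {k : Fin (n.len + 1)}
  (F : ∀ (m : SimplexCategory) (σ : m ⟶ n), InHorn k σ → Cocycle X m)

open Classical in
/-- The first component of a family of cocycles on the simplices of a horn. -/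
noncomputable def hornFst (i j : Fin (n.len + 1)) (h : i ≤ j) : A :=
  if hm : InHorn k (vecHom _ (monotone_vec_two h)) then
    (F _ _ hm).fst (0 : Fin 2) (1 : Fin 2) (Fin.zero_le _) else 1

open Classical in
/-- The second component of a family of cocycles on the simplices of a horn. -/
noncomputable def hornSnd (i j l : Fin (n.len + 1)) (h : i ≤ j) (h' : j ≤ l) : N :=
  if hm : InHorn k (vecHom _ (monotone_vec_three h h')) then
    (F _ _ hm).snd (0 : Fin 3) (1 : Fin 3) (2 : Fin 3) (Fin.zero_le _) (by decide) else 1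

variable (hF : ∀ (m m' : SimplexCategory) (σ : m ⟶ n) (θ : m' ⟶ m) (hσ : InHorn k σ)
  (hσ' : InHorn k (θ ≫ σ)), F m' (θ ≫ σ) hσ' = (F m σ hσ).restrict θ)

include hF

/-- By compatibility the component on an edge of `σ` depends only on the image of that edge in the
horn, not on `σ`. Every identity within one cocycle of the family therefore becomes an identity for
the horn. -/
lemma fst_eq_hornFst {m : SimplexCategory} (σ : m ⟶ n) (hσ : InHorn k σ) (i j) (h : i ≤ j) :
    (F m σ hσ).fst i j h =
      hornFst F (σ.toOrderHom i) (σ.toOrderHom j) (σ.toOrderHom.monotone h) := by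
  have e : vecHom _ (monotone_vec_two h) ≫ σ =
      vecHom _ (monotone_vec_two (σ.toOrderHom.monotone h)) := by
    apply SimplexCategory.Hom.ext
    ext t
    change Fin 2 at t
    fin_cases t <;> rfl
  obtain ⟨r, hr, hi⟩ := hσ
  have hm : InHorn k (vecHom _ (monotone_vec_two h) ≫ σ) := ⟨r, hr, fun t ↦ hi _⟩
  have key := hF _ _ σ (vecHom _ (monotone_vec_two h)) ⟨r, hr, hi⟩ hm
  have hm' := hm
  rw [e] at hm'
  rw [hornFst, dif_pos hm']
  have e2 : F _ _ hm' = F _ _ hm := by congr 1; exact e.symm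
  rw [e2, key]
  rfl

lemma snd_eq_hornSnd {m : SimplexCategory} (σ : m ⟶ n) (hσ : InHorn k σ) (i j l) (h : i ≤ j)
    (h' : j ≤ l) : (F m σ hσ).snd i j l h h' =
      hornSnd F (σ.toOrderHom i) (σ.toOrderHom j) (σ.toOrderHom l) (σ.toOrderHom.monotone h)
        (σ.toOrderHom.monotone h') := by
  have e : vecHom _ (monotone_vec_three h h') ≫ σ =
      vecHom _ (monotone_vec_three (σ.toOrderHom.monotone h) (σ.toOrderHom.monotone h')) := by
    apply SimplexCategory.Hom.ext
    ext t
    change Fin 3 at t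
    fin_cases t <;> rfl
  obtain ⟨r, hr, hi⟩ := hσ
  have hm : InHorn k (vecHom _ (monotone_vec_three h h') ≫ σ) := ⟨r, hr, fun t ↦ hi _⟩
  have key := hF _ _ σ (vecHom _ (monotone_vec_three h h')) ⟨r, hr, hi⟩ hm
  have hm' := hm
  rw [e] at hm'
  rw [hornSnd, dif_pos hm']
  have e2 : F _ _ hm' = F _ _ hm := by congr 1; exact e.symm
  rw [e2, key]
  rfl

/-- The cocycle on a horn defined by a compatible family of cocycles on its simplices. -/
noncomputable def hornCocycle : HornCocycle X k where
  fst := hornFst F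
  snd := hornSnd F
  snd_left r hr i l h hi hl := by
    -- Each condition is read off from a possibly degenerate 3-simplex; here its vertices are `i, i,
    -- i, l`, so positions `0` and `3` form the edge in question.
    have hσ := inHorn_four hr le_rfl le_rfl h hi hi hi hl
    have e := (F _ _ hσ).snd_left (0 : Fin 4) (3 : Fin 4) (by decide)
    rwa [snd_eq_hornSnd F hF] at e
  snd_right r hr i j h hi hj := by
    have hσ := inHorn_four hr le_rfl le_rfl h hi hi hi hj
    have e := (F _ _ hσ).snd_right (0 : Fin 4) (3 : Fin 4) (by decide)
    rwa [snd_eq_hornSnd F hF] at e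
  bd_snd r hr i j l hij hjl hi hj hl := by
    have hσ := inHorn_four hr hij hjl le_rfl hi hj hl hl
    have e := (F _ _ hσ).bd_snd (0 : Fin 4) (1 : Fin 4) (2 : Fin 4) (by decide) (by decide)
    rwa [snd_eq_hornSnd F hF, fst_eq_hornFst F hF, fst_eq_hornFst F hF,
      fst_eq_hornFst F hF] at e
  cocycle r hr i j l m hij hjl hlm hi hj hl hm := by
    have hσ := inHorn_four hr hij hjl hlm hi hj hl hm
    have e := (F _ _ hσ).cocycle (0 : Fin 4) (1 : Fin 4) (2 : Fin 4) (3 : Fin 4) (by decide)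
      (by decide) (by decide)
    rwa [snd_eq_hornSnd F hF, fst_eq_hornFst F hF, snd_eq_hornSnd F hF, snd_eq_hornSnd F hF,
      snd_eq_hornSnd F hF] at e

end

end CrossedModule

namespace CrossedModule

open PartialGroup (classifyingSpace IsKanFibration fiber Homotopic HomotopyEquivalent)

/-! ### Simplices of the classifying space of a discrete group -/

section Bar

variable {Q : Type u} [Group Q]

/-- The value on an edge of a simplex of the classifying space of a discrete group. -/
def barVal {n : SimplexCategoryᵒᵖ} (F : (classifyingSpace Q).obj n)
    (i j : Fin (n.unop.len + 1)) (h : i ≤ j) : Q :=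
  ComposableArrows.map' F i j h

lemma barVal_self {n : SimplexCategoryᵒᵖ} (F : (classifyingSpace Q).obj n) (i) :
    barVal F i i le_rfl = 1 := by
  exact F.map_id i

/-- The factors appear in reverse order because composition in `SingleObj Q` is reversed
multiplication. -/
lemma barVal_mul {n : SimplexCategoryᵒᵖ} (F : (classifyingSpace Q).obj n) (i j l)
    (h : i ≤ j) (h' : j ≤ l) : barVal F j l h' * barVal F i j h = barVal F i l (h.trans h') :=
  (F.map_comp (homOfLE h) (homOfLE h')).symm

/-- The simplex of the classifying space with given values on edges. -/
def barMk {n : SimplexCategoryᵒᵖ} (v : ∀ i j : Fin (n.unop.len + 1), i ≤ j → Q)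
    (h1 : ∀ i, v i i le_rfl = 1)
    (h2 : ∀ i j l (h : i ≤ j) (h' : j ≤ l), v j l h' * v i j h = v i l (h.trans h')) :
    (classifyingSpace Q).obj n :=
  { obj := fun _ ↦ SingleObj.star Q
    map := fun {i j} f ↦ v i j (leOfHom f)
    map_id := h1
    map_comp := fun f g ↦ (h2 _ _ _ (leOfHom f) (leOfHom g)).symm }

lemma bar_ext {n : SimplexCategoryᵒᵖ} {F G : (classifyingSpace Q).obj n}
    (h : ∀ i j h, barVal F i j h = barVal G i j h) : F = G := by
  refine CategoryTheory.Functor.ext (fun _ ↦ rfl) fun i j f ↦ ?_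
  simp only [eqToHom_refl, Category.comp_id, Category.id_comp]
  exact h i j (leOfHom f)

end Bar

variable {N A : Type u} [Group N] [Group A] (X : CrossedModule N A) {Q : Type u} [Group Q]
  (π : A →* Q) (hbd : ∀ m, π (X.bd m) = 1)

/-! ### The Kan fibration from cocycles to the classifying space of the cokernel -/

/-- The map from cocycles to the classifying space of a group receiving the cokernel. -/
def toBar : cocycles X ⟶ classifyingSpace Q where
  -- Modulo boundaries `fst` multiplies along paths from left to right, whereas simplices of the
  -- classifying space multiply from right to left; the inverse converts one into the other.
  app n := ↾fun c : Cocycle X n.unop ↦ barMk (fun i j h ↦ (π (c.fst i j h))⁻¹)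
    (fun i ↦ by rw [c.fst_self, map_one, inv_one])
    (fun i j l h h' ↦ by
      have := congrArg π (c.bd_snd i j l h h')
      rw [map_mul, hbd, one_mul, map_mul] at this
      rw [this, mul_inv_rev])
  naturality _ _ _ := rfl

lemma barVal_toBar {n : SimplexCategoryᵒᵖ} (c : Cocycle X n.unop) (i j) (h : i ≤ j) :
    barVal ((toBar X π hbd).app n c) i j h = (π (c.fst i j h))⁻¹ := rfl

lemma inHorn_iff {m : ℕ} (k : Fin (m + 1)) {d : SimplexCategory} (σ : d ⟶ ⦋m⦌) :
    SSet.stdSimplex.objEquiv.{u}.symm σ ∈ (SSet.horn.{u} m k).obj (Opposite.op d) ↔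
      InHorn (n := ⦋m⦌) k σ := by
  rw [SSet.mem_horn_iff, Ne, Set.eq_univ_iff_forall, not_forall]
  refine exists_congr fun r ↦ ?_
  rw [Set.mem_union, not_or, Set.mem_singleton_iff, and_comm]
  refine and_congr Iff.rfl ?_
  rw [Set.mem_range, not_exists]
  rfl

/-- The top map of the square is a compatible family of cocycles on the horn, hence a `HornCocycle`,
and the bottom map is a 1-cocycle in `Q` after inverting edge values. The lift is the cocycle given
by `exists_cocycle`. -/
lemma hasLiftingProperty_toBar (hπ : Function.Surjective π) (m : ℕ) (k : Fin (m + 2)) :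
    HasLiftingProperty Λ[m + 1, k].ι (toBar X π hbd) := by
  refine ⟨fun {f g} sq ↦ ?_⟩
  let F (d : SimplexCategory) (σ : d ⟶ ⦋m + 1⦌) (hσ : InHorn (n := ⦋m + 1⦌) k σ) : Cocycle X d :=
    f.app (Opposite.op d) ⟨_, (inHorn_iff k σ).2 hσ⟩
  have hF : ∀ (d d' : SimplexCategory) (σ : d ⟶ ⦋m + 1⦌) (θ : d' ⟶ d)
      (hσ : InHorn (n := ⦋m + 1⦌) k σ) (hσ' : InHorn (n := ⦋m + 1⦌) k (θ ≫ σ)),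
      F d' (θ ≫ σ) hσ' = (F d σ hσ).restrict θ := by
    intro d d' σ θ hσ hσ'
    exact ConcreteCategory.congr_hom (f.naturality θ.op)
      (⟨_, (inHorn_iff k σ).2 hσ⟩ : (Λ[m + 1, k] : SSet.{u}).obj (Opposite.op d))
  have hsq : ∀ (d : SimplexCategory) (σ : d ⟶ ⦋m + 1⦌) (hσ : InHorn (n := ⦋m + 1⦌) k σ),
      (toBar X π hbd).app (Opposite.op d) (F d σ hσ) =
        (classifyingSpace Q).map σ.op (SSet.yonedaEquiv g) := by
    intro d σ hσ
    have h1 := congrArg (fun t : (Λ[m + 1, k] : SSet.{u}) ⟶ classifyingSpace Q ↦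
      t.app (Opposite.op d) ⟨_, (inHorn_iff k σ).2 hσ⟩) sq.w
    refine h1.trans ?_
    rw [← SSet.yonedaEquiv_symm_app_objEquiv_symm, Equiv.symm_apply_apply]
    rfl
  let b := SSet.yonedaEquiv g
  obtain ⟨c, hc1, hc2, hc3⟩ := (hornCocycle F hF).exists_cocycle π hπ hbd
    (fun i j h ↦ (barVal b i j h)⁻¹)
    (fun i j l h h' ↦ by rw [← barVal_mul b i j l h h', mul_inv_rev])
    (fun r hr i j h hi hj ↦ by
      have hσ := inHorn_four (n := ⦋m + 1⦌) hr le_rfl le_rfl h hi hi hi hj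
      have h1 := congrArg (fun t ↦ barVal t (0 : Fin 4) (3 : Fin 4) (by decide)) (hsq _ _ hσ)
      dsimp only at h1
      rw [barVal_toBar, fst_eq_hornFst F hF _ hσ] at h1
      exact inv_eq_iff_eq_inv.1 h1)
  refine ⟨⟨⟨SSet.yonedaEquiv.symm c, ?_, ?_⟩⟩⟩
  · ext d ⟨s, hs⟩
    obtain ⟨σ, rfl⟩ := SSet.stdSimplex.objEquiv.symm.surjective s
    have hσ := (inHorn_iff k σ).1 hs
    refine (SSet.yonedaEquiv_symm_app_objEquiv_symm (X := cocycles X) c σ).trans ?_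
    change c.restrict σ = F d.unop σ hσ
    obtain ⟨r, hr, hi⟩ := id hσ
    apply Cocycle.ext
    · funext i j h
      exact (hc1 r hr _ _ _ (hi i) (hi j)).trans (fst_eq_hornFst F hF σ hσ i j h).symm
    · funext i j l h h'
      exact (hc2 r hr _ _ _ _ _ (hi i) (hi j) (hi l)).trans
        (snd_eq_hornSnd F hF σ hσ i j l h h').symm
  · apply SSet.yonedaEquiv.injective
    rw [SSet.yonedaEquiv_comp]
    refine (congrArg ((toBar X π hbd).app (Opposite.op ⦋m + 1⦌))
      (Equiv.apply_symm_apply SSet.yonedaEquiv (c : (cocycles X).obj _))).trans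
        (bar_ext fun i j h ↦ ?_)
    rw [barVal_toBar, hc3, inv_inv]

lemma isKanFibration_toBar (hπ : Function.Surjective π) :
    IsKanFibration (toBar X π hbd) := by
  intro U V i hi
  simp only [SSet.modelCategoryQuillen.J, MorphismProperty.iSup_iff] at hi
  obtain ⟨m, hi⟩ := hi
  have h := hasLiftingProperty_toBar X π hbd hπ m
  cases hi with
  | mk k => exact h k

end CrossedModule

namespace CrossedModule

open PartialGroup (classifyingSpace IsKanFibration fiber Homotopic HomotopyEquivalent WBar
  underlying barGroup component)
open MonoidalCategory

variable {N A : Type u} [Group N] [Group A] (X : CrossedModule N A)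

/-! ### Gauge transformations -/

/-- Change of a cocycle along elements of `N` attached to its edges. -/
def Cocycle.gauge {X : CrossedModule N A} {n : SimplexCategory} (c : Cocycle X n)
    (m : ∀ i j : Fin (n.len + 1), i ≤ j → N) (hm : ∀ i, m i i le_rfl = 1) : Cocycle X n where
  fst i j h := (X.bd (m i j h))⁻¹ * c.fst i j h
  snd i j l h h' := (m i j h)⁻¹ * X.act (c.fst i j h) (m j l h')⁻¹ * c.snd i j l h h' *
    m i l (h.trans h')
  snd_left i l h := by
    rw [c.snd_left, c.fst_self, hm, map_one, MulAut.one_apply]; group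
  snd_right i j h := by rw [c.snd_right, hm]; simp
  bd_snd i j l h h' := by
    have := c.bd_snd i j l h h'
    simp only [map_mul, map_inv, X.bd_act]
    rw [eq_mul_inv_of_mul_eq this]
    group
  cocycle i j l m' h h' h'' := by
    have hi : ∀ a n, X.act a n⁻¹ = (X.act a n)⁻¹ := fun a n ↦ map_inv (X.act a) n
    have e1 : c.fst i l (h.trans h') =
        X.bd (c.snd i j l h h')⁻¹ * (c.fst i j h * c.fst j l h') := by
      rw [← c.bd_snd, map_inv]; group
    have e2 : X.act (c.fst i j h) (c.snd j l m' h' h'') = c.snd i j l h h' *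
        c.snd i l m' (h.trans h') h'' * (c.snd i j m' h (h'.trans h''))⁻¹ :=
      eq_mul_inv_of_mul_eq (c.cocycle i j l m' h h' h'').symm
    simp only [e1, map_mul, ← map_inv X.bd, MulAut.mul_apply, X.act_bd, hi, e2]
    group

lemma Cocycle.gauge_one {X : CrossedModule N A} {n : SimplexCategory} (c : Cocycle X n)
    (m : ∀ i j : Fin (n.len + 1), i ≤ j → N) (hm : ∀ i, m i i le_rfl = 1)
    (h : ∀ i j h, m i j h = 1) : c.gauge m hm = c := by
  apply Cocycle.ext <;> simp [gauge, h]

/-- A section of `bd` on its image. -/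
noncomputable def sec (a : A) : N :=
  -- The clause `a ≠ 1` forces the value `1` at `1`. Gauging by the section then respects
  -- normalization on degenerate edges and does nothing to central data.
  open Classical in if h : a ≠ 1 ∧ ∃ m, X.bd m = a then h.2.choose else 1

lemma sec_one : X.sec 1 = 1 := by simp [sec]

lemma bd_sec {a : A} (h : ∃ m, X.bd m = a) : X.bd (X.sec a) = a := by
  by_cases ha : a = 1
  · rw [ha, sec_one, map_one]
  · have hh : a ≠ 1 ∧ ∃ m, X.bd m = a := ⟨ha, h⟩
    rw [sec, dif_pos hh]
    exact hh.2.choose_spec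

/-- The crossed module of an abelian group. -/
def ofComm (Z : Type u) [CommGroup Z] : CrossedModule Z PUnit.{u + 1} where
  bd := 1
  act := 1
  bd_act _ _ := rfl
  act_bd m n := by simp [mul_comm m n]

/-- The position of the vertex `i` in a simplex of `Δ[1]`. -/
def side {n : SimplexCategoryᵒᵖ} (t : (Δ[1] : SSet.{u}).obj n) (i : Fin (n.unop.len + 1)) :
    Fin 2 :=
  (SSet.stdSimplex.objEquiv t).toOrderHom i

lemma homotopic_refl_of_eq {U V : SSet.{u}} {f g : U ⟶ V} (h : f = g) : Homotopic f g := by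
  rw [h]; exact .refl _

lemma homotopyEquivalent_of_iso {U V W : SSet.{u}} (e : U ≅ V) (h : HomotopyEquivalent V W) :
    HomotopyEquivalent U W := by
  obtain ⟨f, g, h1, h2⟩ := h
  refine ⟨e.hom ≫ f, g ≫ e.inv, ?_, ?_⟩
  · have := ((Homotopic.refl e.hom).comp h1).comp (.refl e.inv)
    simpa using this
  · simpa using h2

lemma homotopyEquivalent_of_iso_right {U V W : SSet.{u}} (e : V ≅ W)
    (h : HomotopyEquivalent U V) : HomotopyEquivalent U W := by
  obtain ⟨f, g, h1, h2⟩ := h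
  refine ⟨f ≫ e.hom, e.inv ≫ g, ?_, ?_⟩
  · simpa using h1
  · have := ((Homotopic.refl e.inv).comp h2).comp (.refl e.hom)
    simpa using this

variable {X} {Z : Type u} [CommGroup Z] (ι : Z →* N) (hι : Function.Injective ι)
  (hker : ∀ n, X.bd n = 1 ↔ ∃ z, ι z = n)

include hker in
lemma bd_ι (z : Z) : X.bd (ι z) = 1 := (hker _).2 ⟨z, rfl⟩

/-! ### The fibre -/

section Fibre

variable {Q : Type u} [Group Q] (π : A →* Q) (hbd : ∀ a, π a = 1 ↔ ∃ m, X.bd m = a)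

/-- The cocycle with trivial first component and central second component. -/
def centralCocycle {n : SimplexCategory} (hι : ∀ z, X.bd (ι z) = 1)
    (c : Cocycle (ofComm Z) n) : Cocycle X n where
  fst _ _ _ := 1
  snd i j l h h' := ι (c.snd i j l h h')
  snd_left i l h := by rw [c.snd_left, map_one]
  snd_right i l h := by rw [c.snd_right, map_one]
  bd_snd i j l h h' := by rw [hι]
  cocycle i j l m h h' h'' := by
    rw [map_one, MulAut.one_apply, ← map_mul, ← map_mul, c.cocycle i j l m h h' h'']
    rfl

/-- The degeneracies of a vertex of the classifying space have trivial values on all edges, so only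
the values of `π` on the first component matter. -/
lemma mem_fiber_toBar (hb : ∀ m, π (X.bd m) = 1) (b : classifyingSpace Q _⦋0⦌)
    {n : SimplexCategoryᵒᵖ} (c : Cocycle X n.unop) :
    c ∈ (fiber (toBar X π hb) b).obj n ↔ ∀ i j h, π (c.fst i j h) = 1 := by
  have h0 : ∀ (f : n.unop ⟶ ⦋0⦌) i j h, barVal ((classifyingSpace Q).map f.op b) i j h = 1 := by
    intro f i j h
    have key : ∀ (x y : Fin 1) (h : x ≤ y), barVal b x y h = 1 := by
      intro x y h
      obtain rfl : x = y := Subsingleton.elim _ _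
      exact barVal_self b x
    exact key _ _ (f.toOrderHom.monotone h)
  change (toBar X π hb).app n c ∈ (SSet.Subcomplex.ofSimplex b).obj n ↔ _
  rw [SSet.Subcomplex.mem_ofSimplex_obj_iff]
  constructor
  · rintro ⟨f, hf⟩ i j h
    have := h0 f i j h
    rw [hf, barVal_toBar] at this
    simpa using this
  · intro hc
    refine ⟨SimplexCategory.const _ _ 0, bar_ext fun i j h ↦ ?_⟩
    rw [h0, barVal_toBar, hc, inv_one]

/-- The gauge transformation of a cocycle by the section of `bd`, carried out on the edges
whose source is in position `0`. -/
noncomputable def Cocycle.contract {n : SimplexCategory} (c : Cocycle X n)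
    (t : Fin (n.len + 1) → Fin 2) : Cocycle X n :=
  -- Any normalized 1-cochain may serve as a gauge, so it can be switched on and off by the position
  -- of the source. The rule commutes with simplicial operators, which makes it a homotopy.
  c.gauge (fun i j h ↦ if t i = 0 then X.sec (c.fst i j h) else 1) (fun i ↦ by
    rw [c.fst_self, sec_one, ite_self])

lemma Cocycle.contract_one {n : SimplexCategory} (c : Cocycle X n) :
    (c.contract fun _ ↦ 1) = c :=
  c.gauge_one _ _ fun _ _ _ ↦ if_neg one_ne_zero

lemma Cocycle.contract_fst {n : SimplexCategory} (c : Cocycle X n)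
    (hc : ∀ i j h, ∃ m, X.bd m = c.fst i j h) (i j h) :
    (c.contract fun _ ↦ 0).fst i j h = 1 := by
  simp [contract, gauge, X.bd_sec (hc i j h)]

include hker in
-- Once the first component is trivial, `bd_snd` places the second one in the kernel of `bd`.
lemma Cocycle.exists_contract_snd {n : SimplexCategory} (c : Cocycle X n)
    (hc : ∀ i j h, ∃ m, X.bd m = c.fst i j h) (i j l h h') :
    ∃ z, ι z = (c.contract fun _ ↦ 0).snd i j l h h' := by
  rw [← hker]
  have := (c.contract fun _ ↦ 0).bd_snd i j l h h'
  simpa only [c.contract_fst hc, mul_one] using this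

/-- The central cocycle associated with a cocycle over the trivial simplex. -/
noncomputable def Cocycle.toCentral {n : SimplexCategory} (c : Cocycle X n)
    (hc : ∀ i j h, ∃ m, X.bd m = c.fst i j h) : Cocycle (ofComm Z) n where
  fst _ _ _ := 1
  snd i j l h h' := (c.exists_contract_snd ι hker hc i j l h h').choose
  snd_left i l h := hι <| by
    rw [(c.exists_contract_snd ι hker hc i i l _ h).choose_spec, snd_left, map_one]
  snd_right i l h := hι <| by
    rw [(c.exists_contract_snd ι hker hc i l l h _).choose_spec, snd_right, map_one]
  bd_snd _ _ _ _ _ := rfl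
  cocycle i j l m h h' h'' := hι <| by
    have := (c.contract fun _ ↦ 0).cocycle i j l m h h' h''
    rw [c.contract_fst hc, map_one, MulAut.one_apply] at this
    change _ = ι ((c.exists_contract_snd ι hker hc j l m h' h'').choose * _)
    simp only [map_mul, (c.exists_contract_snd ι hker hc _ _ _ _ _).choose_spec]
    exact this

lemma Cocycle.ι_toCentral_snd {n : SimplexCategory} (c : Cocycle X n)
    (hc : ∀ i j h, ∃ m, X.bd m = c.fst i j h) (i j l h h') :
    ι ((c.toCentral ι hι hker hc).snd i j l h h') = (c.contract fun _ ↦ 0).snd i j l h h' :=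
  (c.exists_contract_snd ι hker hc i j l h h').choose_spec

lemma Cocycle.toCentral_restrict {n n' : SimplexCategory} (c : Cocycle X n) (τ : n' ⟶ n)
    (hc' : ∀ i j h, ∃ m, X.bd m = (c.restrict τ).fst i j h)
    (hc : ∀ i j h, ∃ m, X.bd m = c.fst i j h) :
    (c.restrict τ).toCentral ι hι hker hc' = (c.toCentral ι hι hker hc).restrict τ := by
  apply Cocycle.ext
  · rfl
  · funext i j l h h'
    apply hι
    rw [ι_toCentral_snd]
    exact (ι_toCentral_snd ι hι hker c hc _ _ _ _ _).symm

lemma Cocycle.toCentral_centralCocycle (hz : ∀ z, X.bd (ι z) = 1) {n : SimplexCategory}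
    (c : Cocycle (ofComm Z) n)
    (hc : ∀ i j h, ∃ m, X.bd m = (centralCocycle ι hz c).fst i j h) :
    (centralCocycle ι hz c).toCentral ι hι hker hc = c := by
  apply Cocycle.ext
  · rfl
  · funext i j l h h'
    apply hι
    rw [ι_toCentral_snd, contract, gauge_one]
    · rfl
    · intro i j h
      rw [if_pos rfl]
      exact X.sec_one

include hι hker hbd in
-- Central cocycles form a retract of the fibre, because the gauge by `sec` does not move them. The
-- other composite is the full gauge, and it is joined to the identity by `Cocycle.contract` along
-- `Δ[1]`.
lemma homotopyEquivalent_fiber (hb : ∀ m, π (X.bd m) = 1) (b : classifyingSpace Q _⦋0⦌) :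
    HomotopyEquivalent (fiber (toBar X π hb) b) (cocycles (ofComm Z)) := by
  have hz := bd_ι ι hker
  have mem {n : SimplexCategoryᵒᵖ} (c : Cocycle X n.unop) :
      c ∈ (fiber (toBar X π hb) b).obj n ↔ ∀ i j h, ∃ m, X.bd m = c.fst i j h := by
    rw [mem_fiber_toBar]
    simp only [hbd]
  refine ⟨{ app := fun n ↦ ↾fun c ↦ Cocycle.toCentral ι hι hker c.1 ((mem _).1 c.2)
            naturality := fun n m θ ↦ ?_ },
    { app := fun n ↦ ↾fun c ↦ ⟨centralCocycle ι hz c, (mem _).2 fun _ _ _ ↦ ⟨1, map_one _⟩⟩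
      naturality := fun n m θ ↦ rfl }, ⟨{ app := fun n ↦ ↾fun p ↦ ⟨
          Cocycle.contract p.1.1 (side p.2), (mem _).2 fun i j h ↦ ?_⟩
                                          naturality := fun n m θ ↦ rfl }, ?_, ?_⟩,
    homotopic_refl_of_eq ?_⟩
  · ext c
    exact Cocycle.toCentral_restrict ι hι hker c.1 θ.unop
      (fun _ _ h ↦ (mem c.1).1 c.2 _ _ (θ.unop.toOrderHom.monotone h)) ((mem _).1 c.2)
  -- A gauge changes first components only by boundaries, so the homotopy stays in the fibre.
  · obtain ⟨m, hm⟩ := (mem _).1 p.1.2 i j h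
    refine ⟨(if side p.2 i = 0 then X.sec (p.1.1.fst i j h) else 1)⁻¹ * m, ?_⟩
    rw [map_mul, hm, map_inv]
    rfl
  · ext n c
    apply Subtype.ext
    apply Cocycle.ext
    · funext i j h
      exact Cocycle.contract_fst c.1 ((mem _).1 c.2) i j h
    · funext i j l h h'
      exact (Cocycle.ι_toCentral_snd ι hι hker c.1 ((mem _).1 c.2) _ _ _ _ _).symm
  · ext n c
    apply Subtype.ext
    exact Cocycle.contract_one c.1
  · ext n c
    exact Cocycle.toCentral_centralCocycle ι hι hker hz c fun _ _ _ ↦ ⟨1, map_one _⟩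

end Fibre

/-! ### The components -/

section Component

variable {G G' : SimplicialObject GrpCat.{u}} (E : Model X G) (E' : Model (ofComm Z) G')

lemma ActionSimplex.ext_zero {s t : ActionSimplex X ⦋0⦌} (h : s.vert 0 = t.vert 0) : s = t := by
  apply ActionSimplex.ext
  · funext i
    change Fin 1 at i
    rw [Subsingleton.elim i 0, h]
  · funext i j
    change Fin 1 at i j
    rw [Subsingleton.elim i j, s.edge_self, t.edge_self]

/-- By `bd_edge` two vertices are joined by an edge exactly when they differ by a boundary on the
left. This is already an equivalence relation. -/
lemma Model.mk_eq_mk_iff (v w : (underlying G) _⦋0⦌) :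
    SSet.π₀.mk v = SSet.π₀.mk w ↔
      ∃ m, (E.equiv _ v).vert 0 = X.bd m * (E.equiv _ w).vert 0 := by
  constructor
  · rw [SSet.π₀.mk_eq_mk_iff]
    intro h
    induction h with
    | rel v w h =>
      obtain ⟨e⟩ := h
      have h1 := e.src_eq
      have h2 := e.tgt_eq
      have e1 : (E.equiv _ v).vert 0 = (E.equiv ⦋1⦌ e.edge).vert (0 : Fin 2) :=
        (congrArg (fun s ↦ (E.equiv ⦋0⦌ s).vert 0) h1).symm.trans
          (congrArg (fun s : ActionSimplex X ⦋0⦌ ↦ s.vert 0)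
            (E.equiv_map (SimplexCategory.δ (1 : Fin 2)) e.edge))
      have e2 : (E.equiv _ w).vert 0 = (E.equiv ⦋1⦌ e.edge).vert (1 : Fin 2) :=
        (congrArg (fun s ↦ (E.equiv ⦋0⦌ s).vert 0) h2).symm.trans
          (congrArg (fun s : ActionSimplex X ⦋0⦌ ↦ s.vert 0)
            (E.equiv_map (SimplexCategory.δ (0 : Fin 2)) e.edge))
      rw [e1, e2]
      exact ⟨_, ((E.equiv ⦋1⦌ e.edge).bd_edge (0 : Fin 2) (1 : Fin 2)).symm⟩
    | refl v => exact ⟨1, by simp⟩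
    | symm v w _ ih =>
      obtain ⟨m, hm⟩ := ih
      exact ⟨m⁻¹, by rw [hm, map_inv, inv_mul_cancel_left]⟩
    | trans u v w _ _ ih1 ih2 =>
      obtain ⟨m, hm⟩ := ih1
      obtain ⟨m', hm'⟩ := ih2
      exact ⟨m * m', by rw [hm, hm', map_mul, mul_assoc]⟩
  · rintro ⟨m, hm⟩
    -- The cone out of `v` with labels `1` and `m` runs from `v` to `(bd m)⁻¹ · v`, which is `w`.
    refine SSet.π₀.sound (SSet.Edge.mk (X := underlying G) ((E.equiv ⦋1⦌).symm
      (ActionSimplex.cone X ⦋1⦌ ((E.equiv _ v).vert 0) ![1, m])) ?_ ?_)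
    · apply (E.equiv _).injective
      refine (E.equiv_map _ _).trans ?_
      rw [MulEquiv.apply_symm_apply]
      apply ActionSimplex.ext_zero
      change (X.bd 1)⁻¹ * _ = _
      simp
    · apply (E.equiv _).injective
      refine (E.equiv_map _ _).trans ?_
      rw [MulEquiv.apply_symm_apply]
      apply ActionSimplex.ext_zero
      change (X.bd m)⁻¹ * _ = _
      rw [hm, inv_mul_cancel_left]

lemma Model.mem_component_iff (v : (underlying G) _⦋0⦌) {n : SimplexCategoryᵒᵖ}
    (g : (underlying G).obj n) : g ∈ (component (SSet.π₀.mk v)).obj n ↔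
      ∀ i, ∃ m, (E.equiv n.unop g).vert i = X.bd m * (E.equiv _ v).vert 0 := by
  have h : ∀ f : ⦋0⦌ ⟶ n.unop, (E.equiv _ ((underlying G).map f.op g)).vert 0 =
      (E.equiv n.unop g).vert (f.toOrderHom 0) := fun f ↦
    congrArg (fun s ↦ s.vert 0) (E.equiv_map f g)
  constructor
  · intro hg i
    have := hg (SimplexCategory.const _ _ i)
    rw [E.mk_eq_mk_iff, h] at this
    exact this
  · intro hg f
    rw [E.mk_eq_mk_iff, h]
    exact hg _

/-- The gauge transformation of a simplex towards the vertex `a`, carried out on the vertices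
in position `0`. -/
noncomputable def ActionSimplex.contract {k : SimplexCategory} (s : ActionSimplex X k) (a : A)
    (t : Fin (k.len + 1) → Fin 2) : ActionSimplex X k :=
  s.gauge fun i ↦ if t i = 0 then X.sec (s.vert i * a⁻¹) else 1

lemma ActionSimplex.contract_vert {k : SimplexCategory} (s : ActionSimplex X k) (a : A)
    (hs : ∀ i, ∃ m, s.vert i = X.bd m * a) (i) : (s.contract a fun _ ↦ 0).vert i = a := by
  have : ∃ m, X.bd m = s.vert i * a⁻¹ := by
    obtain ⟨m, hm⟩ := hs i
    exact ⟨m, by rw [hm, mul_inv_cancel_right]⟩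
  simp [contract, gauge, X.bd_sec this]

include hker in
lemma ActionSimplex.exists_contract_edge {k : SimplexCategory} (s : ActionSimplex X k) (a : A)
    (hs : ∀ i, ∃ m, s.vert i = X.bd m * a) (i j) :
    ∃ z, ι z = (s.contract a fun _ ↦ 0).edge i j := by
  rw [← hker]
  have := (s.contract a fun _ ↦ 0).bd_edge i j
  rwa [contract_vert s a hs, contract_vert s a hs, mul_eq_right] at this

/-- The simplex of `BZ` associated with a simplex in the component of `a`. -/
noncomputable def ActionSimplex.toCentral {k : SimplexCategory} (s : ActionSimplex X k) (a : A)
    (hs : ∀ i, ∃ m, s.vert i = X.bd m * a) : ActionSimplex (ofComm Z) k where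
  vert _ := 1
  edge i j := (s.exists_contract_edge ι hker a hs i j).choose
  edge_mul i j l := hι <| by
    rw [map_mul, (s.exists_contract_edge ι hker a hs i j).choose_spec,
      (s.exists_contract_edge ι hker a hs j l).choose_spec,
      (s.exists_contract_edge ι hker a hs i l).choose_spec, edge_mul]
  bd_edge _ _ := rfl

lemma ActionSimplex.ι_toCentral_edge {k : SimplexCategory} (s : ActionSimplex X k) (a : A)
    (hs : ∀ i, ∃ m, s.vert i = X.bd m * a) (i j) :
    ι ((s.toCentral ι hι hker a hs).edge i j) = (s.contract a fun _ ↦ 0).edge i j :=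
  (s.exists_contract_edge ι hker a hs i j).choose_spec

lemma ActionSimplex.toCentral_restrict {k k' : SimplexCategory} (s : ActionSimplex X k) (a : A)
    (θ : k' ⟶ k) (hs : ∀ i, ∃ m, s.vert i = X.bd m * a) {s' : ActionSimplex X k'}
    (e : s' = s.restrict θ) (hs' : ∀ i, ∃ m, s'.vert i = X.bd m * a) :
    s'.toCentral ι hι hker a hs' = (s.toCentral ι hι hker a hs).restrict θ := by
  subst e
  apply ActionSimplex.ext
  · rfl
  · funext i j
    apply hι
    rw [ι_toCentral_edge]
    exact (ι_toCentral_edge ι hι hker s a hs _ _).symm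

/-- The simplex with constant vertices `a` and central edges. -/
def ActionSimplex.ofCentral (hz : ∀ z, X.bd (ι z) = 1) (a : A) {k : SimplexCategory}
    (s : ActionSimplex (ofComm Z) k) : ActionSimplex X k where
  vert _ := a
  edge i j := ι (s.edge i j)
  edge_mul i j l := by rw [← map_mul, s.edge_mul]
  bd_edge i j := by rw [hz, one_mul]

include hι hker E E' in
-- The argument for the fibre, one dimension lower: in the component of `a` each vertex is a
-- boundary times `a`. Gauging all vertices to `a` puts the edges into `ker bd`, which is `Z`, and
-- the gauge is switched off vertex by vertex along `Δ[1]`.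
lemma homotopyEquivalent_component (c : SSet.π₀ (underlying G)) :
    HomotopyEquivalent (component c) (underlying G') := by
  obtain ⟨v, rfl⟩ := SSet.π₀.mk_surjective c
  have hz := bd_ι ι hker
  set a := (E.equiv _ v).vert 0 with ha
  have mem {n : SimplexCategoryᵒᵖ} (g : (underlying G).obj n) :
      g ∈ (component (SSet.π₀.mk v)).obj n ↔
        ∀ i, ∃ m, (E.equiv n.unop g).vert i = X.bd m * a := E.mem_component_iff v g
  have mem_symm {n : SimplexCategoryᵒᵖ} (s : ActionSimplex X n.unop)
      (hs : ∀ i, ∃ m, s.vert i = X.bd m * a) :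
      ((E.equiv n.unop).symm s : (underlying G).obj n) ∈
        (component (SSet.π₀.mk v)).obj n := by
    rw [mem, MulEquiv.apply_symm_apply]; exact hs
  have hofc {k : SimplexCategory} (s : ActionSimplex (ofComm Z) k) (i) :
      ∃ m, (ActionSimplex.ofCentral ι hz a s).vert i = X.bd m * a :=
    ⟨1, by simp [ActionSimplex.ofCentral]⟩
  refine ⟨{ app := fun n ↦ ↾fun g ↦ (E'.equiv n.unop).symm
              ((E.equiv n.unop g.1).toCentral ι hι hker a ((mem _).1 g.2))
            naturality := fun n m θ ↦ ?_ },
    { app := fun n ↦ ↾fun g ↦ ⟨(E.equiv n.unop).symm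
        (ActionSimplex.ofCentral ι hz a (E'.equiv n.unop g)), mem_symm _ (hofc _)⟩
      naturality := fun n m θ ↦ ?_ },
    ⟨{ app := fun n ↦ ↾fun p ↦ ⟨(E.equiv n.unop).symm
        ((E.equiv n.unop p.1.1).contract a (side p.2)), mem_symm _ fun i ↦ ?_⟩
       naturality := fun n m θ ↦ ?_ }, ?_, ?_⟩,
    homotopic_refl_of_eq ?_⟩
  · ext g
    apply (E'.equiv m.unop).injective
    refine (MulEquiv.apply_symm_apply _ _).trans ?_
    refine Eq.trans ?_ (E'.equiv_map θ.unop _).symm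
    refine Eq.trans ?_ (congrArg (ActionSimplex.restrict θ.unop)
      (MulEquiv.apply_symm_apply _ _).symm)
    exact ActionSimplex.toCentral_restrict ι hι hker _ a θ.unop ((mem _).1 g.2)
      (E.equiv_map θ.unop g.1) _
  · ext g
    apply Subtype.ext
    apply (E.equiv m.unop).injective
    refine (MulEquiv.apply_symm_apply _ _).trans ?_
    refine Eq.trans ?_ (E.equiv_map θ.unop _).symm
    refine Eq.trans ?_ (congrArg (ActionSimplex.restrict θ.unop)
      (MulEquiv.apply_symm_apply _ _).symm)
    exact congrArg (ActionSimplex.ofCentral ι hz a) (E'.equiv_map θ.unop g)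
  · obtain ⟨m, hm⟩ := (mem _).1 p.1.2 i
    refine ⟨(if side p.2 i = 0 then X.sec ((E.equiv n.unop p.1.1).vert i * a⁻¹) else 1)⁻¹ * m, ?_⟩
    rw [map_mul, mul_assoc, ← hm, map_inv]
    rfl
  · ext p
    apply Subtype.ext
    apply (E.equiv m.unop).injective
    refine (MulEquiv.apply_symm_apply _ _).trans ?_
    refine Eq.trans ?_ (E.equiv_map θ.unop _).symm
    refine Eq.trans ?_ (congrArg (ActionSimplex.restrict θ.unop)
      (MulEquiv.apply_symm_apply _ _).symm)
    exact congrArg (fun s ↦ ActionSimplex.contract s a (fun i ↦ side p.2 (θ.unop.toOrderHom i)))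
      (E.equiv_map θ.unop p.1.1)
  · ext n g
    apply Subtype.ext
    apply congrArg (E.equiv n.unop).symm
    refine Eq.trans ?_ (congrArg (ActionSimplex.ofCentral ι hz a)
      (MulEquiv.apply_symm_apply _ _).symm)
    apply ActionSimplex.ext
    · funext i
      exact ActionSimplex.contract_vert _ a ((mem _).1 g.2) i
    · funext i j
      exact (ActionSimplex.ι_toCentral_edge ι hι hker _ a ((mem _).1 g.2) i j).symm
  · ext n g
    apply Subtype.ext
    exact ((E.equiv n.unop).symm_apply_eq).2 (ActionSimplex.gauge_one _)
  · ext n g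
    refine ((E'.equiv n.unop).symm_apply_eq).2 ?_
    apply ActionSimplex.ext
    · rfl
    · funext i j
      apply hι
      refine (ActionSimplex.ι_toCentral_edge _ _ _ _ _ _ _ _).trans ?_
      have e := (E.equiv n.unop).apply_symm_apply
        (ActionSimplex.ofCentral ι hz a (E'.equiv n.unop g))
      refine (congrArg (fun s ↦ (ActionSimplex.contract s a fun _ ↦ 0).edge i j) e).trans ?_
      simp only [ActionSimplex.contract, ActionSimplex.gauge, ActionSimplex.ofCentral, if_true,
        mul_inv_cancel, sec_one, inv_one, one_mul, mul_one]
      rfl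

end Component

end CrossedModule

/-! ### The simplicial group `BZ` as a model. -/

namespace CrossedModule

open PartialGroup (classifyingSpace barGroup)

/-- The simplicial group `BZ` is modelled on the crossed module of the abelian group `Z`. -/
def barModel (Z : Type u) [CommGroup Z] : Model (ofComm Z) (barGroup Z) where
  equiv k := MulEquiv.symm
    { toFun := fun s ↦ barMk (Q := Z) (n := Opposite.op k) (fun i j _ ↦ s.edge i j)
        (fun i ↦ s.edge_self i) (fun i j l _ _ ↦ (mul_comm _ _).trans (s.edge_mul i j l))
      invFun := fun F ↦
        { vert := fun _ ↦ 1
          -- `barVal` needs ordered indices, so an arbitrary pair is routed through the vertex `0`.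
          edge := fun i j ↦ (barVal (Q := Z) F 0 i (Fin.zero_le i))⁻¹ *
            barVal (Q := Z) F 0 j (Fin.zero_le j)
          edge_mul := fun _ _ _ ↦ by group
          bd_edge := fun _ _ ↦ rfl }
      left_inv := fun s ↦ by
        apply ActionSimplex.ext
        · rfl
        · funext i j
          change (s.edge 0 i)⁻¹ * s.edge 0 j = s.edge i j
          rw [s.edge_inv, s.edge_mul]
      right_inv := fun F ↦ bar_ext fun i j h ↦ by
        change (barVal (Q := Z) F 0 i (Fin.zero_le i))⁻¹ * barVal (Q := Z) F 0 j (Fin.zero_le j) =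
          barVal (Q := Z) F i j h
        rw [← barVal_mul (Q := Z) F 0 i j (Fin.zero_le i) h, mul_comm, mul_inv_cancel_right]
      map_mul' := fun s t ↦ bar_ext fun i j h ↦ mul_comm (t.edge i j) (s.edge i j) }
  equiv_map {k k'} θ F := by
    apply ActionSimplex.ext
    · rfl
    · funext i j
      change (barVal (Q := Z) F (θ.toOrderHom 0) (θ.toOrderHom i)
        (θ.toOrderHom.monotone (Fin.zero_le i)))⁻¹ * barVal (Q := Z) F (θ.toOrderHom 0)
          (θ.toOrderHom j) (θ.toOrderHom.monotone (Fin.zero_le j)) =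
        (barVal (Q := Z) F 0 (θ.toOrderHom i) (Fin.zero_le _))⁻¹ *
          barVal (Q := Z) F 0 (θ.toOrderHom j) (Fin.zero_le _)
      rw [← barVal_mul (Q := Z) F 0 (θ.toOrderHom 0) (θ.toOrderHom i) (Fin.zero_le _)
          (θ.toOrderHom.monotone (Fin.zero_le i)),
        ← barVal_mul (Q := Z) F 0 (θ.toOrderHom 0) (θ.toOrderHom j) (Fin.zero_le _)
          (θ.toOrderHom.monotone (Fin.zero_le j)), mul_comm _ (barVal (Q := Z) F 0 _ _),
          mul_comm _ (barVal (Q := Z) F 0 _ _)]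
      group

end CrossedModule

namespace PartialGroup

open MonoidalCategory CartesianMonoidalCategory CrossedModule

/-! ### The crossed module of a partial group -/

section

variable {M : Type u} [PartialGroup M]

lemma Intertwines.conjHom_eq {η : Normalizer M} {α : Aut M} (h : Intertwines α η.1) :
    conjHom M η = α := by
  apply Subtype.ext
  ext x
  rw [conjHom_apply, h.conj_eq]

lemma Normalizer.intertwines (η : Normalizer M) : Intertwines (conjHom M η) η.1 :=
  η.2.intertwines (conjHom_apply η)

/-- Pull the word back by `α⁻¹`, split it at `η`, and apply `α`. This yields both the action of
`Aut(M)` on `N(M)` and the equivariance `bd_act`. -/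
lemma Intertwines.map {η : M} {β : Aut M} (h : Intertwines β η) (α : Aut M) :
    Intertwines (α * β * α⁻¹) (α.1 η) := by
  intro u v huv
  have h0 : ∀ w : List M, (w.map (α⁻¹).1).map α.1 = w := fun w ↦ by simp [Function.comp_def]
  have h1 := Aut.map_mem α⁻¹ huv
  rw [List.map_append] at h1
  obtain ⟨h2, h3⟩ := h _ _ h1
  have e : ((u.map (α⁻¹).1).map β.1 ++ η :: v.map (α⁻¹).1).map α.1 =
      u.map (α * β * α⁻¹).1 ++ α.1 η :: v := by
    simp [Function.comp_def]
  rw [← e]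
  refine ⟨Aut.map_mem α h2, ?_⟩
  rw [Aut.prod_map α h2, h3, ← Aut.prod_map α (h.cons_mem h1), List.map_cons, List.map_append,
    h0, h0]

/-- The action of an automorphism on the normalizer. -/
def Normalizer.map (α : Aut M) (η : Normalizer M) : Normalizer M :=
  ⟨α.1 η.1, (η.intertwines.map α).isNormalizing⟩

variable (M) in
/-- The crossed module `N(M) → Aut(M)`. -/
noncomputable def crossedModule : CrossedModule (Normalizer M) (Aut M) where
  bd := conjHom M
  act :=
    { toFun := fun α ↦
        { toFun := Normalizer.map α
          invFun := Normalizer.map α⁻¹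
          left_inv := fun η ↦ Subtype.ext (by simp [Normalizer.map])
          right_inv := fun η ↦ Subtype.ext (by simp [Normalizer.map])
          map_mul' := fun a b ↦ Subtype.ext
            (Aut.prod_map α (a.intertwines.cons_mem (singleton_mem b.1))).symm }
      map_one' := rfl
      map_mul' := fun _ _ ↦ rfl }
  bd_act α η := Intertwines.conjHom_eq (η := Normalizer.map α η) (η.intertwines.map α)
  act_bd m n := Subtype.ext (by
    refine (conjHom_apply m n.1).trans ?_
    exact (prod_cons_append (u := [m.1, n.1]) (v := [m.1⁻¹]) (m.2.conj_mem n.1)).2)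

/-! ### Simplices of the function complex as families of functions -/

/-- A word in the domain, as a simplex. -/
def wordSimplex {k : SimplexCategory} (w : List M) (h : w ∈ dom) (hl : w.length = k.len) :
    (nerve M).obj (Opposite.op k) := ⟨w, h, hl⟩

/-- The value of a simplex of the function complex. -/
def evalSimplex {n k : SimplexCategory} (F : EndSimplex (nerve M) n)
    (w : (nerve M).obj (Opposite.op k)) (t : k ⟶ n) : (nerve M).obj (Opposite.op k) :=
  NatTrans.app (show nerve M ⊗ SSet.stdSimplex.{u}.obj n ⟶ nerve M from F) (Opposite.op k)
    (w, SSet.stdSimplex.objEquiv.symm t)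

lemma evalSimplex_map {n k k' : SimplexCategory} (F : EndSimplex (nerve M) n)
    (w : (nerve M).obj (Opposite.op k)) (t : k ⟶ n) (θ : k' ⟶ k) :
    evalSimplex F ((nerve M).map θ.op w) (θ ≫ t) = (nerve M).map θ.op (evalSimplex F w t) :=
  congrArg (fun f : (nerve M ⊗ SSet.stdSimplex.{u}.obj n).obj (Opposite.op k) ⟶
    (nerve M).obj (Opposite.op k') ↦ f (w, SSet.stdSimplex.objEquiv.symm t))
    (NatTrans.naturality (show nerve M ⊗ SSet.stdSimplex.{u}.obj n ⟶ nerve M from F) θ.op)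

lemma evalSimplex_ext {n : SimplexCategory} {F G : EndSimplex (nerve M) n}
    (h : ∀ (k : SimplexCategory) (w : (nerve M).obj (Opposite.op k)) (t : k ⟶ n),
      (evalSimplex F w t).1 = (evalSimplex G w t).1) : F = G := by
  refine NatTrans.ext (funext fun k ↦ ?_)
  ext ⟨w, t⟩
  obtain ⟨t, rfl⟩ := SSet.stdSimplex.objEquiv.symm.surjective t
  exact Subtype.ext (h k.unop w t)

lemma evalSimplex_mul {n k : SimplexCategory} (F G : EndSimplex (nerve M) n)
    (w : (nerve M).obj (Opposite.op k)) (t : k ⟶ n) :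
    evalSimplex (F * G) w t = evalSimplex F (evalSimplex G w t) t := rfl

/-- The action of a simplex of the function complex on letters, over an edge. -/
def letter {n : SimplexCategory} (F : EndSimplex (nerve M) n) (i j : Fin (n.len + 1)) (h : i ≤ j)
    (x : M) : M :=
  prod (evalSimplex F (wordSimplex (k := ⦋1⦌) [x] (singleton_mem x) rfl) (edgeHom i j h)).1

lemma letter_congr {n : SimplexCategory} (F : EndSimplex (nerve M) n) {i j i' j' : Fin (n.len + 1)}
    {x x' : M} (h : i ≤ j) (hi : i' = i) (hj : j' = j) (hx : x' = x) :
    letter F i j h x = letter F i' j' (by rwa [hi, hj]) x' := by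
  subst hi hj hx; rfl

/-- Naturality of `F` for the edge `i → j` of the `k`-simplex. Consecutive indices give the letters
of an image word, and the extreme ones give its product. -/
lemma prod_slice_evalSimplex {n k : SimplexCategory} (F : EndSimplex (nerve M) n)
    (w : (nerve M).obj (Opposite.op k)) (t : k ⟶ n) (i j : Fin (k.len + 1)) (h : i ≤ j) :
    prod (slice (evalSimplex F w t).1 i j) =
      letter F (t.toOrderHom i) (t.toOrderHom j) (t.toOrderHom.monotone h)
        (prod (slice w.1 i j)) := by
  have h1 := congrArg (fun s ↦ prod s.1) (evalSimplex_map F w t (edgeHom i j h))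
  rw [edgeHom_comp] at h1
  refine Eq.trans ?_ h1.symm
  exact (prod_singleton _).symm

lemma slice_full {α : Type*} (w : List α) {m : ℕ} (h : w.length = m) : slice w 0 m = w := by
  simp [slice, ← h]

lemma prod_slice_succ (w : List M) (r : ℕ) (h : r < w.length) : prod (slice w r (r + 1)) = w[r] := by
  rw [slice_succ w le_rfl h, slice_self, List.nil_append, prod_singleton]

lemma getElem_evalSimplex {n k : SimplexCategory} (F : EndSimplex (nerve M) n)
    (w : (nerve M).obj (Opposite.op k)) (t : k ⟶ n) (r : ℕ)
    (h : r < (evalSimplex F w t).1.length) (h' : r < w.1.length) (hr : r < k.len) :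
    (evalSimplex F w t).1[r] = letter F (t.toOrderHom ⟨r, by omega⟩)
      (t.toOrderHom ⟨r + 1, by omega⟩) (t.toOrderHom.monotone (Fin.mk_le_mk.2 (Nat.le_succ r)))
        w.1[r] := by
  have := prod_slice_evalSimplex F w t ⟨r, by omega⟩ ⟨r + 1, by omega⟩
    (Fin.mk_le_mk.2 (Nat.le_succ r))
  rw [prod_slice_succ _ _ h, prod_slice_succ _ _ h'] at this
  exact this

lemma prod_evalSimplex {n k : SimplexCategory} (F : EndSimplex (nerve M) n)
    (w : (nerve M).obj (Opposite.op k)) (t : k ⟶ n) :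
    prod (evalSimplex F w t).1 = letter F (t.toOrderHom 0) (t.toOrderHom (Fin.last _))
      (t.toOrderHom.monotone (Fin.zero_le _)) (prod w.1) := by
  have := prod_slice_evalSimplex F w t 0 (Fin.last _) (Fin.zero_le _)
  have e1 : slice (evalSimplex F w t).1 (0 : Fin (k.len + 1)) (Fin.last k.len) = _ :=
    slice_full _ (evalSimplex F w t).2.2
  have e2 : slice w.1 (0 : Fin (k.len + 1)) (Fin.last k.len) = _ := slice_full _ w.2.2
  rwa [e1, e2] at this

lemma letter_ext {n : SimplexCategory} {F G : EndSimplex (nerve M) n}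
    (h : ∀ i j h x, letter F i j h x = letter G i j h x) : F = G := by
  refine evalSimplex_ext fun k w t ↦ ?_
  have h1 : (evalSimplex F w t).1.length = k.len := (evalSimplex F w t).2.2
  have h2 : (evalSimplex G w t).1.length = k.len := (evalSimplex G w t).2.2
  have h3 : w.1.length = k.len := w.2.2
  refine List.ext_getElem (h1.trans h2.symm) fun r hr hr' ↦ ?_
  rw [getElem_evalSimplex F w t r hr (by omega) (by omega),
    getElem_evalSimplex G w t r hr' (by omega) (by omega), h]

lemma evalSimplex_singleton {n : SimplexCategory} (F : EndSimplex (nerve M) n)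
    (i j : Fin (n.len + 1)) (h : i ≤ j) (x : M) :
    evalSimplex F (wordSimplex (k := ⦋1⦌) [x] (singleton_mem x) rfl) (edgeHom i j h) =
      wordSimplex (k := ⦋1⦌) [letter F i j h x] (singleton_mem _) rfl := by
  apply Subtype.ext
  obtain ⟨y, hy⟩ := List.length_eq_one_iff.1 (evalSimplex F (wordSimplex (k := ⦋1⦌) [x]
    (singleton_mem x) rfl) (edgeHom i j h)).2.2
  rw [letter, hy, prod_singleton]
  rfl

lemma letter_mul {n : SimplexCategory} (F G : EndSimplex (nerve M) n) (i j : Fin (n.len + 1))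
    (h : i ≤ j) (x : M) : letter (F * G) i j h x = letter F i j h (letter G i j h x) := by
  rw [letter, evalSimplex_mul, evalSimplex_singleton]
  rfl

lemma letter_one {n : SimplexCategory} (i j : Fin (n.len + 1)) (h : i ≤ j) (x : M) :
    letter (1 : EndSimplex (nerve M) n) i j h x = x := prod_singleton x

lemma evalSimplex_const {n k : SimplexCategory} (F : EndSimplex (nerve M) n)
    (w : (nerve M).obj (Opposite.op k)) (i : Fin (n.len + 1)) :
    (evalSimplex F w (SimplexCategory.const k n i)).1 = w.1.map (letter F i i le_rfl) := by
  set W := evalSimplex F w (SimplexCategory.const k n i)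
  have h1 : W.1.length = k.len := W.2.2
  have h3 : w.1.length = k.len := w.2.2
  refine List.ext_getElem (by simp [h1, h3]) fun r hr hr' ↦ ?_
  rw [getElem_evalSimplex F w _ r hr (by omega) (by omega), List.getElem_map]
  rfl

lemma map_letter_mem {n : SimplexCategory} (F : EndSimplex (nerve M) n) (i : Fin (n.len + 1))
    {w : List M} (hw : w ∈ dom) : w.map (letter F i i le_rfl) ∈ dom := by
  have := (evalSimplex F (wordSimplex (k := ⦋w.length⦌) w hw rfl)
    (SimplexCategory.const _ n i)).2.1
  rwa [evalSimplex_const] at this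

lemma prod_map_letter {n : SimplexCategory} (F : EndSimplex (nerve M) n) (i : Fin (n.len + 1))
    {w : List M} (hw : w ∈ dom) :
    prod (w.map (letter F i i le_rfl)) = letter F i i le_rfl (prod w) := by
  have := prod_evalSimplex F (wordSimplex (k := ⦋w.length⦌) w hw rfl) (SimplexCategory.const _ n i)
  rw [evalSimplex_const] at this
  exact this

lemma insert_one {u v : List M} (h : u ++ v ∈ dom) :
    u ++ prod [] :: v ∈ dom ∧ prod (u ++ prod [] :: v) = prod (u ++ v) := by
  have := prod_append u [] v (by simpa using h)
  simp only [List.append_nil, List.append_assoc, List.singleton_append] at this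
  exact ⟨this.1, this.2.symm⟩

/-- The key property of the letter functions: a simplex of the function complex intertwines its
vertices. -/
lemma letter_intertwines {n : SimplexCategory} (F : EndSimplex (nerve M) n)
    (i j : Fin (n.len + 1)) (h : i ≤ j) {u v : List M} (huv : u ++ v ∈ dom) :
    u.map (letter F i i le_rfl) ++ letter F i j h (prod []) :: v.map (letter F j j le_rfl) ∈ dom ∧
    prod (u.map (letter F i i le_rfl) ++ letter F i j h (prod []) ::
      v.map (letter F j j le_rfl)) = letter F i j h (prod (u ++ v)) := by
  obtain ⟨h1, h2⟩ := insert_one huv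
  let k : SimplexCategory := ⦋u.length + v.length + 1⦌
  let w := wordSimplex (k := k) _ h1 (by simp [k]; omega)
  -- The vertices `0, …, |u|` go to `i` and the later ones to `j`, so the only nonconstant edge of
  -- the spine is the one carrying the inserted unit.
  let t : k ⟶ n := SimplexCategory.Hom.mk
    { toFun := fun r ↦ if (r : ℕ) ≤ u.length then i else j
      monotone' := fun r s hrs ↦ by
        have : (r : ℕ) ≤ s := hrs
        dsimp only
        split_ifs
        · exact le_rfl
        · exact h
        · omega
        · exact le_rfl }
  have ht : ∀ r, t.toOrderHom r = if (r : ℕ) ≤ u.length then i else j := fun r ↦ rfl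
  have e : (evalSimplex F w t).1 = u.map (letter F i i le_rfl) ++ letter F i j h (prod []) ::
      v.map (letter F j j le_rfl) := by
    have hl : (evalSimplex F w t).1.length = u.length + v.length + 1 := (evalSimplex F w t).2.2
    have hl' : w.1.length = u.length + v.length + 1 := w.2.2
    refine List.ext_getElem (by simp [hl]; omega) fun r hr hr' ↦ ?_
    have hr2 : r < k.len := lt_of_lt_of_eq hr hl
    rw [getElem_evalSimplex F w t r hr (by omega) hr2]
    rcases lt_trichotomy r u.length with hru | rfl | hru
    · rw [List.getElem_append_left (by simpa using hru), List.getElem_map]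
      refine letter_congr F _ ?_ ?_ ?_
      · rw [ht, if_pos (by simpa using hru.le)]
      · rw [ht, if_pos (by simpa using hru)]
      · exact (List.getElem_append_left (bs := prod [] :: v) hru).symm
    · rw [List.getElem_append_right (by simp)]
      simp only [List.length_map, Nat.sub_self, List.getElem_cons_zero]
      refine letter_congr F _ ?_ ?_ ?_
      · rw [ht, if_pos (by simp)]
      · rw [ht, if_neg (by simp)]
      · have e1 : (u ++ prod [] :: v)[u.length]'(by simp) = prod [] := by simp
        exact e1.symm
    · obtain ⟨q, rfl⟩ : ∃ q, r = u.length + (q + 1) := ⟨r - u.length - 1, by omega⟩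
      rw [List.getElem_append_right (by simp)]
      simp only [List.length_map, Nat.add_sub_cancel_left, List.getElem_cons_succ,
        List.getElem_map]
      refine letter_congr F _ ?_ ?_ ?_
      · rw [ht, if_neg (by simp)]
      · rw [ht, if_neg (by simp)]
      · have e1 : (u ++ prod [] :: v)[u.length + (q + 1)]'(by simp at hr' ⊢; omega) =
            v[q]'(by simp at hr'; omega) := by simp
        exact e1.symm
  rw [← e]
  refine ⟨(evalSimplex F w t).2.1, ?_⟩
  rw [prod_evalSimplex]
  refine letter_congr F _ ?_ ?_ ?_
  · rw [ht, if_pos (by simp)]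
  · rw [ht, if_neg (by simp [k])]
  · exact h2.symm

lemma letter_eq {n : SimplexCategory} (F : EndSimplex (nerve M) n)
    (i j : Fin (n.len + 1)) (h : i ≤ j) (x : M) :
    letter F i j h x = prod [letter F i i le_rfl x, letter F i j h (prod [])] := by
  have := (letter_intertwines F i j h (u := [x]) (v := []) (singleton_mem x)).2
  rw [List.append_nil, prod_singleton] at this
  exact this.symm

end

end PartialGroup

namespace PartialGroup

open MonoidalCategory CartesianMonoidalCategory CrossedModule

section

variable {M : Type u} [PartialGroup M]

/-! ### Simplices of the function complex from the crossed module -/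

variable {n : SimplexCategory} (s : ActionSimplex (crossedModule M) n)

lemma vert_apply (i j : Fin (n.len + 1)) (x : M) :
    (s.vert i).1 x = (conjHom M (s.edge i j)).1 ((s.vert j).1 x) := by
  rw [← s.bd_edge i j]; rfl

/-- By `bd_edge`, `s.vert i` is `s.vert j` followed by conjugation by the edge element. Moving that
element from the front of a word past `u` therefore changes the index `j` on `u` to `i`. -/
lemma move_edge (i j : Fin (n.len + 1)) {u v : List M} (h : u.map (s.vert j).1 ++ v ∈ dom) :
    u.map (s.vert i).1 ++ (s.edge i j).1 :: v ∈ dom ∧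
      prod (u.map (s.vert i).1 ++ (s.edge i j).1 :: v) =
        prod ((s.edge i j).1 :: (u.map (s.vert j).1 ++ v)) := by
  have e : u.map (s.vert i).1 = (u.map (s.vert j).1).map (conjHom M (s.edge i j)).1 := by
    rw [List.map_map]
    exact List.map_congr_left fun x _ ↦ vert_apply s i j x
  rw [e]
  exact (s.edge i j).intertwines _ _ h

/-- The two-letter words with product the letters of the image of a word. -/
def twistBlocks (w : List M) (t : ℕ → Fin (n.len + 1)) : List (List M) :=
  match w with
  | [] => []
  | x :: w => [(s.vert (t 0)).1 x, (s.edge (t 0) (t 1)).1] :: twistBlocks w fun r ↦ t (r + 1)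

lemma length_twistBlocks (w : List M) : ∀ t, (twistBlocks s w t).length = w.length := by
  induction w with
  | nil => intro t; rfl
  | cons x w ih => intro t; simp [twistBlocks, ih]

lemma take_twistBlocks (w : List M) : ∀ t b,
    (twistBlocks s w t).take b = twistBlocks s (w.take b) t := by
  induction w with
  | nil => intro t b; simp [twistBlocks]
  | cons x w ih =>
    intro t b
    cases b with
    | zero => simp [twistBlocks]
    | succ b => simp [twistBlocks, ih]

lemma drop_twistBlocks (w : List M) : ∀ t b,
    (twistBlocks s w t).drop b = twistBlocks s (w.drop b) fun r ↦ t (r + b) := by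
  induction w with
  | nil => intro t b; simp [twistBlocks]
  | cons x w ih =>
    intro t b
    cases b with
    | zero => simp [twistBlocks]
    | succ b =>
      simp only [twistBlocks, List.drop_succ_cons, ih]
      congr 1

lemma slice_twistBlocks (w : List M) (t) (a b : ℕ) :
    slice (twistBlocks s w t) a b = twistBlocks s (slice w a b) fun r ↦ t (r + a) := by
  rw [slice, take_twistBlocks, drop_twistBlocks, slice]

lemma getElem_twistBlocks (w : List M) : ∀ (t) (r : ℕ) (h : r < (twistBlocks s w t).length)
    (h' : r < w.length), (twistBlocks s w t)[r] =
      [(s.vert (t r)).1 w[r], (s.edge (t r) (t (r + 1))).1] := by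
  induction w with
  | nil => intro t r h h'; simp at h'
  | cons x w ih =>
    intro t r h h'
    cases r with
    | zero => rfl
    | succ r => exact ih _ r (by simpa [twistBlocks] using h) (by simpa using h')

/-- Induction on `v` with an arbitrary prefix `u`, so that `move_edge` can insert the first edge
element behind `u` and `x`. For the product, that element is moved to the front, the tail is
collapsed by induction, and the element is moved back to the end, where it combines with the
remaining edge by `edge_mul`. -/
lemma flatten_twistBlocks_mem (v : List M) : ∀ (u : List M) (t : ℕ → Fin (n.len + 1)),
    u ++ v ∈ dom → u.map (s.vert (t 0)).1 ++ (twistBlocks s v t).flatten ∈ dom ∧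
      prod (u.map (s.vert (t 0)).1 ++ (twistBlocks s v t).flatten) =
        prod ((u ++ v).map (s.vert (t 0)).1 ++ [(s.edge (t 0) (t v.length)).1]) := by
  induction v with
  | nil =>
    intro u t h
    rw [List.append_nil] at h
    have h1 : u.map (s.vert (t 0)).1 ++ [] ∈ dom := by
      rw [List.append_nil]; exact Aut.map_mem _ h
    refine ⟨h1, ?_⟩
    simp only [twistBlocks, List.flatten_nil, List.length_nil, s.edge_self]
    rw [(prod_append_cons h1).2, List.append_nil]
    rfl
  | cons x v ih =>
    intro u t h
    obtain ⟨h1, h2⟩ := ih (u ++ [x]) (fun r ↦ t (r + 1)) (by simpa using h)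
    obtain ⟨h3, h4⟩ := move_edge s (t 0) (t 1) h1
    have e : (u ++ [x]).map (s.vert (t 0)).1 ++ (s.edge (t 0) (t 1)).1 ::
        (twistBlocks s v fun r ↦ t (r + 1)).flatten =
        u.map (s.vert (t 0)).1 ++ (twistBlocks s (x :: v) t).flatten := by
      simp [twistBlocks]
    rw [e] at h3 h4
    refine ⟨h3, h4.trans ?_⟩
    set w := u ++ x :: v with hw
    have hw' : u ++ [x] ++ v = w := by simp [hw]
    rw [hw'] at h2
    have h5 : [(s.edge (t 0) (t 1)).1] ++ _ ∈ dom :=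
      (s.edge (t 0) (t 1)).intertwines.cons_mem h1
    refine (prod_append_cons h5).2.trans
      ((congrArg (fun y ↦ prod ([(s.edge (t 0) (t 1)).1] ++ [y])) h2).trans ?_)
    have h6 : w.map (s.vert (t 1)).1 ++ [(s.edge (t 1) (t (v.length + 1))).1] ∈ dom := by
      have h61 : w.map (s.vert (t (v.length + 1))).1 ++ [] ∈ dom := by
        rw [List.append_nil]; exact Aut.map_mem _ h
      exact (move_edge s (t 1) (t (v.length + 1)) h61).1
    have h7 : [(s.edge (t 0) (t 1)).1] ++ _ ∈ dom :=
      (s.edge (t 0) (t 1)).intertwines.cons_mem h6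
    refine (prod_append_cons h7).2.symm.trans ?_
    obtain ⟨h8, h9⟩ := move_edge s (t 0) (t 1) h6
    refine h9.symm.trans ((prod_append_cons h8).2.trans ?_)
    rw [List.length_cons, ← s.edge_mul (t 0) (t 1) (t (v.length + 1))]
    rfl

/-- The image of a word under a simplex of the function complex. -/
def twistWord (w : List M) (t : ℕ → Fin (n.len + 1)) : List M := (twistBlocks s w t).map prod

lemma length_twistWord (w : List M) (t) : (twistWord s w t).length = w.length := by
  rw [twistWord, List.length_map, length_twistBlocks]

lemma getElem_twistWord (w : List M) (t) (r : ℕ) (h : r < (twistWord s w t).length)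
    (h' : r < w.length) : (twistWord s w t)[r] =
      prod [(s.vert (t r)).1 w[r], (s.edge (t r) (t (r + 1))).1] := by
  simp only [twistWord, List.getElem_map]
  rw [getElem_twistBlocks s w t r (by rwa [length_twistBlocks]) h']

lemma map_append_edge_mem (i j : Fin (n.len + 1)) {w : List M} (hw : w ∈ dom) :
    w.map (s.vert i).1 ++ [(s.edge i j).1] ∈ dom :=
  (move_edge s i j (v := []) (by rw [List.append_nil]; exact Aut.map_mem _ hw)).1

lemma twistWord_mem {w : List M} (hw : w ∈ dom) (t : ℕ → Fin (n.len + 1)) :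
    twistWord s w t ∈ dom ∧ prod (twistWord s w t) =
      prod [(s.vert (t 0)).1 (prod w), (s.edge (t 0) (t w.length)).1] := by
  obtain ⟨h1, h2⟩ := flatten_twistBlocks_mem s w [] t (by simpa using hw)
  obtain ⟨h3, h4⟩ := flatten_mem (twistBlocks s w t) [] h1
  refine ⟨h3, h4.trans (h2.trans ?_)⟩
  rw [List.nil_append, (prod_cons_append (map_append_edge_mem s _ _ hw)).2, Aut.prod_map _ hw]

lemma prod_slice_twistWord {w : List M} (hw : w ∈ dom) (t : ℕ → Fin (n.len + 1)) {a b : ℕ}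
    (hab : a ≤ b) (hb : b ≤ w.length) : prod (slice (twistWord s w t) a b) =
      prod [(s.vert (t a)).1 (prod (slice w a b)), (s.edge (t a) (t b)).1] := by
  rw [twistWord, slice_map, slice_twistBlocks]
  refine (twistWord_mem s (slice_mem hw a b) fun r ↦ t (r + a)).2.trans ?_
  have hl : (slice w a b).length + a = b := by simp [slice]; omega
  rw [hl, zero_add]

/-- The vertices of a simplex of `Δ[n]`, continued constantly. -/
def vertexSeq {k : SimplexCategory} (t : k ⟶ n) (r : ℕ) : Fin (n.len + 1) :=
  t.toOrderHom ⟨min r k.len, by omega⟩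

lemma vertexSeq_val {k : SimplexCategory} (t : k ⟶ n) (i : Fin (k.len + 1)) :
    vertexSeq t i = t.toOrderHom i := by
  have : (⟨min i k.len, by omega⟩ : Fin (k.len + 1)) = i := Fin.ext (by simp; omega)
  rw [vertexSeq, this]

/-- Inside a block cut out by `θ` the edge elements telescope (`prod_slice_twistWord`), leaving one
vertex automorphism applied to the product of the block, times the edge between its ends. -/
lemma twistWord_restrict {k k' : SimplexCategory} (θ : k' ⟶ k) (t : k ⟶ n) {w : List M}
    (hw : w ∈ dom) (hl : w.length = k.len) :
    twistWord s (restrictWord θ.toOrderHom w) (vertexSeq (θ ≫ t)) =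
      restrictWord θ.toOrderHom (twistWord s w (vertexSeq t)) := by
  apply List.ext_getElem
  · simp [length_twistWord, restrictWord]
  · intro r h1 h2
    have hr : r < k'.len := by simpa [restrictWord] using h2
    rw [getElem_twistWord s _ _ r h1 (by simpa [restrictWord] using hr)]
    simp only [restrictWord, List.getElem_ofFn]
    rw [prod_slice_twistWord s hw _ (θ.toOrderHom.monotone (Fin.castSucc_le_succ _))
      (by rw [hl]; exact Nat.le_of_lt_succ (θ.toOrderHom _).2), vertexSeq_val, vertexSeq_val]
    have e1 := vertexSeq_val (θ ≫ t) (⟨r, hr⟩ : Fin k'.len).castSucc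
    have e2 := vertexSeq_val (θ ≫ t) (⟨r, hr⟩ : Fin k'.len).succ
    simp only [Fin.val_castSucc, Fin.val_succ] at e1 e2
    rw [e1, e2]
    rfl

/-- The simplex of the function complex defined by the crossed module. -/
def twist : EndSimplex (nerve M) n :=
  show nerve M ⊗ SSet.stdSimplex.{u}.obj n ⟶ nerve M from
  { app := fun k ↦ ↾fun p ↦ ⟨twistWord s p.1.1 (vertexSeq (SSet.stdSimplex.objEquiv p.2)),
      (twistWord_mem s p.1.2.1 _).1, by rw [length_twistWord]; exact p.1.2.2⟩
    naturality := fun k k' θ ↦ by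
      ext p
      exact Subtype.ext (twistWord_restrict s θ.unop (SSet.stdSimplex.objEquiv p.2)
        p.1.2.1 p.1.2.2) }

lemma evalSimplex_twist {k : SimplexCategory} (w : (nerve M).obj (Opposite.op k)) (t : k ⟶ n) :
    (evalSimplex (twist s) w t).1 = twistWord s w.1 (vertexSeq t) := by
  exact congrArg (fun t ↦ twistWord s w.1 (vertexSeq t))
    (SSet.stdSimplex.objEquiv.{u}.apply_symm_apply t)

lemma letter_twist (i j : Fin (n.len + 1)) (h : i ≤ j) (x : M) :
    letter (twist s) i j h x = prod [(s.vert i).1 x, (s.edge i j).1] := by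
  rw [letter, evalSimplex_twist]
  refine (twistWord_mem s (singleton_mem x) _).2.trans ?_
  rw [prod_singleton]
  rfl

lemma letter_twist_self (i : Fin (n.len + 1)) (x : M) :
    letter (twist s) i i le_rfl x = (s.vert i).1 x := by
  rw [letter_twist, s.edge_self, Normalizer.one_val]
  have := (prod_append_cons (u := [(s.vert i).1 x]) (v := []) (singleton_mem _)).2
  exact this.symm.trans (prod_singleton _)

lemma letter_twist_one (i j : Fin (n.len + 1)) (h : i ≤ j) :
    letter (twist s) i j h (prod []) = (s.edge i j).1 := by
  rw [letter_twist, Aut.map_one, prod_nil_cons (singleton_mem _), prod_singleton]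

variable (M) in
/-- The homomorphism from the simplicial group of the crossed module to the function complex. -/
def twistHom (n : SimplexCategory) :
    ActionSimplex (crossedModule M) n →* EndSimplex (nerve M) n where
  toFun := twist
  map_one' := letter_ext fun i j h x ↦ by
    rw [letter_twist, letter_one]
    exact (prod_append_cons (u := [x]) (v := []) (singleton_mem _)).2.symm.trans (prod_singleton _)
  map_mul' s t := letter_ext fun i j h x ↦ by
    rw [letter_mul, letter_twist, letter_twist, letter_twist, ActionSimplex.mul_vert,
      ActionSimplex.mul_edge]
    have h1 : [(t.vert i).1 x, (t.edge i j).1] ∈ dom := map_append_edge_mem t i j (singleton_mem x)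
    rw [← Aut.prod_map _ h1]
    -- The two sides are the two bracketings of this three-letter word.
    have h2 : [(s.vert i).1 ((t.vert i).1 x), (s.vert i).1 (t.edge i j).1, (s.edge i j).1] ∈ dom :=
      map_append_edge_mem s i j h1
    have h3 := (prod_cons_append (u := [(s.vert i).1 ((t.vert i).1 x),
      (s.vert i).1 (t.edge i j).1]) (v := [(s.edge i j).1]) h2).2
    have h4 := (prod_append_cons (u := [(s.vert i).1 ((t.vert i).1 x)])
      (v := [(s.vert i).1 (t.edge i j).1, (s.edge i j).1]) h2).2
    exact h4.symm.trans h3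

/-- Constant edges recover the vertices and the unit letter recovers the forward edges; backward
edges are their inverses. -/
lemma twistHom_injective (n : SimplexCategory) : Function.Injective (twistHom M n) := by
  intro s t hst
  replace hst : twist s = twist t := hst
  have hedge : ∀ i j, i ≤ j → s.edge i j = t.edge i j := fun i j h ↦ by
    apply Subtype.ext
    rw [← letter_twist_one s i j h, hst, letter_twist_one]
  apply ActionSimplex.ext
  · funext i
    apply Subtype.ext
    ext x
    rw [← letter_twist_self, hst, letter_twist_self]
  · funext i j
    rcases le_total i j with h | h
    · exact hedge i j h
    · rw [← s.edge_inv, ← t.edge_inv, hedge j i h]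

/-- The automorphism at a vertex of an invertible simplex of the function complex. -/
def letterAut (F : (EndSimplex (nerve M) n)ˣ) (i : Fin (n.len + 1)) : Aut M :=
  ⟨{ toFun := letter F.1 i i le_rfl
     invFun := letter F.2 i i le_rfl
     left_inv := fun x ↦ by rw [← letter_mul, F.4, letter_one]
     right_inv := fun x ↦ by rw [← letter_mul, F.3, letter_one] }, by
    refine ⟨fun w ↦ ⟨fun h ↦ ?_, fun h ↦ map_letter_mem F.1 i h⟩, fun w hw ↦
      prod_map_letter F.1 i hw⟩
    have h1 := map_letter_mem F.2 i h
    rw [List.map_map] at h1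
    convert h1
    refine (List.map_id'' (fun x ↦ ?_) w).symm
    change letter F.2 i i le_rfl (letter F.1 i i le_rfl x) = x
    rw [← letter_mul, F.4, letter_one]⟩

/-- Pull a word back by `β⁻¹` and apply `letter_intertwines` to two of its cuts, the given one and
the one in front of the first letter. Both products are the same letter value. Only the two ends
have to be automorphisms, so the lemma also applies to a homotopy not known to be invertible. -/
lemma intertwines_of_letter (F : EndSimplex (nerve M) n) {i j : Fin (n.len + 1)} (h : i ≤ j)
    {α β : Aut M} (hα : ∀ x, letter F i i le_rfl x = α.1 x)
    (hβ : ∀ x, letter F j j le_rfl x = β.1 x) :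
    Intertwines (α * β⁻¹) (letter F i j h (prod [])) := by
  have eα : letter F i i le_rfl = α.1 := funext hα
  have eβ : letter F j j le_rfl = β.1 := funext hβ
  intro u v huv
  have h0 : ∀ w : List M, (w.map (β⁻¹).1).map β.1 = w := fun w ↦ by simp [Function.comp_def]
  have h1 : ∀ w : List M, (w.map (β⁻¹).1).map α.1 = w.map (α * β⁻¹).1 := fun w ↦ by
    simp [Function.comp_def]
  have h2 := Aut.map_mem β⁻¹ huv
  have h3 := letter_intertwines F i j h (u := []) (v := (u ++ v).map (β⁻¹).1) h2
  rw [List.map_append] at h2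
  have h4 := letter_intertwines F i j h h2
  rw [eα, eβ, h0, h1] at h4
  rw [eα, eβ, h0] at h3
  refine ⟨h4.1, h4.2.trans ?_⟩
  rw [← List.map_append]
  exact h3.2.symm

/-- The normalizing element of an edge of an invertible simplex of the function complex. -/
def letterEdge (F : (EndSimplex (nerve M) n)ˣ) (i j : Fin (n.len + 1)) (h : i ≤ j) :
    Normalizer M :=
  ⟨letter F.1 i j h (prod []), (intertwines_of_letter F.1 h (α := letterAut F i)
    (β := letterAut F j) (fun _ ↦ rfl) (fun _ ↦ rfl)).isNormalizing⟩

lemma conjHom_letterEdge (F : (EndSimplex (nerve M) n)ˣ) (i j : Fin (n.len + 1)) (h : i ≤ j) :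
    conjHom M (letterEdge F i j h) * letterAut F j = letterAut F i := by
  rw [Intertwines.conjHom_eq (η := letterEdge F i j h) (intertwines_of_letter F.1 h
    (α := letterAut F i) (β := letterAut F j) (fun _ ↦ rfl) (fun _ ↦ rfl)), inv_mul_cancel_right]

/-- Evaluate `F` on the word `[1|1]` over the triangle `i, j, l`: its letters go to the two edge
elements, and its product, again the unit, goes to the third. -/
lemma letterEdge_mul (F : (EndSimplex (nerve M) n)ˣ) (i j l : Fin (n.len + 1)) (h : i ≤ j)
    (h' : j ≤ l) : letterEdge F i j h * letterEdge F j l h' = letterEdge F i l (h.trans h') := by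
  apply Subtype.ext
  have h1 : [prod [], prod []] ∈ (dom : Set (List M)) :=
    (insert_one (u := []) (v := [prod []]) (singleton_mem _)).1
  let w := wordSimplex (k := ⦋2⦌) _ h1 rfl
  let t : ⦋2⦌ ⟶ n := vecHom ![i, j, l] (monotone_vec_three h h')
  have hl : (evalSimplex F.1 w t).1.length = 2 := (evalSimplex F.1 w t).2.2
  have e : (evalSimplex F.1 w t).1 = [(letterEdge F i j h).1, (letterEdge F j l h').1] := by
    refine List.ext_getElem hl fun r hr hr' ↦ ?_
    have hr2 : r < 2 := hr'
    rw [getElem_evalSimplex F.1 w t r hr hr' hr']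
    interval_cases r <;> rfl
  rw [Normalizer.mul_val, ← e, prod_evalSimplex]
  refine letter_congr F.1 _ rfl rfl ?_
  change _ = prod [prod [], prod []]
  rw [prod_nil_cons (singleton_mem _), prod_singleton]

/-- By `letter_eq` every letter value is a vertex automorphism times an edge element, so the data at
vertices and edges reconstruct `F`. Edge elements for arbitrary pairs are defined through the vertex
`0`. -/
lemma exists_twistHom_eq (F : (EndSimplex (nerve M) n)ˣ) : ∃ s, twistHom M n s = F.1 := by
  have hedge : ∀ i j (h : i ≤ j), (letterEdge F 0 i (Fin.zero_le i))⁻¹ *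
      letterEdge F 0 j (Fin.zero_le j) = letterEdge F i j h := fun i j h ↦ by
    rw [← letterEdge_mul F 0 i j (Fin.zero_le i) h, inv_mul_cancel_left]
  refine ⟨{ vert := letterAut F
            edge := fun i j ↦ (letterEdge F 0 i (Fin.zero_le i))⁻¹ *
              letterEdge F 0 j (Fin.zero_le j)
            edge_mul := fun i j l ↦ by group
            bd_edge := fun i j ↦ ?_ }, letter_ext fun i j h x ↦ ?_⟩
  · change conjHom M _ * _ = _
    rw [map_mul, map_inv, mul_assoc, conjHom_letterEdge, ← conjHom_letterEdge F 0 i (Fin.zero_le i),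
      inv_mul_cancel_left]
  · refine (letter_twist _ i j h x).trans ?_
    dsimp only
    rw [hedge i j h, letter_eq F.1 i j h x]
    rfl

variable (M) in
/-- The crossed module computes the simplices of the simplicial group of automorphisms. -/
noncomputable def twistEquiv (k : SimplexCategory) :
    ActionSimplex (crossedModule M) k ≃* (EndSimplex (nerve M) k)ˣ :=
  MulEquiv.ofBijective (twistHom M k).toHomUnits
    ⟨fun s t h ↦ twistHom_injective k (congrArg Units.val h), fun F ↦ by
      obtain ⟨s, hs⟩ := exists_twistHom_eq F
      exact ⟨s, Units.ext hs⟩⟩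

variable (M) in
/-- The simplicial group of automorphisms of a partial group is modelled on its crossed module. -/
noncomputable def autModel : Model (crossedModule M) (autGroup (nerve M)) where
  equiv k := (twistEquiv M k).symm
  equiv_map {k k'} θ g := by
    obtain ⟨s, rfl⟩ := (twistEquiv M k).surjective g
    refine ((twistEquiv M k').symm_apply_eq).2 ?_
    refine Eq.trans ?_ (congrArg (fun s ↦ twistEquiv M k' (s.restrict θ))
      ((twistEquiv M k).symm_apply_apply s).symm)
    exact Units.ext (letter_ext fun i j h x ↦ rfl)

end

end PartialGroup

namespace PartialGroup

open MonoidalCategory CartesianMonoidalCategory CrossedModule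

section

variable {M : Type u} [PartialGroup M]

/-! ### Inner automorphisms -/

lemma homotopic_conjHom (η : Normalizer M) : Homotopic (nerveMap (conjHom M η)) (𝟙 (nerve M)) := by
  let s : ActionSimplex (crossedModule M) ⦋1⦌ :=
    -- The labels `1` and `η` give the vertices `conjHom M η` and `(conjHom M η)⁻¹ * conjHom M η =
    -- 1`.
    ActionSimplex.cone (crossedModule M) ⦋1⦌ (conjHom M η) ![1, η]
  have h0 : s.vert (0 : Fin 2) = conjHom M η := by
    change (conjHom M (1 : Normalizer M))⁻¹ * conjHom M η = _
    rw [map_one, inv_one, one_mul]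
  have h1 : s.vert (1 : Fin 2) = 1 := inv_mul_cancel (conjHom M η)
  have key : ∀ (i : Fin 2) {k : SimplexCategory} (w : (nerve M).obj (Opposite.op k)),
      (evalSimplex (twist s) w (SimplexCategory.const k ⦋1⦌ i)).1 = w.1.map (s.vert i).1 :=
    fun i k w ↦ (evalSimplex_const (twist s) w i).trans
      (List.map_congr_left fun x _ ↦ letter_twist_self s i x)
  refine ⟨twist s, ?_, ?_⟩
  · ext k w
    refine Subtype.ext ((key 0 w).trans ?_)
    rw [h0]
    rfl
  · ext k w
    refine Subtype.ext ((key 1 w).trans ?_)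
    rw [h1]
    exact List.map_id _

/-- The element is the value of the homotopy on the unit over the nondegenerate edge of `Δ[1]`; it
intertwines the two ends `α` and `1`. -/
lemma exists_conjHom_eq {α : Aut M} (h : Homotopic (nerveMap α) (𝟙 (nerve M))) :
    ∃ η, conjHom M η = α := by
  obtain ⟨F, h0, h1⟩ := h
  let F' : EndSimplex (nerve M) ⦋1⦌ := F
  have e0 : ∀ x, letter F' (0 : Fin 2) (0 : Fin 2) le_rfl x = α.1 x := fun x ↦ by
    have := congrArg (fun f : nerve M ⟶ nerve M ↦ (f.app (Opposite.op ⦋1⦌)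
      (wordSimplex (k := ⦋1⦌) [x] (singleton_mem x) rfl)).1) h0
    exact (List.cons.inj ((evalSimplex_const F' (wordSimplex (k := ⦋1⦌) [x] (singleton_mem x) rfl)
      (0 : Fin 2)).symm.trans this)).1
  have e1 : ∀ x, letter F' (1 : Fin 2) (1 : Fin 2) le_rfl x = (1 : Aut M).1 x := fun x ↦ by
    have := congrArg (fun f : nerve M ⟶ nerve M ↦ (f.app (Opposite.op ⦋1⦌)
      (wordSimplex (k := ⦋1⦌) [x] (singleton_mem x) rfl)).1) h1
    exact (List.cons.inj ((evalSimplex_const F' (wordSimplex (k := ⦋1⦌) [x] (singleton_mem x) rfl)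
      (1 : Fin 2)).symm.trans this)).1
  have h2 := intertwines_of_letter F' (i := (0 : Fin 2)) (j := (1 : Fin 2)) (by decide) e0 e1
  rw [inv_one, mul_one] at h2
  exact ⟨⟨_, h2.isNormalizing⟩, Intertwines.conjHom_eq h2⟩

lemma mem_Inn_iff (α : Aut M) : α ∈ Inn M ↔ ∃ η, conjHom M η = α :=
  ⟨exists_conjHom_eq, fun ⟨η, h⟩ ↦ h ▸ homotopic_conjHom η⟩

lemma conjHom_eq_one_iff_exists_center (η : Normalizer M) :
    conjHom M η = 1 ↔ ∃ z, (Center M).subtype z = η := by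
  rw [conjHom_eq_one_iff]
  exact ⟨fun h ↦ ⟨⟨η, h⟩, rfl⟩, fun ⟨z, h⟩ ↦ h ▸ z.2⟩

/-! ### Transport along isomorphisms -/

lemma IsKanFibration.iso_comp {E E' B : SSet.{u}} (e : E' ≅ E) {p : E ⟶ B}
    (hp : IsKanFibration p) : IsKanFibration (e.hom ≫ p) :=
  (MorphismProperty.cancel_left_of_respectsIso SSet.modelCategoryQuillen.J.rlp e.hom p).2 hp

/-- The fibres of a map do not change under an isomorphism of its source. -/
def fiberIso {E E' B : SSet.{u}} (e : E' ≅ E) (p : E ⟶ B) (b : B _⦋0⦌) :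
    (fiber (e.hom ≫ p) b : SSet.{u}) ≅ (fiber p b : SSet.{u}) where
  hom := SSet.Subcomplex.lift ((fiber (e.hom ≫ p) b).ι ≫ e.hom) (by
    rintro n _ ⟨⟨x, hx⟩, rfl⟩
    exact hx)
  inv := SSet.Subcomplex.lift ((fiber p b).ι ≫ e.inv) (by
    rintro n _ ⟨⟨x, hx⟩, rfl⟩
    change (e.inv ≫ e.hom ≫ p).app n x ∈ (SSet.Subcomplex.ofSimplex b).obj n
    rw [e.inv_hom_id_assoc]
    exact hx)
  hom_inv_id := by
    ext n ⟨x, hx⟩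
    have := congrArg (fun f : E' ⟶ E' ↦ f.app n x) e.hom_inv_id
    exact Subtype.ext this
  inv_hom_id := by
    ext n ⟨x, hx⟩
    have := congrArg (fun f : E ⟶ E ↦ f.app n x) e.inv_hom_id
    exact Subtype.ext this

end

end PartialGroup

/-! ### The main theorem. -/

theorem mainTheorem10 (M : Type u) [PartialGroup M] :
    (∀ c : SSet.π₀ (PartialGroup.underlying (PartialGroup.autGroup (PartialGroup.nerve M))),
      PartialGroup.HomotopyEquivalent (PartialGroup.component c)
        (PartialGroup.classifyingSpace (PartialGroup.Center M))) ∧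
    (∃ p : PartialGroup.WBar (PartialGroup.autGroup (PartialGroup.nerve M)) ⟶
        PartialGroup.classifyingSpace (PartialGroup.Out M),
      PartialGroup.IsKanFibration p ∧
      ∀ b, PartialGroup.HomotopyEquivalent (PartialGroup.fiber p b)
        (PartialGroup.WBar (PartialGroup.barGroup (PartialGroup.Center M)))) ∧
    (Function.Injective (PartialGroup.Center M).subtype ∧
      (PartialGroup.Center M).subtype.range = (PartialGroup.conjHom M).ker ∧
      (PartialGroup.conjHom M).range = (QuotientGroup.mk' (PartialGroup.Inn M)).ker ∧
      Function.Surjective (QuotientGroup.mk' (PartialGroup.Inn M))) := by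
  open PartialGroup CrossedModule in
  have hι : Function.Injective (Center M).subtype := (Center M).subtype_injective
  have hker (η : Normalizer M) : (crossedModule M).bd η = 1 ↔ ∃ z, (Center M).subtype z = η :=
    conjHom_eq_one_iff_exists_center η
  have hbd (α : PartialGroup.Aut M) :
      QuotientGroup.mk' (Inn M) α = 1 ↔ ∃ η, (crossedModule M).bd η = α :=
    (QuotientGroup.eq_one_iff α).trans (mem_Inn_iff α)
  have hb (η : Normalizer M) : QuotientGroup.mk' (Inn M) ((crossedModule M).bd η) = 1 :=
    (hbd _).2 ⟨η, rfl⟩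
  refine ⟨fun c ↦ homotopyEquivalent_component (Center M).subtype hι hker (autModel M)
    (barModel (Center M)) c, ⟨(autModel M).wBarIso.hom ≫
      toBar (crossedModule M) (QuotientGroup.mk' (Inn M)) hb,
    (isKanFibration_toBar _ _ hb (QuotientGroup.mk'_surjective _)).iso_comp _, fun b ↦ ?_⟩,
    hι, ?_, ?_, QuotientGroup.mk'_surjective _⟩
  -- Both sides become spaces of cocycles: the fibre is transported along `wBarIso`, and `B²Z(M)` is
  -- the space of cocycles with values in the abelian group `Z(M)`.
  · exact homotopyEquivalent_of_iso_right (barModel (Center M)).wBarIso.symm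
      (homotopyEquivalent_of_iso (fiberIso _ _ b)
        (homotopyEquivalent_fiber (Center M).subtype hι hker _ hbd hb b))
  · ext η
    exact (hker η).symm
  · ext α
    exact (hbd α).symm
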